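/- Let $\mathcal L\not\equiv 0$ belong to the extended Selberg class $\mathbf S^\sharp$, that is: (S1) $\mathcal L(s)=\sum_{n\ge1}a_n n^{-s}$ converges absolutely for $\Re(s)>1$; (S2) for some integer $k\ge0$, $(s-1)^k\mathcal L(s)$ continues to an entire function of finite order; write $k(\mathcal L)$ for the smallest such $k$; (S3) there are $c,Q>0$, $W\in\mathbb C$ with $|W|=1$, an integer $f\ge1$, $\lambda_j>0$ and $\mu_j\in\mathbb C$ with $\Re(\mu_j)\ge0$ $(1\le j\le f)$ such that, with $\gamma_{\mathcal L}(s)=\prod_{j=1}^f\Gamma(\lambda_js+\mu_j)$, the function $\Lambda_{\mathcal L}(s)=c\,Q^s\gamma_{\mathcal L}(s)\mathcal L(s)$ satisfies $\Lambda_{\mathcal L}(s)=W\,\overline{\Lambda_{\mathcal L}(1-\overline s)}$ as meromorphic functions. Fix any such functional equation data. Let $\varrho$ run over the non-trivial zeros of $\mathcal L$, i.e. the zeros of the meromorphic function $\Lambda_{\mathcal L}$, counted with multiplicity. Sums over $\varrho$ are taken in the principal-value sense $\lim_{T\to+\infty}\sum_{|\Im\varrho|\le T}$, where each partial sum is finite.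 Then: (i) For every $s$ at which none of the terms $\frac{\mathcal L'}{\mathcal L}(s)$, $\frac{k(\mathcal L)}{s}$, $\frac{k(\mathcal L)}{s-1}$, $\frac{\gamma_{\mathcal L}'}{\gamma_{\mathcal L}}(s)$ has a pole, the sum $\sum_\varrho\frac1{s-\varrho}$ converges and $$\frac{\mathcal L'}{\mathcal L}(s)+\frac{k(\mathcal L)}{s}+\frac{k(\mathcal L)}{s-1}=\sum_{\varrho}\frac1{s-\varrho}-\log Q-\frac{\gamma_{\mathcal L}'}{\gamma_{\mathcal L}}(s).$$ (ii) There are constants $A,B\in\mathbb C$ for which the Hadamard factorization $$(s(1-s))^{k(\mathcal L)}\Lambda_{\mathcal L}(s)=s^{m_0}(1-s)^{m_1}e^{A+Bs}\prod_{\varrho\ne0,1}\Bigl(1-\frac s\varrho\Bigr)e^{s/\varrho}$$ holds, the product converging unconditionally, where $m_0-k(\mathcal L)$ and $m_1-k(\mathcal L)$ are the orders of $\Lambda_{\mathcal L}$ at $s=0$ and $s=1$ (negative at a pole). For any such $A,B$, the sum $\sum_{\varrho\ne0,1}\frac1\varrho$ converges and $$B+\sum_{\varrho\neq0,1}\frac1\varrho=0$$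 exactly, not merely in real part. -/

import Mathlib

open Filter Topology ComplexConjugate

noncomputable section

namespace Selberg

/-- An entire function of finite order: `g` is holomorphic on `ℂ` and
`g(z) = O(exp(|z|^A))` for some `A ≥ 0`. -/
def EntireOfFiniteOrder (g : ℂ → ℂ) : Prop :=
  Differentiable ℂ g ∧ ∃ A C : ℝ, 0 ≤ A ∧ ∀ z : ℂ, ‖g z‖ ≤ C * Real.exp (‖z‖ ^ A)

/-- `(s - 1)^k L(s)` is (after removing a singularity at `s = 1`) entire of finite order. -/
def ClearsPole (L : ℂ → ℂ) (k : ℕ) : Prop :=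
  ∃ g : ℂ → ℂ, EntireOfFiniteOrder g ∧ ∀ s : ℂ, s ≠ 1 → g s = (s - 1) ^ k * L s

/-- `k(L)`: the smallest `k ≥ 0` such that `(s - 1)^k L(s)` is entire of finite order. -/
def poleOrder (L : ℂ → ℂ) : ℕ := sInf {k : ℕ | ClearsPole L k}

/-- The parameters of a functional equation: `c, Q > 0`, `|W| = 1`, and a Gamma factor with
`f ≥ 1` factors `Γ(λ_j s + μ_j)`, where `λ_j > 0` and `Re μ_j ≥ 0`. -/
structure GammaData where
  c : ℝ
  Q : ℝ
  W : ℂ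
  f : ℕ
  lam : Fin f → ℝ
  mu : Fin f → ℂ
  c_pos : 0 < c
  Q_pos : 0 < Q
  norm_W : ‖W‖ = 1
  one_le_f : 1 ≤ f
  lam_pos : ∀ j, 0 < lam j
  mu_re : ∀ j, 0 ≤ (mu j).re

namespace GammaData

variable (D : GammaData)

/-- The Gamma factor `γ(s) = ∏_j Γ(λ_j s + μ_j)`. -/
def gammaFactor (s : ℂ) : ℂ := ∏ j, Complex.Gamma ((D.lam j : ℂ) * s + D.mu j)

/-- `s` is not a pole of the Gamma factor. (At poles `Complex.Gamma` has the value `0`, so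
pointwise identities involving `gammaFactor` are only required off the poles.) -/
def Regular (s : ℂ) : Prop := ∀ (j : Fin D.f) (n : ℕ), (D.lam j : ℂ) * s + D.mu j ≠ -(n : ℂ)

/-- The completed function `Λ(s) = c Q^s γ(s) L(s)`. -/
def completed (L : ℂ → ℂ) (s : ℂ) : ℂ := D.c * (D.Q : ℂ) ^ s * D.gammaFactor s * L s

/-- The functional equation `Λ(s) = W * conj (Λ(1 - conj s))`, an identity of meromorphic
functions, required at the points where all the factors on both sides are holomorphic. -/
def FunctionalEquation (L : ℂ → ℂ) : Prop :=
  ∀ s : ℂ, s ≠ 0 → s ≠ 1 → D.Regular s → D.Regular (1 - conj s) →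
    D.completed L s = D.W * conj (D.completed L (1 - conj s))

/-- The non-trivial zeros of `L`: the zeros of the meromorphic function `Λ`. -/
def zeros (L : ℂ → ℂ) : Set ℂ := {ρ | 0 < meromorphicOrderAt (D.completed L) ρ}

/-- The order of the meromorphic function `Λ` at `ρ`, as an integer. -/
def order (L : ℂ → ℂ) (ρ : ℂ) : ℤ := (meromorphicOrderAt (D.completed L) ρ).untop₀

/-- The multiplicity of a non-trivial zero `ρ`. -/
def mult (L : ℂ → ℂ) (ρ : ℂ) : ℕ := (D.order L ρ).toNat

/-- `A, B` are the constants of the Hadamard factorization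
`(s(1-s))^k Λ(s) = s^{m₀} (1-s)^{m₁} e^{A+Bs} ∏_{ρ ≠ 0,1} (1 - s/ρ) e^{s/ρ}`,
where `k = k(L)`, `m₀ - k` and `m₁ - k` are the orders of `Λ` at `0` and `1`, and the product
over the non-trivial zeros (with multiplicity) converges unconditionally. -/
def IsHadamardFactorization (L : ℂ → ℂ) (A B : ℂ) : Prop :=
  ∀ s : ℂ, s ≠ 0 → s ≠ 1 → D.Regular s →
    ∃ P : ℂ,
      HasProd (fun ρ : ↥(D.zeros L \ {0, 1}) =>
        ((1 - s / (ρ : ℂ)) * Complex.exp (s / (ρ : ℂ))) ^ D.mult L ρ) P ∧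
      (s * (1 - s)) ^ poleOrder L * D.completed L s =
        s ^ (D.order L 0 + poleOrder L) * (1 - s) ^ (D.order L 1 + poleOrder L) *
          Complex.exp (A + B * s) * P

end GammaData

/-- `L` is a function in the extended Selberg class, given by the Dirichlet series `∑ a_n n^{-s}`
for `Re s > 1` and by its continuation elsewhere. If `k(L) = 0` there is no pole, and the
continuation is required to be holomorphic at `1` too; otherwise `L 1` is irrelevant. -/
structure ExtendedSelbergClass (a : ℕ → ℂ) (L : ℂ → ℂ) : Prop where
  summable : ∀ s : ℂ, 1 < s.re → LSeriesSummable a s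
  eq_series : ∀ s : ℂ, 1 < s.re → L s = LSeries a s
  continuation : ∃ k : ℕ, ClearsPole L k
  entire : poleOrder L = 0 → Differentiable ℂ L
  functional_equation : ∃ D : GammaData, D.FunctionalEquation L

/-- The sum of `F(ρ)` over `ρ ∈ Z`, each counted `m(ρ)` times, converges to `S` in the
principal-value sense `lim_{T → ∞} ∑_{|Im ρ| ≤ T}` (each partial sum being finite). -/
def HasPVSum (Z : Set ℂ) (m : ℂ → ℕ) (F : ℂ → ℂ) (S : ℂ) : Prop :=
  (∀ T : ℝ, {ρ ∈ Z | |ρ.im| ≤ T}.Finite) ∧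
    Tendsto (fun T : ℝ => ∑ᶠ ρ ∈ {ρ ∈ Z | |ρ.im| ≤ T}, (m ρ : ℂ) * F ρ) atTop (𝓝 S)

end Selberg

end

noncomputable section

namespace Selberg

/-- Growth of order at most `3/2`. -/
def GrowthBound (g : ℂ → ℂ) : Prop :=
  ∃ C : ℝ, ∀ z : ℂ, ‖g z‖ ≤ Real.exp (C * (1 + ‖z‖) ^ (3 / 2 : ℝ))

theorem analyticOrderAt_sub_pow_self (ρ : ℂ) (n : ℕ) :
    analyticOrderAt (fun z : ℂ => (z - ρ) ^ n) ρ = n := by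
  rw [AnalyticAt.analyticOrderAt_eq_natCast (by fun_prop)]
  exact ⟨fun _ => 1, by fun_prop, one_ne_zero, by simp⟩

theorem exists_eq_sub_pow_mul {g : ℂ → ℂ} (hg : Differentiable ℂ g) (ρ : ℂ) (n : ℕ)
    (h : (n : ℕ∞) ≤ analyticOrderAt g ρ) :
    ∃ q : ℂ → ℂ, Differentiable ℂ q ∧ ∀ z, g z = (z - ρ) ^ n * q z := by
  induction n with
  | zero => exact ⟨g, hg, by simp⟩
  | succ n ih =>
    obtain ⟨q, hq, hgq⟩ := ih (le_trans (by norm_cast; omega) h)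
    have hord : analyticOrderAt g ρ = n + analyticOrderAt q ρ := by
      have : g = (fun z : ℂ => (z - ρ) ^ n) * q := funext hgq
      rw [this, analyticOrderAt_mul (by fun_prop) (hq.analyticAt ρ), analyticOrderAt_sub_pow_self]
    have hq0 : q ρ = 0 := by
      refine apply_eq_zero_of_analyticOrderAt_ne_zero fun h0 => ?_
      rw [hord, h0, add_zero] at h
      norm_cast at h
      omega
    refine ⟨dslope q ρ, ?_, fun z => ?_⟩
    · rw [← differentiableOn_univ] at hq ⊢
      exact (Complex.differentiableOn_dslope univ_mem).2 hq
    · have := sub_smul_dslope q ρ z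
      rw [smul_eq_mul, hq0, sub_zero] at this
      rw [hgq, ← this]
      ring

theorem analyticOrderAt_ne_top {g : ℂ → ℂ} (hg : Differentiable ℂ g) (hne : g ≠ 0) (z : ℂ) :
    analyticOrderAt g z ≠ ⊤ := by
  intro h
  apply hne
  exact (AnalyticOnNhd.analyticOrderAt_eq_top_iff_eq_zero z fun w => hg.analyticAt w).1 h

theorem exists_eq_prod_sub_pow_mul {g : ℂ → ℂ} (hg : Differentiable ℂ g) (hne : g ≠ 0)
    (S : Finset ℂ) :
    ∃ q : ℂ → ℂ, Differentiable ℂ q ∧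
      (∀ z, g z = (∏ ρ ∈ S, (z - ρ) ^ analyticOrderNatAt g ρ) * q z) ∧ ∀ ρ ∈ S, q ρ ≠ 0 := by
  classical
  induction S using Finset.induction_on with
  | empty => exact ⟨g, hg, by simp, by simp⟩
  | insert ρ S hρ ih =>
    obtain ⟨q, hq, hgq, hqS⟩ := ih
    set p : ℂ → ℂ := fun z => ∏ ρ ∈ S, (z - ρ) ^ analyticOrderNatAt g ρ with hp
    have hpd : Differentiable ℂ p := by fun_prop
    have hpρ : p ρ ≠ 0 := by
      simp only [hp]
      exact Finset.prod_ne_zero_iff.2 fun σ hσ =>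
        pow_ne_zero _ (sub_ne_zero.2 fun h => hρ (h ▸ hσ))
    have hgpq : g = p * q := funext hgq
    have hord : analyticOrderAt g ρ = analyticOrderAt q ρ := by
      conv_lhs => rw [hgpq]
      rw [analyticOrderAt_mul (hpd.analyticAt ρ) (hq.analyticAt ρ),
        (hpd.analyticAt ρ).analyticOrderAt_eq_zero.2 hpρ, zero_add]
    have hnat : (analyticOrderNatAt g ρ : ℕ∞) = analyticOrderAt q ρ := by
      rw [Nat.cast_analyticOrderNatAt (analyticOrderAt_ne_top hg hne ρ), hord]
    obtain ⟨r, hr, hqr⟩ := exists_eq_sub_pow_mul hq ρ _ hnat.le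
    refine ⟨r, hr, fun z => ?_, fun σ hσ => ?_⟩
    · rw [Finset.prod_insert hρ, hgq, hqr]
      ring
    · rcases Finset.mem_insert.1 hσ with rfl | hσ
      · intro h0
        have h1 : analyticOrderAt q σ = analyticOrderNatAt g σ + analyticOrderAt r σ := by
          conv_lhs => rw [show q = (fun z : ℂ => (z - σ) ^ analyticOrderNatAt g σ) * r
            from funext hqr]
          rw [analyticOrderAt_mul (by fun_prop) (hr.analyticAt σ), analyticOrderAt_sub_pow_self]
        have h2 : analyticOrderAt r σ ≠ 0 := (hr.analyticAt σ).analyticOrderAt_ne_zero.2 h0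
        rw [← hnat] at h1
        have h3 : (analyticOrderNatAt g σ : ℕ∞) ≠ ⊤ := ENat.natCast_ne_top _
        have : analyticOrderAt r σ = 0 := by
          exact ENat.add_right_injective_of_ne_top h3 (by simpa using h1.symm)
        exact h2 this
      · intro h0
        exact hqS σ hσ (by rw [hqr, h0, mul_zero])

theorem exists_eq_prod_one_sub_div_pow_mul {g : ℂ → ℂ} (hg : Differentiable ℂ g) (hne : g ≠ 0)
    (S : Finset ℂ) (hS : (0 : ℂ) ∉ S) :
    ∃ q : ℂ → ℂ, Differentiable ℂ q ∧
      (∀ z, g z = (∏ ρ ∈ S, (1 - z / ρ) ^ analyticOrderNatAt g ρ) * q z) ∧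
      ∀ ρ ∈ S, q ρ ≠ 0 := by
  obtain ⟨q, hq, hgq, hqS⟩ := exists_eq_prod_sub_pow_mul hg hne S
  have h0 : ∀ ρ ∈ S, ρ ≠ 0 := fun ρ hρ h => hS (h ▸ hρ)
  refine ⟨fun z => (∏ ρ ∈ S, (-ρ) ^ analyticOrderNatAt g ρ) * q z, by fun_prop, fun z => ?_,
    fun ρ hρ => mul_ne_zero (Finset.prod_ne_zero_iff.2 fun σ hσ =>
      pow_ne_zero _ (neg_ne_zero.2 (h0 σ hσ))) (hqS ρ hρ)⟩
  rw [hgq, ← mul_assoc, ← Finset.prod_mul_distrib]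
  congr 1
  refine Finset.prod_congr rfl fun ρ hρ => ?_
  rw [← mul_pow]
  congr 1
  field_simp [h0 ρ hρ]
  ring

theorem finite_zeros_inter_closedBall {g : ℂ → ℂ} (hg : Differentiable ℂ g) (hne : g ≠ 0)
    (R : ℝ) : {ρ | g ρ = 0 ∧ ‖ρ‖ ≤ R}.Finite := by
  have hz : ∃ x, g x ≠ 0 := by
    by_contra! h
    exact hne (funext h)
  obtain ⟨x, hx⟩ := hz
  have h1 := AnalyticOnNhd.preimage_zero_mem_codiscrete (f := g)
    (fun w _ => hg.analyticAt w) hx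
  have h2 : (g ⁻¹' {0})ᶜᶜ ∩ Metric.closedBall 0 R = {ρ | g ρ = 0 ∧ ‖ρ‖ ≤ R} := by
    ext; simp
  rw [← h2, Set.inter_comm, ← Set.sdiff_eq]
  exact (isCompact_closedBall (0 : ℂ) R).finite_sdiff_of_mem_codiscreteWithin
    (Filter.codiscreteWithin_mono (Set.subset_univ _) h1)

theorem norm_mul_three_pow_le {g q : ℂ → ℂ} {m : ℂ → ℕ} {C R : ℝ} (hR : 0 < R) {S : Finset ℂ}
    (hS : ∀ ρ ∈ S, ρ ≠ 0 ∧ ‖ρ‖ ≤ R) (hq : Differentiable ℂ q)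
    (hgq : ∀ z, g z = (∏ ρ ∈ S, (1 - z / ρ) ^ m ρ) * q z)
    (hC : ∀ z, ‖z‖ ≤ 4 * R → ‖g z‖ ≤ C) {z : ℂ} (hz : ‖z‖ ≤ 4 * R) :
    ‖q z‖ * 3 ^ (∑ ρ ∈ S, m ρ) ≤ C := by
  have h1 : ∀ w ∈ frontier (Metric.ball (0 : ℂ) (4 * R)),
      ‖q w‖ ≤ C / 3 ^ (∑ ρ ∈ S, m ρ) := by
    intro w hw
    rw [frontier_ball _ (by positivity), mem_sphere_zero_iff_norm] at hw
    rw [le_div_iff₀ (by positivity)]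
    refine le_trans ?_ (hC w hw.le)
    rw [hgq, norm_mul, mul_comm, norm_prod, ← Finset.prod_pow_eq_pow_sum]
    gcongr with ρ hρ
    rw [norm_pow]
    gcongr
    obtain ⟨hρ0, hρR⟩ := hS ρ hρ
    have h2 : 4 ≤ ‖w / ρ‖ := by
      rw [norm_div, hw, le_div_iff₀ (norm_pos_iff.2 hρ0)]
      linarith
    have h3 := norm_sub_norm_le (w / ρ) 1
    rw [norm_one, norm_sub_rev] at h3
    linarith
  have h2 := Complex.norm_le_of_forall_mem_frontier_norm_le Metric.isBounded_ball
    hq.diffContOnCl h1 (z := z)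
    (by rw [closure_ball _ (by positivity)]; simpa using hz)
  rwa [le_div_iff₀ (by positivity)] at h2

theorem GrowthBound.exists_nonneg {g : ℂ → ℂ} (h : GrowthBound g) :
    ∃ C : ℝ, 0 ≤ C ∧ ∀ R : ℝ, 0 ≤ R → ∀ z : ℂ, ‖z‖ ≤ 4 * R →
      ‖g z‖ ≤ Real.exp (C * (1 + R) ^ (3 / 2 : ℝ)) := by
  obtain ⟨C, hC⟩ := h
  refine ⟨8 * |C|, by positivity, fun R hR z hz => (hC z).trans (Real.exp_le_exp.2 ?_)⟩
  have h8 : (8 : ℝ) = 4 ^ (3 / 2 : ℝ) := by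
    rw [show (4 : ℝ) = 2 ^ (2 : ℝ) by norm_num, ← Real.rpow_mul (by norm_num)]
    norm_num
  calc C * (1 + ‖z‖) ^ (3 / 2 : ℝ) ≤ |C| * (4 * (1 + R)) ^ (3 / 2 : ℝ) := by
        gcongr
        · exact le_abs_self C
        · linarith
    _ = 8 * |C| * (1 + R) ^ (3 / 2 : ℝ) := by
        rw [Real.mul_rpow (by norm_num) (by positivity), ← h8]
        ring

theorem exists_sum_order_le {g : ℂ → ℂ} (hg : Differentiable ℂ g) (h0 : g 0 ≠ 0)
    (hgr : GrowthBound g) :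
    ∃ K : ℝ, 0 ≤ K ∧ ∀ R : ℝ, 0 ≤ R → ∀ S : Finset ℂ, (∀ ρ ∈ S, ‖ρ‖ ≤ R) →
      (∑ ρ ∈ S, analyticOrderNatAt g ρ : ℝ) ≤ K * (1 + R) ^ (3 / 2 : ℝ) := by
  classical
  have hne : g ≠ 0 := fun h => h0 (by simp [h])
  obtain ⟨C, hC0, hC⟩ := hgr.exists_nonneg
  have hm0 : analyticOrderNatAt g 0 = 0 := by
    rw [analyticOrderNatAt, (hg.analyticAt 0).analyticOrderAt_eq_zero.2 h0]
    rfl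
  refine ⟨8 * C + |Real.log ‖g 0‖|, by positivity, fun R hR S hS => ?_⟩
  have hS' : ∀ ρ ∈ S.erase 0, ρ ≠ 0 ∧ ‖ρ‖ ≤ 1 + R := fun ρ hρ =>
    ⟨(Finset.mem_erase.1 hρ).1, (hS ρ (Finset.mem_erase.1 hρ).2).trans (by linarith)⟩
  obtain ⟨q, hq, hgq, -⟩ := exists_eq_prod_one_sub_div_pow_mul hg hne (S.erase 0) (by simp)
  have h1 := norm_mul_three_pow_le (by linarith) hS' hq hgq (hC (1 + R) (by linarith)) (z := 0)
    (by simp; linarith)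
  have hq0 : q 0 = g 0 := by simp [hgq]
  have hsum : ∑ ρ ∈ S.erase 0, analyticOrderNatAt g ρ = ∑ ρ ∈ S, analyticOrderNatAt g ρ :=
    Finset.sum_erase _ hm0
  rw [hq0, hsum] at h1
  have hg0 : 0 < ‖g 0‖ := norm_pos_iff.2 h0
  have h2 := Real.log_le_log (by positivity) h1
  rw [Real.log_exp, Real.log_mul hg0.ne' (by positivity), Real.log_pow] at h2
  have h3 : 1 ≤ Real.log 3 := by
    rw [Real.le_log_iff_exp_le (by norm_num)]
    exact Real.exp_one_lt_three.le
  have h4 : (1 + (1 + R)) ^ (3 / 2 : ℝ) ≤ 8 * (1 + R) ^ (3 / 2 : ℝ) := by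
    have h8 : (8 : ℝ) = 4 ^ (3 / 2 : ℝ) := by
      rw [show (4 : ℝ) = 2 ^ (2 : ℝ) by norm_num, ← Real.rpow_mul (by norm_num)]
      norm_num
    rw [h8, ← Real.mul_rpow (by norm_num) (by positivity)]
    gcongr
    linarith
  have h5 : 1 ≤ (1 + R) ^ (3 / 2 : ℝ) := Real.one_le_rpow (by linarith) (by norm_num)
  have h6 : (∑ ρ ∈ S, analyticOrderNatAt g ρ : ℝ) ≤
      ((∑ ρ ∈ S, analyticOrderNatAt g ρ : ℕ) : ℝ) * Real.log 3 := by
    push_cast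
    exact le_mul_of_one_le_right (by positivity) h3
  have h7 := neg_abs_le (Real.log ‖g 0‖)
  calc (∑ ρ ∈ S, analyticOrderNatAt g ρ : ℝ)
      ≤ C * (1 + (1 + R)) ^ (3 / 2 : ℝ) + |Real.log ‖g 0‖| := by linarith
    _ ≤ C * (8 * (1 + R) ^ (3 / 2 : ℝ)) + |Real.log ‖g 0‖| * (1 + R) ^ (3 / 2 : ℝ) := by
        gcongr
        exact le_mul_of_one_le_right (by positivity) h5
    _ = _ := by ring

theorem summable_div_sq_of_sum_le {m : ℂ → ℕ} {K : ℝ} (hK : 0 ≤ K)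
    (h : ∀ R : ℝ, 0 ≤ R → ∀ S : Finset ℂ, (∀ ρ ∈ S, ‖ρ‖ ≤ R) →
      (∑ ρ ∈ S, m ρ : ℝ) ≤ K * (1 + R) ^ (3 / 2 : ℝ)) :
    Summable fun ρ : ℂ => (m ρ : ℝ) / (1 + ‖ρ‖) ^ 2 := by
  classical
  have hex : ∀ ρ : ℂ, ∃ j : ℕ, ‖ρ‖ ≤ 2 ^ j := fun ρ =>
    (pow_unbounded_of_one_lt ‖ρ‖ (by norm_num : (1 : ℝ) < 2)).imp fun _ => le_of_lt
  set J : ℂ → ℕ := fun ρ => Nat.find (hex ρ) with hJ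
  have hJ1 : ∀ ρ, ‖ρ‖ ≤ 2 ^ J ρ := fun ρ => Nat.find_spec (hex ρ)
  have hJ2 : ∀ ρ, 1 / (1 + ‖ρ‖) ^ 2 ≤ 4 * (1 / 4) ^ J ρ := by
    intro ρ
    rw [div_le_iff₀ (by positivity)]
    have hlow : 2 ^ J ρ ≤ 2 * (1 + ‖ρ‖) := by
      rcases Nat.eq_zero_or_pos (J ρ) with h0 | hpos
      · rw [h0]
        have := norm_nonneg ρ
        linarith [pow_zero (2 : ℝ)]
      · have h1 := Nat.find_min (hex ρ) (Nat.sub_one_lt hpos.ne')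
        have h2 : (2 : ℝ) ^ J ρ = 2 * 2 ^ (J ρ - 1) := by
          rw [← pow_succ', Nat.sub_add_cancel hpos]
        rw [not_le] at h1
        have h3 : (2 : ℝ) ^ (J ρ - 1) < ‖ρ‖ := h1
        rw [h2]
        linarith
    have h4 : (4 : ℝ) ^ J ρ ≤ 4 * (1 + ‖ρ‖) ^ 2 := by
      calc (4 : ℝ) ^ J ρ = (2 ^ J ρ) ^ 2 := by
            rw [← pow_mul, mul_comm, pow_mul]; norm_num
        _ ≤ (2 * (1 + ‖ρ‖)) ^ 2 := by gcongr
        _ = _ := by ring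
    calc (1 : ℝ) = (1 / 4) ^ J ρ * 4 ^ J ρ := by rw [← mul_pow]; norm_num
      _ ≤ (1 / 4) ^ J ρ * (4 * (1 + ‖ρ‖) ^ 2) := by gcongr
      _ = _ := by ring
  set r : ℝ := 2 ^ (3 / 2 : ℝ) with hr
  have hr0 : 0 < r := by positivity
  have hr4 : r / 4 < 1 := by
    rw [div_lt_one (by norm_num)]
    calc r < 2 ^ (2 : ℝ) := Real.rpow_lt_rpow_of_exponent_lt (by norm_num) (by norm_num)
      _ = 4 := by norm_num
  have hgeo : Summable fun j : ℕ => 4 * K * r * (r / 4) ^ j :=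
    (summable_geometric_of_lt_one (by positivity) hr4).mul_left _
  refine summable_of_sum_le (c := ∑' j : ℕ, 4 * K * r * (r / 4) ^ j)
    (fun ρ => by positivity) fun S => ?_
  have hmaps : ∀ ρ ∈ S, J ρ ∈ S.image J := fun ρ hρ => Finset.mem_image_of_mem _ hρ
  rw [← Finset.sum_fiberwise_of_maps_to hmaps]
  refine le_trans ?_ (hgeo.sum_le_tsum (S.image J) fun j _ => by positivity)
  refine Finset.sum_le_sum fun j _ => ?_
  calc ∑ ρ ∈ S with J ρ = j, (m ρ : ℝ) / (1 + ‖ρ‖) ^ 2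
      ≤ ∑ ρ ∈ S with J ρ = j, (m ρ : ℝ) * (4 * (1 / 4) ^ j) := by
        refine Finset.sum_le_sum fun ρ hρ => ?_
        rw [← (Finset.mem_filter.1 hρ).2, div_eq_mul_one_div]
        gcongr
        exact hJ2 ρ
    _ = (∑ ρ ∈ S with J ρ = j, (m ρ : ℝ)) * (4 * (1 / 4) ^ j) := by rw [Finset.sum_mul]
    _ ≤ K * (1 + 2 ^ j) ^ (3 / 2 : ℝ) * (4 * (1 / 4) ^ j) := by
        gcongr
        refine h _ (by positivity) _ fun ρ hρ => ?_
        rw [← (Finset.mem_filter.1 hρ).2]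
        exact hJ1 ρ
    _ ≤ K * (r * r ^ j) * (4 * (1 / 4) ^ j) := by
        gcongr
        have h1 : (1 : ℝ) ≤ 2 ^ j := one_le_pow₀ (by norm_num)
        calc (1 + (2 : ℝ) ^ j) ^ (3 / 2 : ℝ) ≤ (2 * 2 ^ j) ^ (3 / 2 : ℝ) := by
              gcongr; linarith
          _ = r * r ^ j := by
              rw [Real.mul_rpow (by norm_num) (by positivity), hr, ← Real.rpow_natCast_mul
                (by norm_num), mul_comm (j : ℝ), Real.rpow_mul_natCast (by norm_num)]
    _ = _ := by rw [div_pow, div_pow, one_pow]; ring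


theorem exists_primitive_logDeriv {q : ℂ → ℂ} {R : ℝ} (hR : 0 < R) (hq : Differentiable ℂ q)
    (hne : ∀ z ∈ Metric.ball (0 : ℂ) R, q z ≠ 0) :
    ∃ F : ℂ → ℂ, F 0 = 0 ∧ (∀ z ∈ Metric.ball (0 : ℂ) R, HasDerivAt F (deriv q z / q z) z) ∧
      ∀ z ∈ Metric.ball (0 : ℂ) R, q z = q 0 * Complex.exp (F z) := by
  have hd : DifferentiableOn ℂ (fun z => deriv q z / q z) (Metric.ball (0 : ℂ) R) :=
    fun z hz => ((hq.contDiff (n := 2)).differentiable_deriv_two z |>.div (hq z)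
      (hne z hz)).differentiableWithinAt
  obtain ⟨F, hF0, hF⟩ := hd.isExactOn_ball.with_val_at 0 0
  refine ⟨F, hF0, hF, ?_⟩
  set k : ℂ → ℂ := fun z => q z * Complex.exp (-F z) with hk
  have hkd : ∀ z ∈ Metric.ball (0 : ℂ) R, HasDerivAt k 0 z := by
    intro z hz
    have h1 := (hq z).hasDerivAt.mul (hF z hz).neg.cexp
    refine h1.congr_deriv ?_
    have h2 : q z * (deriv q z / q z) = deriv q z := mul_div_cancel₀ _ (hne z hz)
    linear_combination -Complex.exp (-F z) * h2
  have hconst : ∀ z ∈ Metric.ball (0 : ℂ) R, k z = k 0 := by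
    intro z hz
    refine (convex_ball (0 : ℂ) R).is_const_of_fderivWithin_eq_zero (𝕜 := ℂ)
      (fun w hw => (hkd w hw).differentiableAt.differentiableWithinAt) (fun w hw => ?_) hz
      (Metric.mem_ball_self hR)
    rw [fderivWithin_of_isOpen Metric.isOpen_ball hw]
    ext
    simp [(hkd w hw).deriv]
  intro z hz
  have := hconst z hz
  simp only [hk, hF0, neg_zero, Complex.exp_zero, mul_one] at this
  rw [← this, mul_assoc, ← Complex.exp_add]
  simp

/-- Control of the logarithm of a zero-free function near the origin. -/
theorem logDeriv_estimates {q : ℂ → ℂ} {R M : ℝ} (hR : 0 < R) (hM : 0 < M)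
    (hq : Differentiable ℂ q) (hne : ∀ z ∈ Metric.ball (0 : ℂ) (2 * R), q z ≠ 0)
    (hb : ∀ z ∈ Metric.ball (0 : ℂ) (2 * R), ‖q z‖ ≤ ‖q 0‖ * Real.exp M)
    {z : ℂ} (hz : ‖z‖ ≤ R / 4) :
    ‖deriv q z / q z - deriv q 0 / q 0‖ ≤ 16 * M / R ^ 2 * ‖z‖ ∧
      ∃ w : ℂ, ‖w‖ ≤ 16 * M / R ^ 2 * ‖z‖ * ‖z‖ ∧
        q z = q 0 * Complex.exp (deriv q 0 / q 0 * z + w) := by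
  obtain ⟨F, hF0, hF, hqF⟩ := exists_primitive_logDeriv (by positivity) hq hne
  have hq0 : q 0 ≠ 0 := hne 0 (Metric.mem_ball_self (by positivity))
  have hre : Set.MapsTo F (Metric.ball 0 (2 * R)) {z | z.re ≤ M} := by
    intro z hz
    have h1 := hb z hz
    rw [hqF z hz, norm_mul, Complex.norm_exp] at h1
    exact Real.exp_le_exp.1 (le_of_mul_le_mul_left h1 (norm_pos_iff.2 hq0))
  have hFd : DifferentiableOn ℂ F (Metric.ball 0 (2 * R)) :=
    fun z hz => (hF z hz).differentiableAt.differentiableWithinAt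
  have hFb : ∀ z : ℂ, ‖z‖ ≤ R → ‖F z‖ ≤ 2 * M := by
    intro z hz
    refine (Complex.borelCaratheodory_zero hM hFd hre (by positivity)
      (by simpa using by linarith) hF0).trans ?_
    rw [div_le_iff₀ (by linarith)]
    gcongr
    linarith
  set l : ℂ → ℂ := fun z => deriv q z / q z with hl
  have hlF : ∀ z : ℂ, ‖z‖ < 2 * R → deriv F z = l z := fun z hz =>
    (hF z (by simpa using hz)).deriv
  have hlb : ∀ z : ℂ, ‖z‖ ≤ R / 2 → ‖l z‖ ≤ 4 * M / R := by
    intro z hz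
    rw [← hlF z (by linarith)]
    have := Complex.norm_deriv_le_of_forall_mem_sphere_norm_le (c := z) (R := R / 2)
      (C := 2 * M) (f := F) (by positivity) ?_ ?_
    · refine this.trans_eq ?_
      field_simp
      norm_num
    · refine (hFd.mono ?_).diffContOnCl
      rw [closure_ball _ (by positivity)]
      refine Metric.closedBall_subset_ball' ?_
      rw [dist_zero_right]
      linarith
    · intro w hw
      apply hFb
      rw [mem_sphere_iff_norm] at hw
      linarith [norm_sub_norm_le w z]
  have hld : DifferentiableOn ℂ l (Metric.ball 0 (2 * R)) :=
    fun z hz => ((hq.contDiff (n := 2)).differentiable_deriv_two z |>.div (hq z)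
      (hne z hz)).differentiableWithinAt
  have hl'b : ∀ z : ℂ, ‖z‖ ≤ R / 4 → ‖deriv l z‖ ≤ 16 * M / R ^ 2 := by
    intro z hz
    have := Complex.norm_deriv_le_of_forall_mem_sphere_norm_le (c := z) (R := R / 4)
      (C := 4 * M / R) (f := l) (by positivity) ?_ ?_
    · refine this.trans_eq ?_
      field_simp
      norm_num
    · refine (hld.mono ?_).diffContOnCl
      rw [closure_ball _ (by positivity)]
      refine Metric.closedBall_subset_ball' ?_
      rw [dist_zero_right]
      linarith
    · intro w hw
      apply hlb
      rw [mem_sphere_iff_norm] at hw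
      linarith [norm_sub_norm_le w z]
  have hl1 : ∀ w : ℂ, ‖w‖ ≤ R / 4 → ‖l w - l 0‖ ≤ 16 * M / R ^ 2 * ‖w‖ := by
    intro w hw
    have := (convex_closedBall (0 : ℂ) (R / 4)).norm_image_sub_le_of_norm_deriv_le (𝕜 := ℂ)
      (f := l) (C := 16 * M / R ^ 2) (x := 0) (y := w) (fun x hx => ?_)
      (fun x hx => hl'b x (by simpa using hx)) (by simpa using by positivity) (by simpa using hw)
    · simpa using this
    · refine (hld x ?_).differentiableAt (Metric.isOpen_ball.mem_nhds ?_) <;>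
      · simp only [Metric.mem_closedBall, dist_zero_right, Metric.mem_ball] at hx ⊢
        linarith
  refine ⟨hl1 z hz, F z - l 0 * z, ?_, ?_⟩
  · have := (convex_closedBall (0 : ℂ) ‖z‖).norm_image_sub_le_of_norm_hasDerivWithin_le (𝕜 := ℂ)
      (f := fun w => F w - l 0 * w) (f' := fun w => l w - l 0)
      (C := 16 * M / R ^ 2 * ‖z‖) (x := 0) (y := z) (fun x hx => ?_) (fun x hx => ?_)
      (by simp) (by simp)
    · simpa [hF0] using this
    · have hx' : ‖x‖ ≤ ‖z‖ := by simpa using hx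
      have h2 := (hF x (by simp; linarith)).sub ((hasDerivAt_id x).const_mul (l 0))
      rw [mul_one] at h2
      exact h2.hasDerivWithinAt
    · have hx' : ‖x‖ ≤ ‖z‖ := by simpa using hx
      exact (hl1 x (by linarith)).trans (by gcongr)
  · rw [hqF z (by simp; linarith)]
    congr 2
    simp [hl]

@[to_additive]
theorem tendsto_finset_prod_of_hasProd {α β M : Type*} [CommMonoid M] [TopologicalSpace M]
    [Preorder β] {f : α → M} {a : M} (h : HasProd f a) {S : β → Finset α} (hmono : Monotone S)
    (hS : ∀ x, f x ≠ 1 → ∃ N, x ∈ S N) :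
    Tendsto (fun N => ∏ x ∈ S N, f x) atTop (𝓝 a) := by
  classical
  rw [← hasProd_subtype_iff_of_mulSupport_subset (s := Function.mulSupport f) subset_rfl] at h
  have h1 : Tendsto (fun N => (S N).subtype (· ∈ Function.mulSupport f)) atTop atTop := by
    refine tendsto_atTop_finset_of_monotone (fun i j hij x hx => ?_) fun x => ?_
    · rw [Finset.mem_subtype] at hx ⊢
      exact hmono hij hx
    · obtain ⟨N, hN⟩ := hS x x.2
      exact ⟨N, Finset.mem_subtype.2 hN⟩
  refine (Tendsto.comp h h1).congr fun N => ?_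
  simp only [Function.comp]
  rw [Finset.prod_subtype_eq_prod_filter (f := f)]
  simp only [Function.mem_mulSupport]
  exact Finset.prod_filter_ne_one _

theorem finite_support_inter_closedBall {m : ℂ → ℕ}
    (hm : Summable fun ρ : ℂ => (m ρ : ℝ) / (1 + ‖ρ‖) ^ 2) (R : ℝ) :
    {ρ | m ρ ≠ 0 ∧ ‖ρ‖ ≤ R}.Finite := by
  rcases lt_or_ge R 0 with hR | hR
  · convert Set.finite_empty
    ext ρ
    simpa using fun _ => hR.trans_le (norm_nonneg ρ)
  have h1 := hm.tendsto_cofinite_zero.eventually_lt_const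
    (show (0 : ℝ) < 1 / (1 + R) ^ 2 by positivity)
  refine (Filter.eventually_cofinite.1 h1).subset fun ρ hρ => ?_
  obtain ⟨h0, hρR⟩ := hρ
  simp only [Set.mem_ofPred_eq, not_lt]
  gcongr
  exact_mod_cast Nat.one_le_iff_ne_zero.2 h0

theorem norm_inv_sub_add_inv_le {z ρ : ℂ} (h : 2 * ‖z‖ + 1 ≤ ‖ρ‖) :
    ‖1 / (z - ρ) + 1 / ρ‖ ≤ 8 * ‖z‖ / (1 + ‖ρ‖) ^ 2 := by
  have hz := norm_nonneg z
  have hρ : ρ ≠ 0 := norm_pos_iff.1 (by linarith)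
  have h1 : ‖ρ‖ - ‖z‖ ≤ ‖z - ρ‖ := by
    rw [norm_sub_rev]; exact norm_sub_norm_le _ _
  have h2 : z - ρ ≠ 0 := norm_pos_iff.1 (by linarith)
  have h3 : 1 / (z - ρ) + 1 / ρ = z / ((z - ρ) * ρ) := by
    field_simp
    ring
  rw [h3, norm_div, norm_mul, div_le_div_iff₀ (by positivity) (by positivity)]
  have h4 : (1 + ‖ρ‖) / 4 ≤ ‖z - ρ‖ := by linarith
  have h5 : (1 + ‖ρ‖) / 2 ≤ ‖ρ‖ := by linarith
  have h6 : (1 + ‖ρ‖) / 4 * ((1 + ‖ρ‖) / 2) ≤ ‖z - ρ‖ * ‖ρ‖ := by gcongr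
  nlinarith

theorem summable_of_norm_le_div_sq {m : ℂ → ℕ}
    (hm : Summable fun ρ : ℂ => (m ρ : ℝ) / (1 + ‖ρ‖) ^ 2) {f : ℂ → ℂ} {C R : ℝ}
    (hf : ∀ ρ, R ≤ ‖ρ‖ → ‖f ρ‖ ≤ C / (1 + ‖ρ‖) ^ 2) :
    Summable fun ρ : ℂ => (m ρ : ℂ) * f ρ := by
  refine (hm.mul_left C).of_norm_bounded_eventually ?_
  rw [Filter.eventually_cofinite]
  refine (finite_support_inter_closedBall hm R).subset fun ρ hρ => ?_
  by_contra! h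
  apply hρ
  rcases eq_or_ne (m ρ) 0 with h0 | h0
  · simp [h0]
  · have hR : R ≤ ‖ρ‖ := by
      by_contra! h2
      exact h ⟨h0, h2.le⟩
    rw [norm_mul, Complex.norm_natCast]
    calc (m ρ : ℝ) * ‖f ρ‖ ≤ m ρ * (C / (1 + ‖ρ‖) ^ 2) := by gcongr; exact hf ρ hR
      _ = _ := by ring

theorem summable_inv_sub_add_inv {m : ℂ → ℕ}
    (hm : Summable fun ρ : ℂ => (m ρ : ℝ) / (1 + ‖ρ‖) ^ 2) (z : ℂ) :
    Summable fun ρ : ℂ => (m ρ : ℂ) * (1 / (z - ρ) + 1 / ρ) :=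
  summable_of_norm_le_div_sq hm fun _ h => norm_inv_sub_add_inv_le h

theorem norm_one_sub_mul_exp_sub_one_le {w : ℂ} (hw : ‖w‖ ≤ 1) :
    ‖(1 - w) * Complex.exp w - 1‖ ≤ 3 * ‖w‖ ^ 2 := by
  have h1 := Complex.norm_exp_sub_one_sub_id_le hw
  have h2 : (1 - w) * Complex.exp w - 1 = (1 - w) * (Complex.exp w - 1 - w) - w ^ 2 := by ring
  have h3 : ‖1 - w‖ ≤ 2 := (norm_sub_le _ _).trans (by rw [norm_one]; linarith)
  rw [h2]
  refine (norm_sub_le _ _).trans ?_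
  rw [norm_mul, norm_pow]
  have : ‖1 - w‖ * ‖Complex.exp w - 1 - w‖ ≤ 2 * ‖w‖ ^ 2 := by gcongr
  linarith

theorem norm_one_add_pow_sub_one_le (u : ℂ) (n : ℕ) (h : n * ‖u‖ ≤ 1) :
    ‖(1 + u) ^ n - 1‖ ≤ 2 * (n * ‖u‖) := by
  have h1 : ‖(1 + u) ^ n - 1‖ ≤ (1 + ‖u‖) ^ n - 1 := by
    have h2 : ∀ n : ℕ, ‖(1 + u) ^ n - 1‖ ≤ (1 + ‖u‖) ^ n - 1 := by
      intro n
      induction n with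
      | zero => simp
      | succ n ih =>
        have h3 : (1 + u) ^ (n + 1) - 1 = ((1 + u) ^ n - 1) * (1 + u) + u := by ring
        have h4 : ‖1 + u‖ ≤ 1 + ‖u‖ := by simpa using norm_add_le 1 u
        rw [h3]
        calc ‖((1 + u) ^ n - 1) * (1 + u) + u‖
            ≤ ‖(1 + u) ^ n - 1‖ * ‖1 + u‖ + ‖u‖ := by
              rw [← norm_mul]; exact norm_add_le _ _
          _ ≤ ((1 + ‖u‖) ^ n - 1) * (1 + ‖u‖) + ‖u‖ := by
              gcongr
              exact (norm_nonneg _).trans ih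
          _ = _ := by ring
    exact h2 n
  have h2 : (1 + ‖u‖) ^ n ≤ Real.exp (n * ‖u‖) := by
    rw [Real.exp_nat_mul]
    gcongr
    linarith [Real.add_one_le_exp ‖u‖]
  have h3 := Real.abs_exp_sub_one_le (x := n * ‖u‖) (by rwa [abs_of_nonneg (by positivity)])
  rw [abs_of_nonneg (show 0 ≤ n * ‖u‖ by positivity)] at h3
  linarith [le_abs_self (Real.exp (n * ‖u‖) - 1)]

theorem multipliable_canonical {m : ℂ → ℕ}
    (hm : Summable fun ρ : ℂ => (m ρ : ℝ) / (1 + ‖ρ‖) ^ 2) (z : ℂ) :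
    Multipliable fun ρ : ℂ => ((1 - z / ρ) * Complex.exp (z / ρ)) ^ m ρ := by
  set u : ℂ → ℂ := fun ρ => (1 - z / ρ) * Complex.exp (z / ρ) - 1 with hu
  have h1 : Summable fun ρ : ℂ => (m ρ : ℂ) * u ρ := by
    refine summable_of_norm_le_div_sq hm (C := 12 * ‖z‖ ^ 2) (R := ‖z‖ + 1) fun ρ hρ => ?_
    have hz := norm_nonneg z
    have hpos : 0 < ‖ρ‖ := by linarith
    have h2 : ‖z / ρ‖ ≤ 1 := by
      rw [norm_div, div_le_one hpos]
      linarith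
    refine (norm_one_sub_mul_exp_sub_one_le h2).trans ?_
    rw [norm_div, div_pow, mul_div_assoc', div_le_div_iff₀ (by positivity) (by positivity)]
    have h3 : (1 + ‖ρ‖) ^ 2 ≤ (2 * ‖ρ‖) ^ 2 := by gcongr; linarith
    nlinarith [sq_nonneg ‖z‖]
  have h2 : Summable fun ρ : ℂ => ((1 - z / ρ) * Complex.exp (z / ρ)) ^ m ρ - 1 := by
    refine (h1.norm.mul_left 2).of_norm_bounded_eventually ?_
    filter_upwards [h1.norm.tendsto_cofinite_zero.eventually_lt_const zero_lt_one] with ρ hρ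
    rw [norm_mul, Complex.norm_natCast] at hρ ⊢
    have := norm_one_add_pow_sub_one_le (u ρ) (m ρ) hρ.le
    simpa [hu] using this
  simpa using Complex.multipliable_one_add_of_summable h2


theorem tendsto_growth_div_sq (C b : ℝ) :
    Tendsto (fun N : ℕ => 16 * (C * (1 + 2 * ((N : ℝ) + 1)) ^ (3 / 2 : ℝ) + b) / ((N : ℝ) + 1) ^ 2)
      atTop (𝓝 0) := by
  have h1 : Tendsto (fun x : ℝ => x ^ (-(1 / 2) : ℝ)) atTop (𝓝 0) :=
    tendsto_rpow_neg_atTop (by norm_num)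
  have h2 : Tendsto (fun N : ℕ => ((N : ℝ) + 1)) atTop atTop :=
    tendsto_atTop_add_const_right _ _ tendsto_natCast_atTop_atTop
  have h3 := (h1.comp h2).const_mul (16 * (|C| * 3 ^ (3 / 2 : ℝ) + |b|))
  rw [mul_zero] at h3
  refine squeeze_zero_norm (fun N => ?_) h3
  have hx : (1 : ℝ) ≤ (N : ℝ) + 1 := by linarith [Nat.cast_nonneg (α := ℝ) N]
  set x : ℝ := (N : ℝ) + 1
  have hx0 : 0 < x := by linarith
  have h4 : x ^ (-(1 / 2) : ℝ) = x ^ (3 / 2 : ℝ) / x ^ 2 := by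
    rw [← Real.rpow_two, ← Real.rpow_sub hx0]
    norm_num
  have h5 : (1 + 2 * x) ^ (3 / 2 : ℝ) ≤ 3 ^ (3 / 2 : ℝ) * x ^ (3 / 2 : ℝ) := by
    rw [← Real.mul_rpow (by norm_num) hx0.le]
    gcongr
    linarith
  have h6 : 1 ≤ x ^ (3 / 2 : ℝ) := Real.one_le_rpow hx (by norm_num)
  simp only [Function.comp]
  rw [h4, Real.norm_eq_abs, abs_div, abs_of_pos (show 0 < x ^ 2 by positivity), mul_div_assoc']
  gcongr
  rw [abs_mul, abs_of_pos (show (0 : ℝ) < 16 by norm_num), mul_assoc]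
  gcongr
  calc |C * (1 + 2 * x) ^ (3 / 2 : ℝ) + b| ≤ |C| * (1 + 2 * x) ^ (3 / 2 : ℝ) + |b| := by
        refine (abs_add_le _ _).trans ?_
        rw [abs_mul, abs_of_pos (show 0 < (1 + 2 * x) ^ (3 / 2 : ℝ) by positivity)]
    _ ≤ |C| * (3 ^ (3 / 2 : ℝ) * x ^ (3 / 2 : ℝ)) + |b| * x ^ (3 / 2 : ℝ) := by
        gcongr
        exact le_mul_of_one_le_right (abs_nonneg _) h6
    _ = _ := by ring

/-- Approximation of an entire function of order less than two by finite products. -/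
theorem exists_finite_approximation {g : ℂ → ℂ} (hg : Differentiable ℂ g) (h0 : g 0 ≠ 0)
    (hgr : GrowthBound g) :
    ∃ (S : ℕ → Finset ℂ) (q : ℕ → ℂ → ℂ) (ε : ℕ → ℝ), Monotone S ∧ Tendsto ε atTop (𝓝 0) ∧
      (∀ ρ, g ρ = 0 → ∃ N, ρ ∈ S N) ∧ (∀ N, ∀ ρ ∈ S N, g ρ = 0) ∧
      (∀ N, Differentiable ℂ (q N)) ∧
      (∀ N z, g z = (∏ ρ ∈ S N, (1 - z / ρ) ^ analyticOrderNatAt g ρ) * q N z) ∧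
      ∀ (N : ℕ) z, ‖z‖ ≤ ((N : ℝ) + 1) / 4 → q N z ≠ 0 ∧
        ‖deriv (q N) z / q N z - deriv (q N) 0 / q N 0‖ ≤ ε N * ‖z‖ ∧
        ∃ w : ℂ, ‖w‖ ≤ ε N * ‖z‖ * ‖z‖ ∧
          q N z = g 0 * Complex.exp (deriv (q N) 0 / q N 0 * z + w) := by
  classical
  have hne : g ≠ 0 := fun h => h0 (by simp [h])
  obtain ⟨C, hC0, hC⟩ := hgr.exists_nonneg
  set S : ℕ → Finset ℂ := fun N =>
    (finite_zeros_inter_closedBall hg hne (2 * ((N : ℝ) + 1))).toFinset with hS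
  have hmem : ∀ N ρ, ρ ∈ S N ↔ g ρ = 0 ∧ ‖ρ‖ ≤ 2 * ((N : ℝ) + 1) := by
    intro N ρ
    simp [hS]
  have h0S : ∀ N, (0 : ℂ) ∉ S N := fun N h => h0 ((hmem N 0).1 h).1
  choose q hq hgq hqS using fun N =>
    exists_eq_prod_one_sub_div_pow_mul hg hne (S N) (h0S N)
  have hq0 : ∀ N, q N 0 = g 0 := fun N => by simp [hgq N 0]
  have hg0 : 0 < ‖g 0‖ := norm_pos_iff.2 h0
  set b : ℝ := |Real.log ‖g 0‖| + 1 with hb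
  refine ⟨S, q, fun N => 16 * (C * (1 + 2 * ((N : ℝ) + 1)) ^ (3 / 2 : ℝ) + b) /
    ((N : ℝ) + 1) ^ 2, ?_, tendsto_growth_div_sq C b, ?_,
    fun N ρ hρ => ((hmem N ρ).1 hρ).1, hq, hgq, ?_⟩
  · intro i j hij ρ hρ
    rw [hmem] at hρ ⊢
    refine ⟨hρ.1, hρ.2.trans ?_⟩
    gcongr
  · intro ρ hρ
    obtain ⟨N, hN⟩ := exists_nat_ge ‖ρ‖
    exact ⟨N, (hmem N ρ).2 ⟨hρ, by linarith [norm_nonneg ρ]⟩⟩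
  · intro N z hz
    have hR : (0 : ℝ) < (N : ℝ) + 1 := by positivity
    set R : ℝ := (N : ℝ) + 1
    have hqne : ∀ w : ℂ, ‖w‖ ≤ 2 * R → q N w ≠ 0 := by
      intro w hw hqw
      by_cases hwS : w ∈ S N
      · exact hqS N w hwS hqw
      · exact hwS ((hmem N w).2 ⟨by rw [hgq N, hqw, mul_zero], hw⟩)
    have hbound : ∀ w ∈ Metric.ball (0 : ℂ) (2 * R),
        ‖q N w‖ ≤ ‖q N 0‖ * Real.exp (C * (1 + 2 * R) ^ (3 / 2 : ℝ) + b) := by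
      intro w hw
      rw [mem_ball_zero_iff] at hw
      have h1 := norm_mul_three_pow_le (R := 2 * R) (by positivity)
        (fun ρ hρ => ⟨fun h => h0S N (h ▸ hρ), ((hmem N ρ).1 hρ).2⟩) (hq N) (hgq N)
        (hC (2 * R) (by positivity)) (z := w) (by linarith)
      have h2 : ‖q N w‖ ≤ Real.exp (C * (1 + 2 * R) ^ (3 / 2 : ℝ)) :=
        (le_mul_of_one_le_right (norm_nonneg _) (one_le_pow₀ (by norm_num))).trans h1
      rw [hq0, Real.exp_add, mul_left_comm]
      refine h2.trans (le_mul_of_one_le_right (Real.exp_pos _).le ?_)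
      nth_rewrite 1 [← Real.exp_log hg0]
      rw [← Real.exp_add]
      apply Real.one_le_exp
      linarith [neg_abs_le (Real.log ‖g 0‖)]
    have h3 := logDeriv_estimates hR (by positivity) (hq N)
      (fun w hw => hqne w (mem_ball_zero_iff.1 hw).le) hbound hz
    rw [← hq0 N]
    exact ⟨hqne z (by linarith), h3⟩

theorem logDeriv_finset_prod {S : Finset ℂ} {m : ℂ → ℕ} {q : ℂ → ℂ} {z : ℂ}
    (hS : (0 : ℂ) ∉ S) (hz : z ∉ S) (hq : Differentiable ℂ q) (hqz : q z ≠ 0) {g : ℂ → ℂ}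
    (hgq : ∀ z, g z = (∏ ρ ∈ S, (1 - z / ρ) ^ m ρ) * q z) :
    deriv g z / g z = ∑ ρ ∈ S, (m ρ : ℂ) * (1 / (z - ρ)) + deriv q z / q z := by
  have h0 : ∀ ρ ∈ S, ρ ≠ 0 := fun ρ hρ h => hS (h ▸ hρ)
  have hne : ∀ ρ ∈ S, 1 - z / ρ ≠ 0 := by
    intro ρ hρ h
    exact hz ((div_eq_one_iff_eq (h0 ρ hρ)).1 (sub_eq_zero.1 h).symm ▸ hρ)
  have h1 : g = fun z => (∏ ρ ∈ S, (1 - z / ρ) ^ m ρ) * q z := funext hgq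
  have hprod : logDeriv (fun z => ∏ ρ ∈ S, (1 - z / ρ) ^ m ρ) z =
      ∑ ρ ∈ S, logDeriv (fun z => (1 - z / ρ) ^ m ρ) z :=
    logDeriv_prod (fun ρ hρ => pow_ne_zero _ (hne ρ hρ)) (fun ρ _ => by fun_prop)
  change logDeriv g z = _ + logDeriv q z
  rw [h1, logDeriv_mul z (Finset.prod_ne_zero_iff.2 fun ρ hρ => pow_ne_zero _ (hne ρ hρ)) hqz
    (by fun_prop) (hq z), hprod]
  congr 1
  refine Finset.sum_congr rfl fun ρ hρ => ?_
  rw [logDeriv_fun_pow (by fun_prop), logDeriv_apply]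
  congr 1
  have h2 : HasDerivAt (fun z => 1 - z / ρ) (-(1 / ρ)) z := by
    simpa using ((hasDerivAt_id z).div_const ρ).const_sub 1
  rw [h2.deriv]
  have h3 := h0 ρ hρ
  have h4 := hne ρ hρ
  have h5 : z - ρ ≠ 0 := sub_ne_zero.2 fun h => hz (h ▸ hρ)
  have h6 : ρ - z ≠ 0 := sub_ne_zero.2 fun h => hz (h ▸ hρ)
  field_simp
  ring

theorem analyticOrderNatAt_eq_zero_of_ne_zero {g : ℂ → ℂ} (hg : Differentiable ℂ g) {ρ : ℂ}
    (h : g ρ ≠ 0) : analyticOrderNatAt g ρ = 0 := by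
  rw [analyticOrderNatAt, (hg.analyticAt ρ).analyticOrderAt_eq_zero.2 h]
  rfl

theorem summable_order_div_sq {g : ℂ → ℂ} (hg : Differentiable ℂ g) (h0 : g 0 ≠ 0)
    (hgr : GrowthBound g) :
    Summable fun ρ : ℂ => (analyticOrderNatAt g ρ : ℝ) / (1 + ‖ρ‖) ^ 2 := by
  obtain ⟨K, hK, h⟩ := exists_sum_order_le hg h0 hgr
  exact summable_div_sq_of_sum_le hK h

theorem hasSum_logDeriv_of_ne_zero {g : ℂ → ℂ} (hg : Differentiable ℂ g) (h0 : g 0 ≠ 0)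
    (hgr : GrowthBound g) {z : ℂ} (hz : g z ≠ 0) :
    HasSum (fun ρ : ℂ => (analyticOrderNatAt g ρ : ℂ) * (1 / (z - ρ) + 1 / ρ))
      (deriv g z / g z - deriv g 0 / g 0) := by
  obtain ⟨S, q, ε, hmono, hε, hS, hS0, hq, hgq, hest⟩ := exists_finite_approximation hg h0 hgr
  have h1 := (summable_inv_sub_add_inv (summable_order_div_sq hg h0 hgr) z).hasSum
  have h2 := tendsto_finset_sum_of_hasSum h1 hmono (fun ρ hρ => hS ρ (by
    by_contra h
    simp [analyticOrderNatAt_eq_zero_of_ne_zero hg h] at hρ))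
  have h3 : Tendsto (fun N => deriv g z / g z - deriv g 0 / g 0 -
      (deriv (q N) z / q N z - deriv (q N) 0 / q N 0)) atTop
      (𝓝 (deriv g z / g z - deriv g 0 / g 0 - 0)) := by
    refine tendsto_const_nhds.sub (squeeze_zero_norm' ?_ (by simpa using hε.mul_const ‖z‖))
    filter_upwards [eventually_ge_atTop ⌈4 * ‖z‖⌉₊] with N hN
    have := Nat.ceil_le.1 hN
    exact (hest N z (by linarith)).2.1
  have h4 := tendsto_nhds_unique_of_eventuallyEq h2 h3 ?_
  · rw [sub_zero] at h4
    rwa [h4] at h1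
  · filter_upwards [eventually_ge_atTop ⌈4 * ‖z‖⌉₊] with N hN
    have := Nat.ceil_le.1 hN
    have h5 : ∀ w, g w ≠ 0 → w ∉ S N := fun w hw h => hw (hS0 N w h)
    rw [logDeriv_finset_prod (h5 0 h0) (h5 z hz) (hq N) (hest N z (by linarith)).1 (hgq N),
      logDeriv_finset_prod (h5 0 h0) (h5 0 h0) (hq N)
        (hest N 0 (by rw [norm_zero]; positivity)).1 (hgq N)]
    simp only [mul_add, Finset.sum_add_distrib, zero_sub, one_div, inv_neg, mul_neg,
      Finset.sum_neg_distrib]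
    ring

theorem hasProd_canonical_of_ne_zero {g : ℂ → ℂ} (hg : Differentiable ℂ g) (h0 : g 0 ≠ 0)
    (hgr : GrowthBound g) (z : ℂ) :
    HasProd (fun ρ : ℂ => ((1 - z / ρ) * Complex.exp (z / ρ)) ^ analyticOrderNatAt g ρ)
      (g z / (g 0 * Complex.exp (deriv g 0 / g 0 * z))) := by
  obtain ⟨S, q, ε, hmono, hε, hS, hS0, hq, hgq, hest⟩ := exists_finite_approximation hg h0 hgr
  have h1 := (multipliable_canonical (summable_order_div_sq hg h0 hgr) z).hasProd
  have h2 := tendsto_finset_prod_of_hasProd h1 hmono (fun ρ hρ => hS ρ (by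
    by_contra h
    simp [analyticOrderNatAt_eq_zero_of_ne_zero hg h] at hρ))
  choose w hw hqw using fun (N : ℕ) (h : ‖z‖ ≤ ((N : ℝ) + 1) / 4) => (hest N z h).2.2
  classical
  set W : ℕ → ℂ := fun N => if h : ‖z‖ ≤ ((N : ℝ) + 1) / 4 then w N h else 0 with hW
  have hW0 : Tendsto W atTop (𝓝 0) := by
    refine squeeze_zero_norm' ?_ (a := fun N => ε N * ‖z‖ * ‖z‖)
      (by simpa using (hε.mul_const ‖z‖).mul_const ‖z‖)
    filter_upwards [eventually_ge_atTop ⌈4 * ‖z‖⌉₊] with N hN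
    have := Nat.ceil_le.1 hN
    have h : ‖z‖ ≤ ((N : ℝ) + 1) / 4 := by linarith
    simp only [hW, dif_pos h]
    exact hw N h
  have h3 : Tendsto (fun N => g z / (g 0 * Complex.exp (deriv g 0 / g 0 * z)) *
      Complex.exp (-W N)) atTop
      (𝓝 (g z / (g 0 * Complex.exp (deriv g 0 / g 0 * z)) * Complex.exp (-0))) :=
    tendsto_const_nhds.mul ((Complex.continuous_exp.tendsto _).comp hW0.neg)
  have h4 := tendsto_nhds_unique_of_eventuallyEq h2 h3 ?_
  · rw [neg_zero, Complex.exp_zero, mul_one] at h4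
    rwa [h4] at h1
  · filter_upwards [eventually_ge_atTop ⌈4 * ‖z‖⌉₊] with N hN
    have := Nat.ceil_le.1 hN
    have h : ‖z‖ ≤ ((N : ℝ) + 1) / 4 := by linarith
    have h5 : (0 : ℂ) ∉ S N := fun h => h0 (hS0 N 0 h)
    have h6 : W N = w N h := by simp only [hW, dif_pos h]
    rw [h6, logDeriv_finset_prod h5 h5 (hq N)
      (hest N 0 (by rw [norm_zero]; positivity)).1 (hgq N), hgq N z, hqw N h]
    simp only [mul_pow, Finset.prod_mul_distrib, ← Complex.exp_nat_mul, ← Complex.exp_sum]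
    have h8 : ∑ ρ ∈ S N, (analyticOrderNatAt g ρ : ℂ) * (z / ρ) =
        -((∑ ρ ∈ S N, (analyticOrderNatAt g ρ : ℂ) * (1 / (0 - ρ))) * z) := by
      rw [Finset.sum_mul, ← Finset.sum_neg_distrib]
      refine Finset.sum_congr rfl fun ρ _ => ?_
      rw [zero_sub, one_div, inv_neg]
      ring
    rw [h8, mul_div_assoc, mul_assoc]
    congr 1
    rw [mul_div_mul_left _ _ h0, ← Complex.exp_sub, ← Complex.exp_add]
    congr 1
    ring

/-- The logarithmic derivative of an entire function of order less than two. -/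
theorem exists_hasSum_logDeriv {g : ℂ → ℂ} (hg : Differentiable ℂ g) (hne : g ≠ 0)
    (hgr : GrowthBound g) :
    (Summable fun ρ : ℂ => (analyticOrderNatAt g ρ : ℝ) / (1 + ‖ρ‖) ^ 2) ∧
    ∃ c B : ℂ, c ≠ 0 ∧ (∀ z, g z ≠ 0 →
      HasSum (fun ρ : ℂ => (analyticOrderNatAt g ρ : ℂ) * (1 / (z - ρ) + 1 / ρ))
        (deriv g z / g z - B)) ∧
      ∀ z, ∃ P, HasProd
        (fun ρ : ℂ => ((1 - z / ρ) * Complex.exp (z / ρ)) ^ analyticOrderNatAt g ρ) P ∧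
        g z = z ^ analyticOrderNatAt g 0 * (c * Complex.exp (B * z)) * P := by
  classical
  obtain ⟨f, hf, hgf, hf0⟩ := exists_eq_prod_sub_pow_mul hg hne {0}
  replace hf0 : f 0 ≠ 0 := hf0 0 (by simp)
  set n := analyticOrderNatAt g 0 with hn
  replace hgf : ∀ z, g z = z ^ n * f z := fun z => by simpa using hgf z
  have hgr' : GrowthBound f := by
    obtain ⟨C, hC0, hC⟩ := hgr.exists_nonneg
    refine ⟨3 * C, fun z => ?_⟩
    have key : ∀ w : ℂ, 1 ≤ ‖w‖ → ‖f w‖ ≤ ‖g w‖ := fun w hw => by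
      rw [hgf, norm_mul, norm_pow]
      exact le_mul_of_one_le_left (norm_nonneg _) (one_le_pow₀ hw)
    have h1 : (1 : ℝ) ≤ (1 + ‖z‖) ^ (3 / 2 : ℝ) :=
      Real.one_le_rpow (by linarith [norm_nonneg z]) (by norm_num)
    have hz0 := norm_nonneg z
    rcases le_total 1 ‖z‖ with hz | hz
    · refine (key z hz).trans ((hC ‖z‖ (by positivity) z (by linarith)).trans ?_)
      apply Real.exp_le_exp.2
      have : 0 ≤ C * (1 + ‖z‖) ^ (3 / 2 : ℝ) := by positivity
      linarith
    · have h2 := Complex.norm_le_of_forall_mem_frontier_norm_le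
        (f := f) (C := Real.exp (3 * C)) (U := Metric.ball (0 : ℂ) 1) (z := z)
        Metric.isBounded_ball hf.diffContOnCl (fun w hw => ?_)
        (by rw [closure_ball _ one_ne_zero]; simpa using hz)
      · refine h2.trans (Real.exp_le_exp.2 ?_)
        exact le_mul_of_one_le_right (by positivity) h1
      · rw [frontier_ball _ one_ne_zero, mem_sphere_zero_iff_norm] at hw
        refine (key w hw.ge).trans ((hC 1 (by norm_num) w (by linarith)).trans ?_)
        apply Real.exp_le_exp.2
        have : (1 + 1 : ℝ) ^ (3 / 2 : ℝ) ≤ 3 := by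
          have h3 : (0 : ℝ) ≤ (1 + 1 : ℝ) ^ (3 / 2 : ℝ) := by positivity
          have h4 : ((1 + 1 : ℝ) ^ (3 / 2 : ℝ)) ^ 2 = 8 := by
            rw [← Real.rpow_mul_natCast (by norm_num)]
            norm_num
          nlinarith
        nlinarith
  have hord : ∀ ρ : ℂ, ρ ≠ 0 → analyticOrderNatAt g ρ = analyticOrderNatAt f ρ := by
    intro ρ hρ
    have h1 : g = (fun z => z ^ n) * f := funext hgf
    have h2 : analyticOrderAt (fun z : ℂ => z ^ n) ρ = 0 :=
      AnalyticAt.analyticOrderAt_eq_zero (by fun_prop) |>.2 (pow_ne_zero _ hρ)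
    rw [analyticOrderNatAt, analyticOrderNatAt, h1, analyticOrderAt_mul (by fun_prop)
      (hf.analyticAt ρ), h2, zero_add]
  have hf00 : analyticOrderNatAt f 0 = 0 := analyticOrderNatAt_eq_zero_of_ne_zero hf hf0
  refine ⟨?_, f 0, deriv f 0 / f 0, hf0, fun z hz => ?_, fun z => ?_⟩
  · refine (summable_order_div_sq hf hf0 hgr').congr_cofinite ?_
    filter_upwards [(Set.finite_singleton (0 : ℂ)).compl_mem_cofinite] with ρ hρ
    rw [hord ρ hρ]
  · have hfz : f z ≠ 0 := fun h => hz (by rw [hgf, h, mul_zero])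
    have h1 := (hasSum_logDeriv_of_ne_zero hf hf0 hgr' hfz).add
      (hasSum_ite_eq (0 : ℂ) ((n : ℂ) * (1 / z)))
    convert h1 using 1
    · ext ρ
      split_ifs with h
      · simp [h, hf00, ← hn]
      · simp [hord ρ h]
    · have hgd : deriv g z / g z = n * (1 / z) + deriv f z / f z := by
        rcases eq_or_ne n 0 with h0 | h0
        · have : g = f := funext fun z => by rw [hgf, h0]; simp
          rw [h0, this]
          simp
        · have hz0 : z ≠ 0 := fun h => hz (by rw [hgf, h, zero_pow h0, zero_mul])
          have h1 : g = fun z => z ^ n * f z := funext hgf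
          change logDeriv g z = _ + logDeriv f z
          rw [h1, logDeriv_mul (f := fun z => z ^ n) z (pow_ne_zero _ hz0) hfz (by fun_prop) (hf z),
            logDeriv_pow]
          simp [div_eq_mul_inv]
      rw [hgd]
      ring
  · refine ⟨_, hasProd_canonical_of_ne_zero hf hf0 hgr' z |>.congr_fun ?_, ?_⟩
    · intro ρ
      rcases eq_or_ne ρ 0 with rfl | h
      · simp
      · rw [hord ρ h]
    · rw [hgf z]
      have := Complex.exp_ne_zero (deriv f 0 / f 0 * z)
      field_simp


/-- Terms of a series for `log Γ(w + 1)`. -/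
def logGammaTerm (n : ℕ) (w : ℂ) : ℂ :=
  w * (Real.log (n + 2) - Real.log (n + 1) : ℝ) -
    (Complex.log (w + n + 1) - (Real.log (n + 1) : ℝ))

/-- The derivatives of `logGammaTerm`. -/
def digammaTerm (n : ℕ) (w : ℂ) : ℂ :=
  (Real.log (n + 2) - Real.log (n + 1) : ℝ) - 1 / (w + n + 1)

theorem hasDerivAt_logGammaTerm (n : ℕ) {w : ℂ} (hw : 0 < w.re) :
    HasDerivAt (logGammaTerm n) (digammaTerm n w) w := by
  have h1 : w + n + 1 ∈ Complex.slitPlane := by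
    left
    simp
    positivity
  have h2 : HasDerivAt (fun w : ℂ => w + n + 1) 1 w := by
    simpa using! ((hasDerivAt_id w).add_const (n : ℂ)).add_const 1
  have h3 := ((hasDerivAt_id w).mul_const ((Real.log (n + 2) - Real.log (n + 1) : ℝ) : ℂ)).sub
    ((h2.clog h1).sub_const ((Real.log (n + 1) : ℝ) : ℂ))
  rw [one_mul] at h3
  exact h3

theorem norm_digammaTerm_le (n : ℕ) {w : ℂ} (hw : 0 < w.re) :
    ‖digammaTerm n w‖ ≤
      1 / ((n : ℝ) + 1) ^ 2 + ‖w‖ ^ (1 / 4 : ℝ) * (1 / ((n : ℝ) + 1) ^ (5 / 4 : ℝ)) := by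
  have hn : (0 : ℝ) < (n : ℝ) + 1 := by positivity
  have hnc : (n : ℂ) + 1 ≠ 0 := by exact_mod_cast hn.ne'
  have hw0 : 0 < ‖w‖ := norm_pos_iff.2 fun h => by simp [h] at hw
  have hre : (w + n + 1).re = w.re + (n + 1) := by simp; ring
  have h1 : (n : ℝ) + 1 ≤ ‖w + n + 1‖ := by
    refine le_trans ?_ (Complex.re_le_norm _)
    rw [hre]
    linarith
  have h2 : ‖w‖ ≤ ‖w + n + 1‖ := by
    rw [← sq_le_sq₀ (norm_nonneg _) (norm_nonneg _), ← Complex.normSq_eq_norm_sq,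
      ← Complex.normSq_eq_norm_sq, Complex.normSq_apply, Complex.normSq_apply, hre]
    have : (w + n + 1).im = w.im := by simp
    rw [this]
    nlinarith
  have hwn : w + n + 1 ≠ 0 := norm_pos_iff.1 (hn.trans_le h1)
  have h3 : digammaTerm n w = ((Real.log (n + 2) - Real.log (n + 1) - 1 / (n + 1) : ℝ) : ℂ) +
      w / ((n + 1) * (w + n + 1)) := by
    rw [digammaTerm]
    push_cast
    field_simp
    ring
  rw [h3]
  refine (norm_add_le _ _).trans (add_le_add ?_ ?_)
  · rw [Complex.norm_real, Real.norm_eq_abs, ← Real.log_div (by positivity) (by positivity)]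
    have h4 := Real.log_le_sub_one_of_pos (show (0 : ℝ) < (n + 2) / (n + 1) by positivity)
    have h5 := Real.one_sub_inv_le_log_of_pos (show (0 : ℝ) < (n + 2) / (n + 1) by positivity)
    have h6 : ((n : ℝ) + 2) / (n + 1) - 1 = 1 / (n + 1) := by field_simp; ring
    have h7 : 1 - (((n : ℝ) + 2) / (n + 1))⁻¹ = 1 / (n + 2) := by field_simp; ring
    have h8 : 1 / ((n : ℝ) + 1) - 1 / (n + 2) ≤ 1 / ((n : ℝ) + 1) ^ 2 := by
      rw [div_sub_div _ _ (by positivity) (by positivity), div_le_div_iff₀ (by positivity)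
        (by positivity)]
      nlinarith
    have h9 : (0 : ℝ) ≤ 1 / ((n : ℝ) + 1) ^ 2 := by positivity
    rw [h6] at h4
    rw [h7] at h5
    rw [abs_le]
    constructor <;> linarith
  · have h4 : ‖w‖ ^ (3 / 4 : ℝ) * ((n : ℝ) + 1) ^ (1 / 4 : ℝ) ≤ ‖w + n + 1‖ := by
      calc ‖w‖ ^ (3 / 4 : ℝ) * ((n : ℝ) + 1) ^ (1 / 4 : ℝ)
          ≤ ‖w + n + 1‖ ^ (3 / 4 : ℝ) * ‖w + n + 1‖ ^ (1 / 4 : ℝ) := by gcongr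
        _ = ‖w + n + 1‖ := by
          rw [← Real.rpow_add (hn.trans_le h1)]
          norm_num
    have h5 : ‖(n : ℂ) + 1‖ = (n : ℝ) + 1 := by
      rw [show (n : ℂ) + 1 = (((n : ℝ) + 1 : ℝ) : ℂ) by push_cast; ring, Complex.norm_real,
        Real.norm_of_nonneg hn.le]
    rw [norm_div, norm_mul, h5]
    have h6 : ‖w‖ = ‖w‖ ^ (1 / 4 : ℝ) * ‖w‖ ^ (3 / 4 : ℝ) := by
      rw [← Real.rpow_add hw0]
      norm_num
    have h7 : ((n : ℝ) + 1) ^ (5 / 4 : ℝ) = ((n : ℝ) + 1) * ((n : ℝ) + 1) ^ (1 / 4 : ℝ) := by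
      rw [show (5 / 4 : ℝ) = 1 + 1 / 4 by norm_num, Real.rpow_add hn, Real.rpow_one]
    rw [h7, mul_one_div]
    nth_rewrite 1 [h6]
    rw [div_le_div_iff₀ (by positivity) (by positivity)]
    calc ‖w‖ ^ (1 / 4 : ℝ) * ‖w‖ ^ (3 / 4 : ℝ) * ((n + 1) * (n + 1) ^ (1 / 4 : ℝ))
        = ‖w‖ ^ (1 / 4 : ℝ) * ((n + 1) * (‖w‖ ^ (3 / 4 : ℝ) * (n + 1) ^ (1 / 4 : ℝ))) := by ring
      _ ≤ _ := by gcongr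

theorem summable_one_div_add_one_sq : Summable fun n : ℕ => 1 / ((n : ℝ) + 1) ^ 2 := by
  simpa using (summable_nat_add_iff 1).2 (Real.summable_one_div_nat_pow.2 (by norm_num : 1 < 2))

theorem summable_one_div_add_one_rpow :
    Summable fun n : ℕ => 1 / ((n : ℝ) + 1) ^ (5 / 4 : ℝ) := by
  simpa using (summable_nat_add_iff 1).2
    (Real.summable_one_div_nat_rpow.2 (by norm_num : (1 : ℝ) < 5 / 4))

theorem summable_digammaTerm {w : ℂ} (hw : 0 < w.re) : Summable fun n => digammaTerm n w :=
  (summable_one_div_add_one_sq.add (summable_one_div_add_one_rpow.mul_left _)).of_norm_bounded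
    fun n => norm_digammaTerm_le n hw

theorem norm_tsum_digammaTerm_le :
    ∃ C : ℝ, 0 ≤ C ∧ ∀ w : ℂ, 0 < w.re →
      ‖∑' n, digammaTerm n w‖ ≤ C * (1 + ‖w‖) ^ (1 / 4 : ℝ) := by
  refine ⟨(∑' n : ℕ, 1 / ((n : ℝ) + 1) ^ 2) + ∑' n : ℕ, 1 / ((n : ℝ) + 1) ^ (5 / 4 : ℝ),
    by positivity, fun w hw => ?_⟩
  refine (tsum_of_norm_bounded (summable_one_div_add_one_sq.hasSum.add
    (summable_one_div_add_one_rpow.hasSum.mul_left _)) fun n => norm_digammaTerm_le n hw).trans ?_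
  have hw0 := norm_nonneg w
  have h1 : (1 : ℝ) ≤ (1 + ‖w‖) ^ (1 / 4 : ℝ) := Real.one_le_rpow (by linarith) (by norm_num)
  rw [add_mul]
  refine add_le_add (le_mul_of_one_le_right (by positivity) h1) ?_
  rw [mul_comm]
  gcongr
  linarith

theorem hasSum_logGammaTerm {w : ℂ} (hw : 0 < w.re) :
    HasDerivAt (fun z => ∑' n, logGammaTerm n z) (∑' n, digammaTerm n w) w ∧
      Summable fun n => logGammaTerm n w := by
  set t : Set ℂ := {z : ℂ | 0 < z.re} ∩ Metric.ball 0 (‖w‖ + 2) with ht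
  have hto : IsOpen t := (isOpen_lt continuous_const Complex.continuous_re).inter Metric.isOpen_ball
  have htc : IsPreconnected t :=
    ((convex_halfSpace_re_gt 0).inter (convex_ball _ _)).isPreconnected
  have h1t : (1 : ℂ) ∈ t := ⟨by simp, by simp; linarith [norm_nonneg w]⟩
  have hwt : w ∈ t := ⟨hw, by simp⟩
  have hu : Summable fun n : ℕ => 1 / ((n : ℝ) + 1) ^ 2 +
      (‖w‖ + 2) ^ (1 / 4 : ℝ) * (1 / ((n : ℝ) + 1) ^ (5 / 4 : ℝ)) :=
    summable_one_div_add_one_sq.add (summable_one_div_add_one_rpow.mul_left _)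
  have hb : ∀ (n : ℕ) (z : ℂ), z ∈ t → ‖digammaTerm n z‖ ≤ 1 / ((n : ℝ) + 1) ^ 2 +
      (‖w‖ + 2) ^ (1 / 4 : ℝ) * (1 / ((n : ℝ) + 1) ^ (5 / 4 : ℝ)) := by
    intro n z hz
    refine (norm_digammaTerm_le n hz.1).trans ?_
    gcongr
    exact (mem_ball_zero_iff.1 hz.2).le
  have h0 : Summable fun n => logGammaTerm n 1 := by
    convert summable_zero (α := ℂ) (β := ℕ) using 2 with n
    rw [logGammaTerm, show (1 : ℂ) + n + 1 = (((n : ℝ) + 2 : ℝ) : ℂ) by push_cast; ring,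
      ← Complex.ofReal_log (by positivity)]
    push_cast
    ring
  exact ⟨hasDerivAt_tsum_of_isPreconnected hu hto htc
    (fun n y hy => hasDerivAt_logGammaTerm n hy.1) hb h1t h0 hwt,
    summable_of_summable_hasDerivAt_of_isPreconnected hu hto htc
    (fun n y hy => hasDerivAt_logGammaTerm n hy.1) hb h1t h0 hwt⟩

theorem exp_sum_logGammaTerm {w : ℂ} (hw : 0 < w.re) (N : ℕ) :
    Complex.exp (∑ n ∈ Finset.range N, logGammaTerm n w) =
      ((N : ℂ) + 1) ^ w * N.factorial / ∏ j ∈ Finset.range N, (w + j + 1) := by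
  induction N with
  | zero => simp
  | succ N ih =>
    have hne : w + N + 1 ≠ 0 := by
      intro h
      have := congrArg Complex.re h
      simp at this
      linarith [Nat.cast_nonneg (α := ℝ) N]
    have hN1 : ((N : ℂ) + 1) ≠ 0 := by exact_mod_cast N.succ_ne_zero
    have hN2 : ((N + 1 : ℕ) : ℂ) + 1 ≠ 0 := by exact_mod_cast (N + 1).succ_ne_zero
    rw [Finset.sum_range_succ, Complex.exp_add, ih, Finset.prod_range_succ, Nat.factorial_succ,
      logGammaTerm, Complex.cpow_def_of_ne_zero hN1, Complex.cpow_def_of_ne_zero hN2]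
    have h1 : Complex.log ((N : ℂ) + 1) = (Real.log ((N : ℝ) + 1) : ℝ) := by
      rw [Complex.ofReal_log (by positivity)]; push_cast; rfl
    have h2 : Complex.log (((N + 1 : ℕ) : ℂ) + 1) = (Real.log ((N : ℝ) + 2) : ℝ) := by
      rw [Complex.ofReal_log (by positivity)]; push_cast; congr 1; ring
    rw [h1, h2, Complex.exp_sub, Complex.exp_sub, Complex.exp_log hne,
      ← Complex.ofReal_exp (Real.log ((N : ℝ) + 1)), Real.exp_log (by positivity)]
    push_cast
    rw [mul_sub, Complex.exp_sub, mul_comm w, mul_comm w]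
    have h3 := Complex.exp_ne_zero ((Real.log ((N : ℝ) + 1) : ℝ) * w)
    field_simp

theorem Gamma_add_one_eq_exp {w : ℂ} (hw : 0 < w.re) :
    Complex.Gamma (w + 1) = Complex.exp (∑' n, logGammaTerm n w) := by
  have hw0 : w ≠ 0 := fun h => by simp [h] at hw
  have h1 := (hasSum_logGammaTerm hw).2.hasSum.tendsto_sum_nat
  have h2 := (Complex.continuous_exp.tendsto _).comp h1
  refine tendsto_nhds_unique ?_ h2
  rw [Complex.Gamma_add_one w hw0]
  have h3 : Tendsto (fun N : ℕ => (((N : ℂ) + 1) / N) ^ w) atTop (𝓝 1) := by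
    have h4 : Tendsto (fun N : ℕ => ((N : ℂ) + 1) / N) atTop (𝓝 1) := by
      have h5 : Tendsto (fun N : ℕ => 1 + 1 / (N : ℂ)) atTop (𝓝 (1 + 0)) :=
        tendsto_const_nhds.add tendsto_one_div_atTop_nhds_zero_nat
      rw [add_zero] at h5
      refine h5.congr' ?_
      filter_upwards [eventually_ne_atTop 0] with N hN
      have : (N : ℂ) ≠ 0 := by exact_mod_cast hN
      field_simp
    have h6 := h4.cpow (tendsto_const_nhds (x := w)) (by simp)
    simpa using h6
  have h7 := (h3.mul (Complex.GammaSeq_tendsto_Gamma w)).const_mul w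
  rw [one_mul] at h7
  refine h7.congr' ?_
  filter_upwards [eventually_ne_atTop 0] with N hN
  have hNC : (N : ℂ) ≠ 0 := by exact_mod_cast hN
  simp only [Function.comp]
  rw [exp_sum_logGammaTerm hw, Complex.GammaSeq, Finset.prod_range_succ', Nat.cast_zero, add_zero]
  have h8 : (((N : ℂ) + 1) / N) ^ w * (N : ℂ) ^ w = ((N : ℂ) + 1) ^ w := by
    have e1 : ((N : ℂ) + 1) / N = ((((N : ℝ) + 1) / N : ℝ) : ℂ) := by push_cast; rfl
    have e2 : (N : ℂ) = ((N : ℝ) : ℂ) := by push_cast; rfl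
    rw [e1, e2, ← Complex.mul_cpow_ofReal_nonneg (by positivity) (by positivity), ← e1, ← e2]
    congr 1
    field_simp
  have h9 : ∏ k ∈ Finset.range N, (w + ((k + 1 : ℕ) : ℂ)) = ∏ j ∈ Finset.range N, (w + j + 1) :=
    Finset.prod_congr rfl fun k _ => by push_cast; ring
  rw [h9, ← h8]
  field_simp

theorem digamma_eq_tsum {w : ℂ} (hw : 0 < w.re) :
    Complex.digamma w = -1 / w + ∑' n, digammaTerm n w := by
  have hw0 : w ≠ 0 := fun h => by simp [h] at hw
  have hnat : ∀ m : ℕ, w ≠ -m := by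
    intro m h
    rw [h] at hw
    simp at hw
    linarith [Nat.cast_nonneg (α := ℝ) m]
  have h1 : (fun z => Complex.Gamma (z + 1)) =ᶠ[𝓝 w]
      fun z => Complex.exp (∑' n, logGammaTerm n z) := by
    filter_upwards [(isOpen_lt continuous_const Complex.continuous_re).mem_nhds hw] with z hz
    exact Gamma_add_one_eq_exp hz
  have h2 := ((hasSum_logGammaTerm hw).1.cexp).congr_of_eventuallyEq h1
  have h3 := Complex.digamma_apply_add_one w hnat
  have h4 : Complex.digamma (w + 1) = ∑' n, digammaTerm n w := by
    rw [Complex.digamma_def, logDeriv_apply, ← deriv_comp_add_const, h2.deriv,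
      Gamma_add_one_eq_exp hw, mul_div_cancel_left₀ _ (Complex.exp_ne_zero _)]
  rw [← h4, h3, neg_div, one_div]
  ring

theorem exists_norm_digamma_le {δ : ℝ} (hδ : 0 < δ) :
    ∃ C : ℝ, 0 ≤ C ∧ ∀ w : ℂ, δ ≤ w.re →
      ‖Complex.digamma w‖ ≤ C * (1 + ‖w‖) ^ (1 / 4 : ℝ) := by
  obtain ⟨C, hC0, hC⟩ := norm_tsum_digammaTerm_le
  refine ⟨1 / δ + C, by positivity, fun w hw => ?_⟩
  rw [digamma_eq_tsum (hδ.trans_le hw), add_mul]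
  refine (norm_add_le _ _).trans (add_le_add ?_ (hC w (hδ.trans_le hw)))
  have hw0 := norm_nonneg w
  have h1 : (1 : ℝ) ≤ (1 + ‖w‖) ^ (1 / 4 : ℝ) := Real.one_le_rpow (by linarith) (by norm_num)
  refine le_trans ?_ (le_mul_of_one_le_right (by positivity) h1)
  rw [norm_div, norm_neg, norm_one]
  gcongr
  exact hw.trans (Complex.re_le_norm w)

theorem abs_im_one_div_le {u : ℂ} (hu : 0 < u.re) : |(1 / u).im| ≤ |u.im| / u.re ^ 2 := by
  have h1 : u.re ^ 2 ≤ Complex.normSq u := by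
    rw [Complex.normSq_apply]
    nlinarith [mul_self_nonneg u.im]
  rw [one_div, Complex.inv_im, abs_div, abs_neg, abs_of_nonneg (Complex.normSq_nonneg u)]
  gcongr

theorem abs_im_digamma_le {w : ℂ} (hw : 0 < w.re) :
    |(Complex.digamma w).im| ≤ |w.im| / w.re ^ 2 +
      |w.im| / w.re ^ (3 / 4 : ℝ) * ∑' n : ℕ, 1 / ((n : ℝ) + 1) ^ (5 / 4 : ℝ) := by
  rw [digamma_eq_tsum hw, Complex.add_im, ← (Complex.hasSum_im (summable_digammaTerm hw).hasSum).tsum_eq]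
  refine (abs_add_le _ _).trans (add_le_add ?_ ?_)
  · rw [neg_div, Complex.neg_im, abs_neg]
    exact abs_im_one_div_le hw
  · rw [← Real.norm_eq_abs]
    refine tsum_of_norm_bounded (summable_one_div_add_one_rpow.hasSum.mul_left _) fun n => ?_
    have hn : (0 : ℝ) < (n : ℝ) + 1 := by positivity
    have hre : (w + n + 1).re = w.re + (n + 1) := by simp; ring
    have him : (w + n + 1).im = w.im := by simp
    rw [digammaTerm, Complex.sub_im, Complex.ofReal_im, zero_sub, norm_neg, Real.norm_eq_abs]
    refine (abs_im_one_div_le (by rw [hre]; positivity)).trans ?_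
    rw [hre, him, div_mul_div_comm, mul_one]
    gcongr
    calc w.re ^ (3 / 4 : ℝ) * ((n : ℝ) + 1) ^ (5 / 4 : ℝ)
        ≤ (w.re + (n + 1)) ^ (3 / 4 : ℝ) * (w.re + (n + 1)) ^ (5 / 4 : ℝ) := by
          refine mul_le_mul (Real.rpow_le_rpow hw.le (by linarith) (by norm_num))
            (Real.rpow_le_rpow hn.le (by linarith) (by norm_num)) (by positivity) (by positivity)
      _ = (w.re + (n + 1)) ^ 2 := by
          rw [← Real.rpow_add (by positivity), ← Real.rpow_two]
          norm_num

theorem tendsto_im_digamma {l : ℝ} (hl : 0 < l) (m : ℂ) :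
    Tendsto (fun x : ℝ => (Complex.digamma (l * x + m)).im) atTop (𝓝 0) := by
  have hre : ∀ x : ℝ, ((l : ℂ) * x + m).re = l * x + m.re := fun x => by simp
  have him : ∀ x : ℝ, ((l : ℂ) * x + m).im = m.im := fun x => by simp
  have hx : Tendsto (fun x : ℝ => l * x + m.re) atTop atTop :=
    tendsto_atTop_add_const_right _ _ (tendsto_id.const_mul_atTop hl)
  have h1 : Tendsto (fun y : ℝ => |m.im| / y ^ 2 +
      |m.im| / y ^ (3 / 4 : ℝ) * ∑' n : ℕ, 1 / ((n : ℝ) + 1) ^ (5 / 4 : ℝ)) atTop (𝓝 0) := by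
    have h2 : Tendsto (fun y : ℝ => |m.im| / y ^ 2) atTop (𝓝 0) :=
      tendsto_const_nhds.div_atTop (tendsto_pow_atTop (by norm_num))
    have h3 : Tendsto (fun y : ℝ => |m.im| / y ^ (3 / 4 : ℝ)) atTop (𝓝 0) :=
      tendsto_const_nhds.div_atTop (tendsto_rpow_atTop (by norm_num))
    simpa using h2.add (h3.mul_const _)
  refine squeeze_zero_norm' ?_ (h1.comp hx)
  filter_upwards [hx.eventually_gt_atTop 0] with x h0
  have h2 := abs_im_digamma_le (w := l * x + m) (by rwa [hre])
  rw [hre, him] at h2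
  exact h2


theorem arctan_sub_arctan_le {x y : ℝ} (hx : 0 ≤ x) (hxy : x ≤ y) :
    Real.arctan y - Real.arctan x ≤ (y - x) / (1 + x ^ 2) := by
  have h := (convex_Ici x).image_sub_le_mul_sub_of_deriv_le (f := Real.arctan)
    (C := 1 / (1 + x ^ 2)) Real.continuous_arctan.continuousOn
    Real.differentiable_arctan.differentiableOn (fun z hz => ?_) x Set.self_mem_Ici y hxy hxy
  · rw [div_eq_mul_one_div, mul_comm]
    exact h
  · rw [interior_Ici] at hz
    rw [Real.deriv_arctan]
    have h1 : x ≤ z := le_of_lt hz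
    exact one_div_le_one_div_of_le (by positivity) (by gcongr)

theorem pi_div_two_sub_arctan_le {T a A v : ℝ} (hT : 1 ≤ T) (ha : 1 ≤ a) (haA : a ≤ A)
    (hv0 : 0 ≤ v) (hvT : v ≤ T) :
    Real.pi / 2 - Real.arctan (v / a) ≤ 4 * A * (T / (T + v ^ 2)) := by
  have ha0 : 0 < a := by linarith
  have hA : 1 ≤ A := ha.trans haA
  rcases le_or_gt (v ^ 2) T with h | h
  · have h1 : (1 : ℝ) / 2 ≤ T / (T + v ^ 2) := by
      rw [div_le_div_iff₀ (by norm_num) (by positivity)]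
      linarith
    have h2 : 0 ≤ Real.arctan (v / a) := Real.arctan_nonneg.2 (by positivity)
    have h3 := Real.pi_lt_four
    nlinarith
  · have hv : 0 < v := by
      rcases hv0.lt_or_eq with h1 | h1
      · exact h1
      · rw [← h1] at h
        norm_num at h
        linarith
    have h1 := Real.arctan_inv_of_pos (show 0 < v / a by positivity)
    have h2 := arctan_sub_arctan_le le_rfl (show 0 ≤ (v / a)⁻¹ by positivity)
    rw [Real.arctan_zero, h1] at h2
    simp only [sub_zero, inv_div, ne_eq, OfNat.ofNat_ne_zero, not_false_eq_true, zero_pow,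
      add_zero, div_one] at h2
    refine h2.trans ?_
    rw [mul_div_assoc', div_le_div_iff₀ hv (by positivity)]
    have h3 : T + v ^ 2 ≤ 2 * v ^ 2 := by linarith
    have h4 : a * (T + v ^ 2) ≤ A * (2 * v ^ 2) := by gcongr
    have h5 : A * (2 * v ^ 2) ≤ 4 * A * T * v := by
      have : v ^ 2 ≤ T * v := by nlinarith
      nlinarith
    linarith

theorem arctan_add_sub_arctan_le {T a A u : ℝ} (hT : 1 ≤ T) (ha : 1 ≤ a) (haA : a ≤ A)
    (hu : 0 ≤ u) :
    Real.arctan ((u + T) / a) - Real.arctan (u / a) ≤ 4 * A * (T / (T + u ^ 2)) := by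
  have ha0 : 0 < a := by linarith
  have hA : 1 ≤ A := ha.trans haA
  rcases le_or_gt (u ^ 2) T with h | h
  · have h1 : (1 : ℝ) / 2 ≤ T / (T + u ^ 2) := by
      rw [div_le_div_iff₀ (by norm_num) (by positivity)]
      linarith
    have h2 : 0 ≤ Real.arctan (u / a) := Real.arctan_nonneg.2 (by positivity)
    have h3 := Real.pi_lt_four
    have h4 := Real.arctan_lt_pi_div_two ((u + T) / a)
    nlinarith
  · refine (arctan_sub_arctan_le (by positivity) (by gcongr; linarith)).trans ?_
    have h1 : ((u + T) / a - u / a) / (1 + (u / a) ^ 2) = a * T / (a ^ 2 + u ^ 2) := by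
      field_simp
      ring
    rw [h1, mul_div_assoc', div_le_div_iff₀ (by positivity) (by positivity)]
    have h3 : T + u ^ 2 ≤ 2 * (a ^ 2 + u ^ 2) := by nlinarith
    have h4 : a * T * (T + u ^ 2) ≤ A * T * (2 * (a ^ 2 + u ^ 2)) := by gcongr
    have h5 : 0 ≤ A * T * (a ^ 2 + u ^ 2) := by positivity
    nlinarith

/-- `∫_0^T (p(t - γ) - p(-t - γ)) dt` for the Poisson kernel `p(u) = a / (a² + u²)`. -/
def oddPoisson (a γ T : ℝ) : ℝ :=
  Real.arctan ((T - γ) / a) - Real.arctan ((T + γ) / a) + 2 * Real.arctan (γ / a)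

/-- The sign of `γ`, cut off at height `T`. -/
def truncSign (T γ : ℝ) : ℝ := if |γ| ≤ T then Real.sign γ else 0

theorem oddPoisson_neg (a γ T : ℝ) : oddPoisson a (-γ) T = -oddPoisson a γ T := by
  rw [oddPoisson, oddPoisson, neg_div, Real.arctan_neg, sub_neg_eq_add, ← sub_eq_add_neg]
  ring

theorem truncSign_neg (T γ : ℝ) : truncSign T (-γ) = -truncSign T γ := by
  rw [truncSign, truncSign, abs_neg, Real.sign_neg]
  split_ifs <;> simp

theorem abs_pi_mul_truncSign_sub_oddPoisson_le {T a A γ : ℝ} (hT : 1 ≤ T) (ha : 1 ≤ a)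
    (haA : a ≤ A) :
    |Real.pi * truncSign T γ - oddPoisson a γ T| ≤
      8 * A * (T / (T + (T - γ) ^ 2) + T / (T + (-T - γ) ^ 2) + T / (T + (0 - γ) ^ 2)) := by
  wlog hγ : 0 ≤ γ generalizing γ
  · have h := this (γ := -γ) (by linarith)
    rw [oddPoisson_neg, truncSign_neg, mul_neg, ← neg_sub', abs_neg] at h
    refine h.trans_eq ?_
    have e1 : (T - -γ) ^ 2 = (-T - γ) ^ 2 := by ring
    have e2 : (-T - -γ) ^ 2 = (T - γ) ^ 2 := by ring
    have e3 : (0 - -γ) ^ 2 = (0 - γ) ^ 2 := by ring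
    rw [e1, e2, e3]
    ring
  have ha0 : 0 < a := by linarith
  have hA : 0 < A := by linarith
  have hT0 : 0 < T := by linarith
  have hK : 0 ≤ 8 * A * (T / (T + (-T - γ) ^ 2)) := by positivity
  have e3 : (0 - γ) ^ 2 = γ ^ 2 := by ring
  have hK1 : 0 ≤ A * (T / (T + (T - γ) ^ 2)) := by positivity
  have hK2 : 0 ≤ A * (T / (T + γ ^ 2)) := by positivity
  rw [e3, mul_add, mul_add]
  rcases hγ.lt_or_eq with hpos | h0
  · rcases le_or_gt γ T with hle | hgt
    · rw [truncSign, if_pos (by rwa [abs_of_nonneg hγ]), Real.sign_of_pos hpos, oddPoisson]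
      have h1 := pi_div_two_sub_arctan_le hT ha haA (sub_nonneg.2 hle) (by linarith : T - γ ≤ T)
      have h2 := pi_div_two_sub_arctan_le hT ha haA hγ hle
      have h3 := Real.arctan_lt_pi_div_two ((T + γ) / a)
      have h4 := Real.arctan_lt_pi_div_two (γ / a)
      have h5 : Real.arctan ((T - γ) / a) ≤ Real.arctan ((T + γ) / a) :=
        Real.arctan_strictMono.monotone (by gcongr; linarith)
      rw [abs_le]
      constructor <;> linarith
    · rw [truncSign, if_neg (by rw [abs_of_nonneg hγ]; linarith), oddPoisson]
      have h1 := arctan_add_sub_arctan_le hT ha haA (show 0 ≤ γ - T by linarith)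
      have h2 := arctan_add_sub_arctan_le hT ha haA hγ
      have e1 : γ - T + T = γ := by ring
      have e2 : (γ - T) ^ 2 = (T - γ) ^ 2 := by ring
      rw [e1, e2] at h1
      have h3 : Real.arctan ((T - γ) / a) = -Real.arctan ((γ - T) / a) := by
        rw [← Real.arctan_neg, ← neg_div, neg_sub]
      have h4 : Real.arctan ((γ - T) / a) ≤ Real.arctan (γ / a) :=
        Real.arctan_strictMono.monotone (by gcongr; linarith)
      have h5 : Real.arctan (γ / a) ≤ Real.arctan ((γ + T) / a) :=
        Real.arctan_strictMono.monotone (by gcongr; linarith)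
      rw [h3, add_comm T γ, abs_le]
      constructor <;> linarith
  · rw [← h0, truncSign, oddPoisson]
    simp
    positivity

theorem integral_poisson {a : ℝ} (ha : 0 < a) (γ T : ℝ) :
    ∫ t in (0 : ℝ)..T, (a / (a ^ 2 + (t - γ) ^ 2) - a / (a ^ 2 + (-t - γ) ^ 2)) =
      oddPoisson a γ T := by
  have h1 : ∀ c ε : ℝ, ε ^ 2 = 1 → ∀ t : ℝ, HasDerivAt (fun t => ε * Real.arctan ((ε * t - c) / a))
      (a / (a ^ 2 + (ε * t - c) ^ 2)) t := by
    intro c ε hε t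
    have h2 : HasDerivAt (fun t : ℝ => (ε * t - c) / a) (ε / a) t := by
      simpa using (((hasDerivAt_id t).const_mul ε).sub_const c).div_const a
    refine (h2.arctan.const_mul ε).congr_deriv ?_
    field_simp
    linear_combination hε
  have h3 : ∀ t : ℝ, HasDerivAt (fun t => 1 * Real.arctan ((1 * t - γ) / a) -
      (-1) * Real.arctan ((-1 * t - γ) / a))
      (a / (a ^ 2 + (t - γ) ^ 2) - a / (a ^ 2 + (-t - γ) ^ 2)) t := by
    intro t
    have := (h1 γ 1 (by norm_num) t).sub (h1 γ (-1) (by norm_num) t)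
    simp only [one_mul, neg_one_mul] at this ⊢
    exact this
  rw [intervalIntegral.integral_eq_sub_of_hasDerivAt (fun t _ => h3 t)]
  · have e1 : (-1 * T - γ) / a = -((T + γ) / a) := by ring
    have e2 : (-1 * 0 - γ) / a = -(γ / a) := by ring
    have e3 : (1 * 0 - γ) / a = -(γ / a) := by ring
    rw [e1, e2, e3, Real.arctan_neg, Real.arctan_neg, oddPoisson, one_mul T]
    ring
  · apply Continuous.intervalIntegrable
    have h4 : ∀ u : ℝ, a ^ 2 + u ^ 2 ≠ 0 := fun u => by positivity
    exact (continuous_const.div (by fun_prop) fun t => h4 _).sub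
      (continuous_const.div (by fun_prop) fun t => h4 _)


/-- A function `h` with simple poles of residue `m ρ` at points `ρ` of a vertical strip, given by
its Mittag-Leffler expansion, whose size and symmetry are controlled to the right of the strip. -/
structure StripExpansion (m : ℂ → ℕ) (h : ℂ → ℂ) (B : ℂ) (b σ : ℝ) : Prop where
  summable : Summable fun ρ : ℂ => (m ρ : ℝ) / (1 + ‖ρ‖) ^ 2
  b_nonneg : 0 ≤ b
  abs_re_le : ∀ ρ, m ρ ≠ 0 → |ρ.re| ≤ b
  lt_sigma : b + 1 ≤ σ
  hasSum : ∀ z, m z = 0 → HasSum (fun ρ : ℂ => (m ρ : ℂ) * (1 / (z - ρ) + 1 / ρ)) (h z - B)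
  reflect : ∀ ρ, m (1 - conj ρ) = m ρ
  re_eq_zero : ∃ s₀ : ℂ, s₀.re = 1 / 2 ∧ m s₀ = 0 ∧ (h s₀).re = 0
  growth : ∃ C : ℝ, ∀ s : ℂ, σ ≤ s.re → ‖h s‖ ≤ C * (1 + ‖s‖) ^ (1 / 4 : ℝ)
  odd_integral : ∃ C : ℝ, ∀ T : ℝ, 1 ≤ T →
    |∫ t in (0 : ℝ)..T, ((h (σ + t * Complex.I)).re - (h (σ + (-t : ℝ) * Complex.I)).re)| ≤
      C * T ^ (3 / 4 : ℝ)
  im_tendsto : Tendsto (fun x : ℝ => (h x).im) atTop (𝓝 0)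

namespace StripExpansion

variable {m : ℂ → ℕ} {h : ℂ → ℂ} {B : ℂ} {b σ : ℝ}

theorem one_add_norm_sq_le (E : StripExpansion m h B b σ) {ρ : ℂ} (hρ : m ρ ≠ 0) :
    (1 + ‖ρ‖) ^ 2 ≤ 2 * (1 + b) ^ 2 * (1 + ρ.im ^ 2) := by
  have h1 := Complex.norm_le_abs_re_add_abs_im ρ
  have h2 := E.abs_re_le ρ hρ
  have h3 := E.b_nonneg
  have h4 : 1 + ‖ρ‖ ≤ (1 + b) * (1 + |ρ.im|) := by nlinarith [abs_nonneg ρ.im]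
  have h5 : (1 + |ρ.im|) ^ 2 ≤ 2 * (1 + ρ.im ^ 2) := by
    rw [← sq_abs ρ.im]
    nlinarith [sq_nonneg (1 - |ρ.im|)]
  calc (1 + ‖ρ‖) ^ 2 ≤ ((1 + b) * (1 + |ρ.im|)) ^ 2 := by gcongr
    _ = (1 + b) ^ 2 * (1 + |ρ.im|) ^ 2 := by ring
    _ ≤ (1 + b) ^ 2 * (2 * (1 + ρ.im ^ 2)) := by gcongr
    _ = _ := by ring

theorem summable_im (E : StripExpansion m h B b σ) :
    Summable fun ρ : ℂ => (m ρ : ℝ) * (1 / (1 + ρ.im ^ 2)) := by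
  refine (E.summable.mul_left (2 * (1 + b) ^ 2)).of_nonneg_of_le (fun ρ => by positivity)
    fun ρ => ?_
  rcases eq_or_ne (m ρ) 0 with h0 | h0
  · simp [h0]
  · rw [mul_one_div, mul_div_assoc', div_le_div_iff₀ (by positivity) (by positivity)]
    have := E.one_add_norm_sq_le h0
    calc (m ρ : ℝ) * (1 + ‖ρ‖) ^ 2 ≤ m ρ * (2 * (1 + b) ^ 2 * (1 + ρ.im ^ 2)) := by gcongr
      _ = _ := by ring

theorem summable_of_abs_le (E : StripExpansion m h B b σ) {f : ℂ → ℝ} {C : ℝ}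
    (hf : ∀ ρ, m ρ ≠ 0 → |f ρ| ≤ C / (1 + ρ.im ^ 2)) : Summable fun ρ : ℂ => (m ρ : ℝ) * f ρ := by
  refine (E.summable_im.mul_left C).of_norm_bounded fun ρ => ?_
  rcases eq_or_ne (m ρ) 0 with h0 | h0
  · simp [h0]
  · rw [Real.norm_eq_abs, abs_mul, Nat.abs_cast]
    calc (m ρ : ℝ) * |f ρ| ≤ m ρ * (C / (1 + ρ.im ^ 2)) := by gcongr; exact hf ρ h0
      _ = _ := by ring

theorem re_one_div_sub (z ρ : ℂ) :
    (1 / (z - ρ)).re = (z.re - ρ.re) / ((z.re - ρ.re) ^ 2 + (z.im - ρ.im) ^ 2) := by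
  rw [one_div, Complex.inv_re, Complex.normSq_apply]
  simp only [Complex.sub_re, Complex.sub_im, sq]

theorem im_one_div_sub (z ρ : ℂ) :
    (1 / (z - ρ)).im = (ρ.im - z.im) / ((z.re - ρ.re) ^ 2 + (z.im - ρ.im) ^ 2) := by
  rw [one_div, Complex.inv_im, Complex.normSq_apply]
  simp only [Complex.sub_re, Complex.sub_im, sq]
  ring

theorem hasSum_re (E : StripExpansion m h B b σ) {z : ℂ} (hz : m z = 0) :
    HasSum (fun ρ : ℂ => (m ρ : ℝ) * (1 / (z - ρ)).re) (h z).re := by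
  have hb := E.b_nonneg
  have h1 : Summable fun ρ : ℂ => (m ρ : ℝ) * (1 / ρ).re := by
    have h2 : Summable fun ρ : ℂ => (m ρ : ℂ) * ((if m ρ = 0 then 0 else (1 / ρ).re : ℝ) : ℂ) := by
      refine summable_of_norm_le_div_sq E.summable (C := 4 * b) (R := 1) fun ρ hρ => ?_
      have hpos : 0 < ‖ρ‖ := by linarith
      split_ifs with h0
      · simp only [Complex.ofReal_zero, norm_zero]
        positivity
      · rw [Complex.norm_real, Real.norm_eq_abs, one_div, Complex.inv_re, abs_div,
          Complex.normSq_eq_norm_sq, abs_of_nonneg (sq_nonneg ‖ρ‖),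
          div_le_div_iff₀ (by positivity) (by positivity)]
        have h3 := E.abs_re_le ρ h0
        have h4 : (1 + ‖ρ‖) ^ 2 ≤ (2 * ‖ρ‖) ^ 2 := by gcongr; linarith
        calc |ρ.re| * (1 + ‖ρ‖) ^ 2 ≤ b * (2 * ‖ρ‖) ^ 2 := by gcongr
          _ = _ := by ring
    refine (Complex.hasSum_re h2.hasSum).summable.congr fun ρ => ?_
    rw [← Complex.ofReal_natCast, ← Complex.ofReal_mul, Complex.ofReal_re]
    split_ifs with h0
    · simp [h0]
    · rfl
  set c : ℝ := B.re + ∑' ρ : ℂ, (m ρ : ℝ) * (1 / ρ).re with hc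
  have key : ∀ z, m z = 0 → HasSum (fun ρ : ℂ => (m ρ : ℝ) * (1 / (z - ρ)).re) ((h z).re - c) := by
    intro z hz
    have h2 := (Complex.hasSum_re (E.hasSum z hz)).sub h1.hasSum
    have h3 : (h z).re - c = (h z - B).re - ∑' ρ : ℂ, (m ρ : ℝ) * (1 / ρ).re := by
      rw [Complex.sub_re, hc]
      ring
    rw [h3]
    refine h2.congr_fun fun ρ => ?_
    rw [← Complex.ofReal_natCast, Complex.re_ofReal_mul, Complex.add_re]
    ring
  obtain ⟨s₀, hs₀, hms₀, hh⟩ := E.re_eq_zero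
  have hk := key s₀ hms₀
  rw [hh, zero_sub] at hk
  have hinv : Function.Involutive fun ρ : ℂ => 1 - conj ρ := fun ρ => by simp
  have h3 : HasSum (fun ρ : ℂ => (m ρ : ℝ) * (1 / (s₀ - (1 - conj ρ))).re) (-c) := by
    have := (Equiv.hasSum_iff (hinv.toPerm)).2 hk
    refine this.congr_fun ?_
    intro ρ
    simp [E.reflect]
  have h4 : ∀ ρ : ℂ, (1 / (s₀ - (1 - conj ρ))).re = -(1 / (s₀ - ρ)).re := by
    intro ρ
    rw [re_one_div_sub, re_one_div_sub]
    simp only [Complex.sub_re, Complex.one_re, Complex.conj_re, Complex.sub_im, Complex.one_im,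
      Complex.conj_im, hs₀]
    rw [← neg_div]
    congr 1
    · ring
    · ring
  simp only [h4, mul_neg] at h3
  have h5 := h3.unique hk.neg
  have h6 : c = 0 := by linarith
  simpa [h6] using key z hz

theorem eq_zero_of_lt_re (E : StripExpansion m h B b σ) {z : ℂ} (hz : b < z.re) : m z = 0 := by
  by_contra h0
  have := (abs_le.1 (E.abs_re_le z h0)).2
  linarith

/-- The number of points near height `y`, on the scale `√T`. -/
theorem sum_local_le (E : StripExpansion m h B b σ) :
    ∃ C : ℝ, 0 ≤ C ∧ ∀ T y : ℝ, 1 ≤ T → |y| ≤ T →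
      Summable (fun ρ : ℂ => (m ρ : ℝ) * (T / (T + (y - ρ.im) ^ 2))) ∧
      ∑' ρ : ℂ, (m ρ : ℝ) * (T / (T + (y - ρ.im) ^ 2)) ≤ C * T ^ (3 / 4 : ℝ) := by
  obtain ⟨C, hC⟩ := E.growth
  have hb := E.b_nonneg
  have hσ := E.lt_sigma
  set K : ℝ := 1 + σ + b with hK
  have hK1 : 1 ≤ K := by linarith
  have hσ3 : 0 ≤ 3 + σ := by linarith
  refine ⟨K ^ 2 * (|C| * (3 + σ) ^ (1 / 4 : ℝ)), by positivity, fun T y hT hy => ?_⟩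
  have hT0 : 0 < T := by linarith
  set s : ℂ := ⟨σ + √T, y⟩ with hs
  have hsq : 1 ≤ √T := Real.one_le_sqrt.2 hT
  have hsqT : √T ^ 2 = T := Real.sq_sqrt hT0.le
  have hre : s.re = σ + √T := rfl
  have him : s.im = y := rfl
  have h1 := E.hasSum_re (z := s) (E.eq_zero_of_lt_re (by rw [hre]; linarith))
  have h2 : ∀ ρ : ℂ, (m ρ : ℝ) * (T / (T + (y - ρ.im) ^ 2)) ≤
      K ^ 2 * √T * ((m ρ : ℝ) * (1 / (s - ρ)).re) := by
    intro ρ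
    rcases eq_or_ne (m ρ) 0 with h0 | h0
    · simp [h0]
    rw [mul_left_comm]
    gcongr
    rw [re_one_div_sub, hre, him]
    obtain ⟨h3, h4⟩ := abs_le.1 (E.abs_re_le ρ h0)
    set a : ℝ := σ + √T - ρ.re with ha
    have ha1 : √T ≤ a := by linarith
    have ha2 : a ≤ K * √T := by nlinarith
    have ha0 : 0 < a := by linarith
    have h5 : a ^ 2 + (y - ρ.im) ^ 2 ≤ K ^ 2 * (T + (y - ρ.im) ^ 2) := by
      have h6 : a ^ 2 ≤ (K * √T) ^ 2 := by gcongr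
      rw [mul_pow, hsqT] at h6
      have h7 : 1 ≤ K ^ 2 := one_le_pow₀ hK1
      nlinarith [sq_nonneg (y - ρ.im)]
    rw [mul_div_assoc', div_le_div_iff₀ (by positivity) (by positivity)]
    calc T * (a ^ 2 + (y - ρ.im) ^ 2) ≤ T * (K ^ 2 * (T + (y - ρ.im) ^ 2)) := by gcongr
      _ = K ^ 2 * √T * √T * (T + (y - ρ.im) ^ 2) := by
        rw [mul_assoc (K ^ 2), ← sq, hsqT]; ring
      _ ≤ K ^ 2 * √T * a * (T + (y - ρ.im) ^ 2) := by gcongr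
  have h3 := h1.mul_left (K ^ 2 * √T)
  have h4 : Summable (fun ρ : ℂ => (m ρ : ℝ) * (T / (T + (y - ρ.im) ^ 2))) :=
    h3.summable.of_nonneg_of_le (fun ρ => by positivity) h2
  refine ⟨h4, (h4.tsum_le_tsum h2 h3.summable).trans ?_⟩
  rw [h3.tsum_eq]
  have h5 : (h s).re ≤ |C| * (3 + σ) ^ (1 / 4 : ℝ) * T ^ (1 / 4 : ℝ) := by
    refine (Complex.re_le_norm _).trans ((hC s (by rw [hre]; linarith)).trans ?_)
    rw [mul_assoc, ← Real.mul_rpow (by linarith) hT0.le]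
    have h6 : ‖s‖ ≤ σ + √T + T := by
      refine (Complex.norm_le_abs_re_add_abs_im s).trans ?_
      rw [hre, him, abs_of_pos (by linarith)]
      linarith
    have h7 : √T ≤ T := by nlinarith
    gcongr
    · exact le_abs_self C
    · nlinarith
  have h6 : T ^ (3 / 4 : ℝ) = √T * T ^ (1 / 4 : ℝ) := by
    rw [Real.sqrt_eq_rpow, ← Real.rpow_add hT0]
    norm_num
  rw [h6]
  calc K ^ 2 * √T * (h s).re
      ≤ K ^ 2 * √T * (|C| * (3 + σ) ^ (1 / 4 : ℝ) * T ^ (1 / 4 : ℝ)) := by gcongr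
    _ = _ := by ring

theorem countable_support (E : StripExpansion m h B b σ) : {ρ | m ρ ≠ 0}.Countable := by
  refine E.summable.countable_support.mono fun ρ hρ => ?_
  have : (m ρ : ℝ) ≠ 0 := by exact_mod_cast hρ
  simp only [Function.mem_support]
  positivity

theorem hasSum_oddPoisson (E : StripExpansion m h B b σ) {T : ℝ} (hT : 1 ≤ T) :
    HasSum (fun ρ : ℂ => (m ρ : ℝ) * oddPoisson (σ - ρ.re) ρ.im T)
      (∫ t in (0 : ℝ)..T,
        ((h (σ + t * Complex.I)).re - (h (σ + (-t : ℝ) * Complex.I)).re)) := by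
  have hb := E.b_nonneg
  have hσ := E.lt_sigma
  set ι := {ρ : ℂ // m ρ ≠ 0}
  have : Countable ι := E.countable_support.to_subtype
  set p : ι → ℝ → ℝ := fun ρ t => (σ - ρ.1.re) / ((σ - ρ.1.re) ^ 2 + (t - ρ.1.im) ^ 2) with hp
  have ha : ∀ ρ : ι, 1 ≤ σ - ρ.1.re ∧ σ - ρ.1.re ≤ σ + b := fun ρ => by
    obtain ⟨h3, h4⟩ := abs_le.1 (E.abs_re_le ρ.1 ρ.2)
    constructor <;> linarith
  have hpsum : ∀ t : ℝ, HasSum (fun ρ : ι => (m ρ : ℝ) * p ρ t) (h (σ + t * Complex.I)).re := by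
    intro t
    have h1 := E.hasSum_re (z := σ + t * Complex.I) (E.eq_zero_of_lt_re (by simp; linarith))
    rw [← hasSum_subtype_iff_of_support_subset (s := {ρ | m ρ ≠ 0})
      (fun ρ hρ => by
        by_contra h0
        simp only [Set.mem_ofPred_eq, not_not] at h0
        simp [h0] at hρ)] at h1
    refine h1.congr_fun fun ρ => ?_
    simp only [Function.comp, hp, re_one_div_sub]
    simp
  have hpc : ∀ ρ : ι, Continuous (p ρ) := fun ρ => by
    have := (ha ρ).1
    exact continuous_const.div (by fun_prop) fun t => by positivity
  have hpb : ∀ (ρ : ι) (t : ℝ), |t| ≤ T →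
      |p ρ t| ≤ (2 * (σ + b) * (1 + T ^ 2)) * (1 / (1 + ρ.1.im ^ 2)) := by
    intro ρ t ht
    obtain ⟨h1, h2⟩ := ha ρ
    have h3 : t ^ 2 ≤ T ^ 2 := sq_le_sq' (abs_le.1 ht).1 (abs_le.1 ht).2
    have h4 : 1 + ρ.1.im ^ 2 ≤ 2 * (1 + T ^ 2) * (1 + (t - ρ.1.im) ^ 2) := by
      nlinarith [sq_nonneg (2 * t - ρ.1.im), mul_nonneg (sq_nonneg T) (sq_nonneg (t - ρ.1.im))]
    have h5 : 1 + (t - ρ.1.im) ^ 2 ≤ (σ - ρ.1.re) ^ 2 + (t - ρ.1.im) ^ 2 := by nlinarith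
    have h6 : 0 < σ - ρ.1.re := by linarith
    have h7 : 0 ≤ σ + b := by linarith
    simp only [hp]
    rw [abs_of_nonneg (by positivity), mul_one_div, div_le_div_iff₀ (by positivity)
      (by positivity)]
    calc (σ - ρ.1.re) * (1 + ρ.1.im ^ 2)
        ≤ (σ + b) * (2 * (1 + T ^ 2) * (1 + (t - ρ.1.im) ^ 2)) := by gcongr
      _ ≤ (σ + b) * (2 * (1 + T ^ 2) * ((σ - ρ.1.re) ^ 2 + (t - ρ.1.im) ^ 2)) := by gcongr
      _ = _ := by ring
  have hbs : Summable fun ρ : ι =>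
      2 * ((2 * (σ + b) * (1 + T ^ 2)) * ((m ρ : ℝ) * (1 / (1 + ρ.1.im ^ 2)))) :=
    ((E.summable_im.subtype {ρ | m ρ ≠ 0}).mul_left _).mul_left _
  have key := intervalIntegral.hasSum_integral_of_dominated_convergence
    (μ := MeasureTheory.volume) (a := 0) (b := T)
    (F := fun (ρ : ι) (t : ℝ) => (m ρ : ℝ) * (p ρ t - p ρ (-t)))
    (f := fun t : ℝ => (h (σ + t * Complex.I)).re - (h (σ + (-t : ℝ) * Complex.I)).re)
    (fun ρ _ => 2 * ((2 * (σ + b) * (1 + T ^ 2)) * ((m ρ : ℝ) * (1 / (1 + ρ.1.im ^ 2)))))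
    (fun ρ => ((continuous_const.mul ((hpc ρ).sub ((hpc ρ).comp continuous_neg)))
      |>.aestronglyMeasurable)) ?_ ?_ ?_ ?_
  · rw [← hasSum_subtype_iff_of_support_subset (s := {ρ | m ρ ≠ 0})
      (fun ρ hρ => by
        by_contra h0
        simp only [Set.mem_ofPred_eq, not_not] at h0
        simp [h0] at hρ)]
    refine key.congr_fun fun ρ => ?_
    have h6 : 0 < σ - ρ.1.re := by linarith [(ha ρ).1]
    simp only [Function.comp]
    rw [intervalIntegral.integral_const_mul, ← integral_poisson h6]
  · intro ρ
    refine Eventually.of_forall fun t ht => ?_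
    rw [Set.uIoc_of_le (by linarith)] at ht
    have h1 := hpb ρ t (by rw [abs_of_pos ht.1]; exact ht.2)
    have h2 := hpb ρ (-t) (by rw [abs_neg, abs_of_pos ht.1]; exact ht.2)
    rw [Real.norm_eq_abs, abs_mul, Nat.abs_cast]
    have h3 : |p ρ t - p ρ (-t)| ≤
        2 * ((2 * (σ + b) * (1 + T ^ 2)) * (1 / (1 + ρ.1.im ^ 2))) :=
      (abs_sub _ _).trans (by linarith)
    calc (m ρ : ℝ) * |p ρ t - p ρ (-t)|
        ≤ m ρ * (2 * ((2 * (σ + b) * (1 + T ^ 2)) * (1 / (1 + ρ.1.im ^ 2)))) := by gcongr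
      _ = _ := by ring
  · exact Eventually.of_forall fun t _ => hbs
  · exact intervalIntegrable_const
  · refine Eventually.of_forall fun t _ => ?_
    have := (hpsum t).sub (hpsum (-t))
    simpa [mul_sub] using this

end StripExpansion

theorem rpow_div_sq_add_sq_le {x t : ℝ} (hx : 1 ≤ x) (ht : 0 ≤ t) :
    (1 + t) ^ (3 / 4 : ℝ) * (1 / (x ^ 2 + t ^ 2)) ≤
      2 * x ^ (-(1 / 8) : ℝ) * (1 + t) ^ (-(9 / 8) : ℝ) := by
  have hx0 : 0 < x := by linarith
  have h1 : x ^ (1 / 8 : ℝ) * (1 + t) ^ (15 / 8 : ℝ) ≤ 2 * (x ^ 2 + t ^ 2) := by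
    calc x ^ (1 / 8 : ℝ) * (1 + t) ^ (15 / 8 : ℝ)
        ≤ (x + t) ^ (1 / 8 : ℝ) * (x + t) ^ (15 / 8 : ℝ) := by gcongr; linarith
      _ = (x + t) ^ 2 := by
        rw [← Real.rpow_add (by positivity), ← Real.rpow_two]
        norm_num
      _ ≤ _ := by nlinarith [sq_nonneg (x - t)]
  have h2 : (1 + t) ^ (15 / 8 : ℝ) = (1 + t) ^ (3 / 4 : ℝ) * (1 + t) ^ (9 / 8 : ℝ) := by
    rw [← Real.rpow_add (by positivity)]
    norm_num
  rw [Real.rpow_neg hx0.le, Real.rpow_neg (by positivity), mul_one_div, mul_assoc, ← mul_inv,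
    ← div_eq_mul_inv, div_le_div_iff₀ (by positivity) (by positivity)]
  rw [h2] at h1
  linarith

theorem integral_one_add_rpow_le {S T : ℝ} (hS : 0 ≤ S) (hST : S ≤ T) :
    ∫ t in S..T, (1 + t) ^ (-(9 / 8) : ℝ) ≤ 8 * (1 + S) ^ (-(1 / 8) : ℝ) := by
  have h1 : ∀ t ∈ Set.uIcc S T, HasDerivAt (fun t : ℝ => -8 * (1 + t) ^ (-(1 / 8) : ℝ))
      ((1 + t) ^ (-(9 / 8) : ℝ)) t := by
    intro t ht
    rw [Set.uIcc_of_le hST] at ht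
    have h2 : HasDerivAt (fun t : ℝ => 1 + t) 1 t := (hasDerivAt_id t).const_add 1
    have h3 := (h2.rpow_const (p := -(1 / 8)) (Or.inl (by linarith [ht.1]))).const_mul (-8)
    refine h3.congr_deriv ?_
    norm_num
    ring
  rw [intervalIntegral.integral_eq_sub_of_hasDerivAt h1]
  · have : 0 ≤ (1 + T) ^ (-(1 / 8) : ℝ) := Real.rpow_nonneg (by linarith) _
    linarith
  · refine ContinuousOn.intervalIntegrable fun t ht => ?_
    rw [Set.uIcc_of_le hST] at ht
    exact ((continuousAt_const.add continuousAt_id).rpow_const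
      (Or.inl (by simp; linarith [ht.1]))).continuousWithinAt

/-- The derivative of `t / (x² + t²)`. -/
def kernelDeriv (x t : ℝ) : ℝ := (x ^ 2 - t ^ 2) / (x ^ 2 + t ^ 2) ^ 2

theorem continuous_kernelDeriv {x : ℝ} (hx : 0 < x) : Continuous (kernelDeriv x) :=
  Continuous.div (by fun_prop) (by fun_prop) fun t => by positivity

theorem abs_kernelDeriv_le {x : ℝ} (hx : 0 < x) (t : ℝ) :
    |kernelDeriv x t| ≤ 1 / (x ^ 2 + t ^ 2) := by
  have h1 : |x ^ 2 - t ^ 2| ≤ x ^ 2 + t ^ 2 := by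
    rw [abs_le]
    constructor <;> nlinarith [sq_nonneg x, sq_nonneg t]
  rw [kernelDeriv, abs_div, abs_of_pos (show 0 < (x ^ 2 + t ^ 2) ^ 2 by positivity),
    div_le_div_iff₀ (by positivity) (by positivity), one_mul, sq (x ^ 2 + t ^ 2)]
  gcongr

theorem integral_kernelDeriv {x : ℝ} (hx : 0 < x) (r T : ℝ) :
    ∫ t in r..T, kernelDeriv x t = T / (x ^ 2 + T ^ 2) - r / (x ^ 2 + r ^ 2) := by
  rw [intervalIntegral.integral_eq_sub_of_hasDerivAt (f := fun t => t / (x ^ 2 + t ^ 2))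
    (fun t _ => ?_) ((continuous_kernelDeriv hx).intervalIntegrable _ _)]
  have h1 : HasDerivAt (fun t : ℝ => x ^ 2 + t ^ 2) (2 * t) t := by
    simpa using! (hasDerivAt_pow 2 t).const_add (x ^ 2)
  refine ((hasDerivAt_id t).div h1 (by positivity)).congr_deriv ?_
  rw [kernelDeriv]
  simp only [id]
  ring

theorem integrable_indicator_kernelDeriv {x : ℝ} (hx : 0 < x) (r T : ℝ) (hT : 0 ≤ T) :
    IntervalIntegrable ((Set.Ici r).indicator (kernelDeriv x)) MeasureTheory.volume 0 T := by
  rw [intervalIntegrable_iff_integrableOn_Ioc_of_le hT]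
  refine MeasureTheory.Integrable.indicator ?_ measurableSet_Ici
  exact ((continuous_kernelDeriv hx).intervalIntegrable 0 T).1

theorem integral_indicator_kernelDeriv {x : ℝ} (hx : 0 < x) {r T : ℝ} (hr : 0 < r) (hrT : r ≤ T) :
    ∫ t in (0 : ℝ)..T, (Set.Ici r).indicator (kernelDeriv x) t =
      T / (x ^ 2 + T ^ 2) - r / (x ^ 2 + r ^ 2) := by
  rw [intervalIntegral.integral_of_le (by linarith),
    MeasureTheory.setIntegral_indicator measurableSet_Ici]
  have h1 : Set.Ioc 0 T ∩ Set.Ici r = Set.Icc r T := by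
    ext t
    simp only [Set.mem_inter_iff, Set.mem_Ioc, Set.mem_Ici, Set.mem_Icc]
    constructor
    · exact fun h => ⟨h.2, h.1.2⟩
    · exact fun h => ⟨⟨by linarith [h.1], h.2⟩, h.1⟩
  rw [h1, MeasureTheory.integral_Icc_eq_integral_Ioc, ← intervalIntegral.integral_of_le hrT,
    integral_kernelDeriv hx]

namespace StripExpansion

variable {m : ℂ → ℕ} {h : ℂ → ℂ} {B : ℂ} {b σ : ℝ}

theorem finite_abs_im_le (E : StripExpansion m h B b σ) (T : ℝ) :
    {ρ | m ρ ≠ 0 ∧ |ρ.im| ≤ T}.Finite :=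
  (finite_support_inter_closedBall E.summable (b + T)).subset fun ρ hρ =>
    ⟨hρ.1, (Complex.norm_le_abs_re_add_abs_im ρ).trans (add_le_add (E.abs_re_le ρ hρ.1) hρ.2)⟩

/-- The points at height at most `T`. -/
def upTo (E : StripExpansion m h B b σ) (T : ℝ) : Finset ℂ := (E.finite_abs_im_le T).toFinset

theorem mem_upTo (E : StripExpansion m h B b σ) {T : ℝ} {ρ : ℂ} :
    ρ ∈ E.upTo T ↔ m ρ ≠ 0 ∧ |ρ.im| ≤ T := by simp [upTo]

/-- The number of points in the upper half plane minus the number in the lower half plane, up to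
height `T`. -/
def signedCount (E : StripExpansion m h B b σ) (T : ℝ) : ℝ :=
  ∑ ρ ∈ E.upTo T, (m ρ : ℝ) * Real.sign ρ.im

theorem upTo_mono (E : StripExpansion m h B b σ) : Monotone E.upTo := fun S T hST ρ hρ => by
  rw [mem_upTo] at hρ ⊢
  exact ⟨hρ.1, hρ.2.trans hST⟩

theorem abs_signedCount_le (E : StripExpansion m h B b σ) :
    ∃ C : ℝ, 0 ≤ C ∧ ∀ T : ℝ, 0 ≤ T → |E.signedCount T| ≤ C * (1 + T) ^ (3 / 4 : ℝ) := by
  obtain ⟨C₁, hC₁⟩ := E.odd_integral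
  obtain ⟨C₂, hC₂, hloc⟩ := E.sum_local_le
  have hb := E.b_nonneg
  have hσ := E.lt_sigma
  set A : ℝ := σ + b with hA
  have hA0 : 0 ≤ A := by linarith
  set C₀ : ℝ := ∑ ρ ∈ E.upTo 1, (m ρ : ℝ) with hC₀
  have hC₀0 : 0 ≤ C₀ := by positivity
  refine ⟨C₀ + (|C₁| + 8 * A * (3 * C₂)), by positivity, fun T hT => ?_⟩
  have h1T : (1 : ℝ) ≤ (1 + T) ^ (3 / 4 : ℝ) := Real.one_le_rpow (by linarith) (by norm_num)
  rcases lt_or_ge T 1 with hT1 | hT1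
  · have h1 : |E.signedCount T| ≤ C₀ := by
      refine (Finset.abs_sum_le_sum_abs _ _).trans ?_
      calc ∑ ρ ∈ E.upTo T, |(m ρ : ℝ) * Real.sign ρ.im| ≤ ∑ ρ ∈ E.upTo T, (m ρ : ℝ) := by
            refine Finset.sum_le_sum fun ρ _ => ?_
            rw [abs_mul, Nat.abs_cast]
            refine mul_le_of_le_one_right (Nat.cast_nonneg _) ?_
            rcases Real.sign_apply_eq ρ.im with h | h | h <;> simp [h]
        _ ≤ C₀ := Finset.sum_le_sum_of_subset_of_nonneg (E.upTo_mono hT1.le)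
            fun ρ _ _ => Nat.cast_nonneg _
    have h2 : 0 ≤ |C₁| + 8 * A * (3 * C₂) := by positivity
    nlinarith
  · have hcount : HasSum (fun ρ : ℂ => (m ρ : ℝ) * truncSign T ρ.im) (E.signedCount T) := by
      have h1 : E.signedCount T = ∑ ρ ∈ E.upTo T, (m ρ : ℝ) * truncSign T ρ.im := by
        refine Finset.sum_congr rfl fun ρ hρ => ?_
        rw [truncSign, if_pos (E.mem_upTo.1 hρ).2]
      rw [h1]
      refine hasSum_sum_of_ne_finset_zero fun ρ hρ => ?_
      rw [mem_upTo, not_and_or, not_not] at hρ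
      rcases hρ with h | h
      · simp [h]
      · simp [truncSign, h]
    have hdiff := (hcount.mul_left Real.pi).sub (E.hasSum_oddPoisson hT1)
    obtain ⟨s1, b1⟩ := hloc T T hT1 (abs_of_nonneg hT).le
    obtain ⟨s2, b2⟩ := hloc T (-T) hT1 (by rw [abs_neg, abs_of_nonneg hT])
    obtain ⟨s3, b3⟩ := hloc T 0 hT1 (by simpa)
    have hbd := (((s1.hasSum.add s2.hasSum).add s3.hasSum).mul_left (8 * A))
    have h1 := hdiff.norm_le_of_bounded hbd fun ρ => ?_
    · rw [Real.norm_eq_abs] at h1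
      have h2 := hC₁ T hT1
      have h3 := Real.pi_gt_three
      have h4 : 3 * |E.signedCount T| ≤ |Real.pi * E.signedCount T| := by
        rw [abs_mul, abs_of_pos Real.pi_pos]
        gcongr
      have h5 := abs_sub_abs_le_abs_sub (Real.pi * E.signedCount T)
        (∫ t in (0 : ℝ)..T, ((h (σ + t * Complex.I)).re - (h (σ + (-t : ℝ) * Complex.I)).re))
      have h6 : T ^ (3 / 4 : ℝ) ≤ (1 + T) ^ (3 / 4 : ℝ) := by gcongr; linarith
      have h7 : |E.signedCount T| ≤ (|C₁| + 8 * A * (3 * C₂)) * T ^ (3 / 4 : ℝ) := by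
        have h8 : C₁ * T ^ (3 / 4 : ℝ) ≤ |C₁| * T ^ (3 / 4 : ℝ) := by gcongr; exact le_abs_self _
        have h9 := mul_le_mul_of_nonneg_left (add_le_add (add_le_add b1 b2) b3)
          (show 0 ≤ 8 * A by positivity)
        have h10 := abs_nonneg (E.signedCount T)
        linarith
      exact h7.trans (mul_le_mul (by linarith) h6 (by positivity) (by positivity))
    · rcases eq_or_ne (m ρ) 0 with h0 | h0
      · simp [h0]
      · obtain ⟨h3, h4⟩ := abs_le.1 (E.abs_re_le ρ h0)
        have h2 := abs_pi_mul_truncSign_sub_oddPoisson_le (γ := ρ.im) hT1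
          (show 1 ≤ σ - ρ.re by linarith) (show σ - ρ.re ≤ A by linarith)
        have h5 : Real.pi * ((m ρ : ℝ) * truncSign T ρ.im) -
            m ρ * oddPoisson (σ - ρ.re) ρ.im T =
            m ρ * (Real.pi * truncSign T ρ.im - oddPoisson (σ - ρ.re) ρ.im T) := by ring
        rw [h5, Real.norm_eq_abs, abs_mul, Nat.abs_cast]
        calc _ ≤ (m ρ : ℝ) * _ := mul_le_mul_of_nonneg_left h2 (Nat.cast_nonneg _)
          _ = _ := by ring

theorem signedCount_eq (E : StripExpansion m h B b σ) {t T : ℝ} (htT : t ≤ T) :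
    E.signedCount t =
      ∑ ρ ∈ E.upTo T, (m ρ : ℝ) * Real.sign ρ.im * (Set.Ici |ρ.im|).indicator 1 t := by
  rw [signedCount, ← Finset.sum_subset (E.upTo_mono htT)]
  · refine Finset.sum_congr rfl fun ρ hρ => ?_
    rw [Set.indicator_of_mem (by exact (E.mem_upTo.1 hρ).2)]
    simp
  · intro ρ hρ hρt
    rw [mem_upTo] at hρ hρt
    rw [Set.indicator_of_notMem (by exact fun h => hρt ⟨hρ.1, h⟩), mul_zero]

theorem signedCount_mul_kernelDeriv_eq (E : StripExpansion m h B b σ) (x : ℝ) {t T : ℝ}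
    (htT : t ≤ T) :
    E.signedCount t * kernelDeriv x t = ∑ ρ ∈ E.upTo T,
      (m ρ : ℝ) * Real.sign ρ.im * (Set.Ici |ρ.im|).indicator (kernelDeriv x) t := by
  rw [E.signedCount_eq htT, Finset.sum_mul]
  refine Finset.sum_congr rfl fun ρ _ => ?_
  rw [mul_assoc]
  congr 1
  by_cases ht : t ∈ Set.Ici |ρ.im|
  · simp [Set.indicator_of_mem ht]
  · simp [Set.indicator_of_notMem ht]

theorem intervalIntegrable_signedCount (E : StripExpansion m h B b σ) {x T : ℝ} (hx : 0 < x)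
    (hT : 0 ≤ T) :
    IntervalIntegrable (fun t => E.signedCount t * kernelDeriv x t) MeasureTheory.volume 0 T := by
  have h1 : IntervalIntegrable (fun t => ∑ ρ ∈ E.upTo T,
      (m ρ : ℝ) * Real.sign ρ.im * (Set.Ici |ρ.im|).indicator (kernelDeriv x) t)
      MeasureTheory.volume 0 T := by
    have := IntervalIntegrable.sum (E.upTo T) (μ := MeasureTheory.volume) (a := 0) (b := T)
      (f := fun ρ t => (m ρ : ℝ) * Real.sign ρ.im * (Set.Ici |ρ.im|).indicator (kernelDeriv x) t)
      fun ρ _ => (integrable_indicator_kernelDeriv hx _ T hT).const_mul _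
    refine this.congr fun t _ => ?_
    simp
  refine h1.congr fun t ht => ?_
  rw [Set.uIoc_of_le hT] at ht
  exact (E.signedCount_mul_kernelDeriv_eq x ht.2).symm

/-- Partial summation. -/
theorem sum_im_div_eq (E : StripExpansion m h B b σ) {x T : ℝ} (hx : 0 < x) (hT : 0 ≤ T) :
    ∑ ρ ∈ E.upTo T, (m ρ : ℝ) * (ρ.im / (x ^ 2 + ρ.im ^ 2)) =
      T / (x ^ 2 + T ^ 2) * E.signedCount T -
        ∫ t in (0 : ℝ)..T, E.signedCount t * kernelDeriv x t := by
  have h1 : ∫ t in (0 : ℝ)..T, E.signedCount t * kernelDeriv x t =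
      ∑ ρ ∈ E.upTo T, (m ρ : ℝ) * Real.sign ρ.im *
        ∫ t in (0 : ℝ)..T, (Set.Ici |ρ.im|).indicator (kernelDeriv x) t := by
    rw [intervalIntegral.integral_congr_ae (g := fun t => ∑ ρ ∈ E.upTo T,
      (m ρ : ℝ) * Real.sign ρ.im * (Set.Ici |ρ.im|).indicator (kernelDeriv x) t)
      (Eventually.of_forall fun t ht => ?_)]
    · rw [intervalIntegral.integral_finsetSum fun ρ _ =>
        (integrable_indicator_kernelDeriv hx _ T hT).const_mul _]
      simp only [intervalIntegral.integral_const_mul]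
    · rw [Set.uIoc_of_le hT] at ht
      exact E.signedCount_mul_kernelDeriv_eq x ht.2
  rw [h1, signedCount, Finset.mul_sum, ← Finset.sum_sub_distrib]
  refine Finset.sum_congr rfl fun ρ hρ => ?_
  rcases eq_or_ne ρ.im 0 with h0 | h0
  · simp [h0]
  · rw [integral_indicator_kernelDeriv hx (abs_pos.2 h0) (E.mem_upTo.1 hρ).2, sq_abs]
    have h2 : Real.sign ρ.im * |ρ.im| = ρ.im := by
      rcases lt_or_gt_of_ne h0 with h | h
      · rw [Real.sign_of_neg h, abs_of_neg h]; ring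
      · rw [Real.sign_of_pos h, abs_of_pos h]; ring
    nth_rewrite 1 [← h2]
    ring

theorem exists_tendsto_sum_im_div (E : StripExpansion m h B b σ) :
    ∃ C : ℝ, ∀ x : ℝ, 1 ≤ x → ∃ l : ℝ, |l| ≤ C * x ^ (-(1 / 8) : ℝ) ∧
      Tendsto (fun T => ∑ ρ ∈ E.upTo T, (m ρ : ℝ) * (ρ.im / (x ^ 2 + ρ.im ^ 2))) atTop (𝓝 l) := by
  obtain ⟨C, hC0, hC⟩ := E.abs_signedCount_le
  refine ⟨18 * C, fun x hx => ?_⟩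
  have hx0 : 0 < x := by linarith
  set S : ℝ → ℝ := fun T => ∑ ρ ∈ E.upTo T, (m ρ : ℝ) * (ρ.im / (x ^ 2 + ρ.im ^ 2)) with hS
  set y : ℝ := x ^ (-(1 / 8) : ℝ) with hy
  have hy0 : 0 ≤ y := by positivity
  have hbdry : ∀ T, 0 ≤ T →
      |T / (x ^ 2 + T ^ 2) * E.signedCount T| ≤ 2 * C * y * (1 + T) ^ (-(1 / 8) : ℝ) := by
    intro T hT
    rw [abs_mul, abs_of_nonneg (by positivity)]
    have h1 := rpow_div_sq_add_sq_le hx hT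
    have h2 : (1 + T) ^ (-(1 / 8) : ℝ) = (1 + T) * (1 + T) ^ (-(9 / 8) : ℝ) := by
      nth_rewrite 2 [← Real.rpow_one (1 + T)]
      rw [← Real.rpow_add (by positivity)]
      norm_num
    calc T / (x ^ 2 + T ^ 2) * |E.signedCount T|
        ≤ T / (x ^ 2 + T ^ 2) * (C * (1 + T) ^ (3 / 4 : ℝ)) := by gcongr; exact hC T hT
      _ = T * C * ((1 + T) ^ (3 / 4 : ℝ) * (1 / (x ^ 2 + T ^ 2))) := by ring
      _ ≤ (1 + T) * C * (2 * y * (1 + T) ^ (-(9 / 8) : ℝ)) := by gcongr; linarith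
      _ = _ := by rw [h2]; ring
  have hint : ∀ S T, 0 ≤ S → S ≤ T → |∫ t in S..T, E.signedCount t * kernelDeriv x t| ≤
      16 * C * y * (1 + S) ^ (-(1 / 8) : ℝ) := by
    intro S T hS0 hST
    have h1 := intervalIntegral.norm_integral_le_of_norm_le hST (μ := MeasureTheory.volume)
      (f := fun t => E.signedCount t * kernelDeriv x t)
      (g := fun t => 2 * C * y * (1 + t) ^ (-(9 / 8) : ℝ)) (Eventually.of_forall fun t ht => ?_) ?_
    · rw [Real.norm_eq_abs, intervalIntegral.integral_const_mul] at h1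
      refine h1.trans ?_
      calc _ ≤ 2 * C * y * (8 * (1 + S) ^ (-(1 / 8) : ℝ)) := by
            gcongr; exact integral_one_add_rpow_le hS0 hST
        _ = _ := by ring
    · have ht0 : 0 ≤ t := hS0.trans ht.1.le
      rw [Real.norm_eq_abs, abs_mul]
      calc |E.signedCount t| * |kernelDeriv x t|
          ≤ C * (1 + t) ^ (3 / 4 : ℝ) * (1 / (x ^ 2 + t ^ 2)) := by
            gcongr
            · exact hC t ht0
            · exact abs_kernelDeriv_le hx0 t
        _ = C * ((1 + t) ^ (3 / 4 : ℝ) * (1 / (x ^ 2 + t ^ 2))) := by ring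
        _ ≤ C * (2 * y * (1 + t) ^ (-(9 / 8) : ℝ)) := by
            exact mul_le_mul_of_nonneg_left (rpow_div_sq_add_sq_le hx ht0) hC0
        _ = _ := by ring
    · refine ContinuousOn.intervalIntegrable fun t ht => ?_
      rw [Set.uIcc_of_le hST] at ht
      exact (continuousAt_const.mul ((continuousAt_const.add continuousAt_id).rpow_const
        (Or.inl (by simp; linarith [ht.1])))).continuousWithinAt
  have hle1 : ∀ T : ℝ, 0 ≤ T → (1 + T) ^ (-(1 / 8) : ℝ) ≤ 1 := fun T hT =>
    Real.rpow_le_one_of_one_le_of_nonpos (by linarith) (by norm_num)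
  have hbound : ∀ T, 0 ≤ T → |S T| ≤ 18 * C * y := by
    intro T hT
    simp only [hS]
    rw [E.sum_im_div_eq hx0 hT]
    refine (abs_sub _ _).trans ?_
    have h1 := hbdry T hT
    have h2 := hint 0 T le_rfl hT
    have h3 : 2 * C * y * (1 + T) ^ (-(1 / 8) : ℝ) ≤ 2 * C * y :=
      mul_le_of_le_one_right (by positivity) (hle1 T hT)
    have h4 : 16 * C * y * (1 + 0) ^ (-(1 / 8) : ℝ) ≤ 16 * C * y :=
      mul_le_of_le_one_right (by positivity) (hle1 0 le_rfl)
    linarith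
  have hcauchy : ∀ U V, 0 ≤ U → U ≤ V →
      dist (S U) (S V) ≤ 20 * C * y * (1 + U) ^ (-(1 / 8) : ℝ) := by
    intro U V hU hUV
    have hV := hU.trans hUV
    have h1 := hbdry U hU
    have h2 := hbdry V hV
    have h3 := hint U V hU hUV
    have h4 : (1 + V) ^ (-(1 / 8) : ℝ) ≤ (1 + U) ^ (-(1 / 8) : ℝ) :=
      Real.rpow_le_rpow_of_nonpos (by linarith) (by linarith) (by norm_num)
    have h5 : 2 * C * y * (1 + V) ^ (-(1 / 8) : ℝ) ≤ 2 * C * y * (1 + U) ^ (-(1 / 8) : ℝ) := by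
      gcongr
    have h6 := intervalIntegral.integral_interval_sub_left
      (E.intervalIntegrable_signedCount hx0 hV) (E.intervalIntegrable_signedCount hx0 hU)
    rw [Real.dist_eq]
    simp only [hS]
    rw [E.sum_im_div_eq hx0 hU, E.sum_im_div_eq hx0 hV]
    rw [← h6] at h3
    rw [abs_le] at h1 h2 h3 ⊢
    constructor <;> linarith
  have hCS : CauchySeq fun T : ℝ => S (max T 0) := by
    refine cauchySeq_of_le_tendsto_0'
      (fun U => 20 * C * y * (1 + max U 0) ^ (-(1 / 8) : ℝ)) (fun U V hUV =>
        hcauchy _ _ (le_max_right _ _) (max_le_max_right 0 hUV)) ?_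
    have h1 : Tendsto (fun U : ℝ => 1 + max U 0) atTop atTop :=
      tendsto_atTop_mono (fun U => (le_max_left U 0).trans (by linarith)) tendsto_id
    have h2 := ((tendsto_rpow_neg_atTop (show (0 : ℝ) < 1 / 8 by norm_num)).comp h1).const_mul
      (20 * C * y)
    rw [mul_zero] at h2
    exact h2
  obtain ⟨l, hl⟩ := cauchySeq_tendsto_of_complete hCS
  refine ⟨l, le_of_tendsto hl.abs (Eventually.of_forall fun T => hbound _ (le_max_right _ _)),
    hl.congr' ?_⟩
  filter_upwards [eventually_ge_atTop 0] with T hT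
  rw [max_eq_left hT]

theorem tendsto_sum_upTo (E : StripExpansion m h B b σ) {M : Type*} [AddCommMonoid M]
    [TopologicalSpace M] {f : ℂ → M} {a : M} (hf : HasSum f a) (hf0 : ∀ ρ, m ρ = 0 → f ρ = 0) :
    Tendsto (fun T => ∑ ρ ∈ E.upTo T, f ρ) atTop (𝓝 a) := by
  refine tendsto_finset_sum_of_hasSum hf E.upTo_mono fun ρ hρ => ⟨|ρ.im|, ?_⟩
  exact E.mem_upTo.2 ⟨fun h0 => hρ (hf0 ρ h0), le_rfl⟩

theorem abs_im_sub_le {β c x γ : ℝ} (hβ : |β| ≤ c) (hx : 2 * c + 1 ≤ x) :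
    |γ / ((x - β) ^ 2 + γ ^ 2) - γ / (x ^ 2 + γ ^ 2)| ≤ 12 * c / (x ^ 2 + γ ^ 2) := by
  have hc : 0 ≤ c := (abs_nonneg β).trans hβ
  obtain ⟨h1, h2⟩ := abs_le.1 hβ
  have hx0 : 0 < x := by linarith
  have hxβ : x / 2 ≤ x - β := by linarith
  have hpos : 0 < (x - β) ^ 2 + γ ^ 2 := by
    have : 0 < x - β := by linarith
    positivity
  have h3 : γ / ((x - β) ^ 2 + γ ^ 2) - γ / (x ^ 2 + γ ^ 2) =
      γ * (β * (2 * x - β)) / (((x - β) ^ 2 + γ ^ 2) * (x ^ 2 + γ ^ 2)) := by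
    field_simp
    ring
  have h4 : (x ^ 2 + γ ^ 2) ≤ 4 * ((x - β) ^ 2 + γ ^ 2) := by nlinarith [sq_nonneg γ]
  have h5 : |γ * (β * (2 * x - β))| ≤ 3 * c * (x ^ 2 + γ ^ 2) := by
    have e1 : |2 * x - β| ≤ 3 * x := by
      rw [abs_le]
      constructor <;> linarith
    have e2 : |γ| * x ≤ x ^ 2 + γ ^ 2 := by
      rw [← sq_abs γ]
      nlinarith [sq_nonneg (|γ| - x), abs_nonneg γ]
    rw [abs_mul, abs_mul]
    calc |γ| * (|β| * |2 * x - β|) ≤ |γ| * (c * (3 * x)) := by gcongr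
      _ = 3 * c * (|γ| * x) := by ring
      _ ≤ _ := by gcongr
  rw [h3, abs_div, abs_of_pos (show 0 < ((x - β) ^ 2 + γ ^ 2) * (x ^ 2 + γ ^ 2) by positivity),
    div_le_div_iff₀ (by positivity) (by positivity)]
  calc |γ * (β * (2 * x - β))| * (x ^ 2 + γ ^ 2)
      ≤ 3 * c * (x ^ 2 + γ ^ 2) * (x ^ 2 + γ ^ 2) := by gcongr
    _ ≤ 3 * c * (4 * ((x - β) ^ 2 + γ ^ 2)) * (x ^ 2 + γ ^ 2) := by gcongr
    _ = _ := by ring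

/-- The deviation of `Im 1/(x - ρ)` from `γ / (x² + γ²)`. -/
def imDefect (x : ℝ) (ρ : ℂ) : ℝ := (1 / ((x : ℂ) - ρ)).im - ρ.im / (x ^ 2 + ρ.im ^ 2)

theorem abs_imDefect_le (E : StripExpansion m h B b σ) {x : ℝ} (hx : 2 * b + 1 ≤ x) {ρ : ℂ}
    (hρ : m ρ ≠ 0) : |imDefect x ρ| ≤ 12 * b / (x ^ 2 + ρ.im ^ 2) := by
  have h1 := abs_im_sub_le (γ := ρ.im) (E.abs_re_le ρ hρ) hx
  rw [imDefect, im_one_div_sub]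
  simpa using h1

theorem abs_imDefect_le_of_one_le (E : StripExpansion m h B b σ) {x : ℝ} (hx : 2 * b + 1 ≤ x)
    {ρ : ℂ} (hρ : m ρ ≠ 0) : |imDefect x ρ| ≤ 12 * b / (1 + ρ.im ^ 2) := by
  have hb := E.b_nonneg
  refine (E.abs_imDefect_le hx hρ).trans ?_
  gcongr
  nlinarith

theorem tendsto_tsum_imDefect (E : StripExpansion m h B b σ) :
    Tendsto (fun x : ℝ => ∑' ρ : ℂ, (m ρ : ℝ) * imDefect x ρ) atTop (𝓝 0) := by
  have hb := E.b_nonneg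
  have h0 : (0 : ℝ) = ∑' _ : ℂ, (0 : ℝ) := by simp
  rw [h0]
  refine tendsto_tsum_of_dominated_convergence
    (bound := fun ρ => 12 * b * ((m ρ : ℝ) * (1 / (1 + ρ.im ^ 2))))
    (E.summable_im.mul_left _) (fun ρ => ?_) ?_
  · rcases eq_or_ne (m ρ) 0 with h1 | h1
    · simp [h1]
    · have h2 : Tendsto (fun x : ℝ => 12 * b / (x ^ 2 + ρ.im ^ 2)) atTop (𝓝 0) :=
        tendsto_const_nhds.div_atTop
          (tendsto_atTop_add_const_right _ _ (tendsto_pow_atTop two_ne_zero))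
      have h3 : Tendsto (fun x : ℝ => imDefect x ρ) atTop (𝓝 0) := by
        refine squeeze_zero_norm' ?_ h2
        filter_upwards [eventually_ge_atTop (2 * b + 1)] with x hx
        exact E.abs_imDefect_le hx h1
      simpa using h3.const_mul (m ρ : ℝ)
  · filter_upwards [eventually_ge_atTop (2 * b + 1)] with x hx ρ
    rcases eq_or_ne (m ρ) 0 with h1 | h1
    · simp [h1]
    · rw [Real.norm_eq_abs, abs_mul, Nat.abs_cast]
      calc (m ρ : ℝ) * |imDefect x ρ| ≤ m ρ * (12 * b / (1 + ρ.im ^ 2)) := by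
            gcongr; exact E.abs_imDefect_le_of_one_le hx h1
        _ = _ := by ring

/-- The principal-value partial fraction expansion. -/
theorem tendsto_sum_one_div_sub (E : StripExpansion m h B b σ) {z : ℂ} (hz : m z = 0) :
    Tendsto (fun T => ∑ ρ ∈ E.upTo T, (m ρ : ℂ) * (1 / (z - ρ))) atTop (𝓝 (h z)) := by
  have hb := E.b_nonneg
  have hσ := E.lt_sigma
  obtain ⟨C, hC⟩ := E.exists_tendsto_sum_im_div
  choose! l hl hlim using hC
  have key : ∀ x : ℝ, 2 * b + 1 ≤ x →
      Tendsto (fun T => ∑ ρ ∈ E.upTo T, (m ρ : ℂ) * (1 / (z - ρ))) atTop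
        (𝓝 (h z + ((∑' ρ : ℂ, (m ρ : ℝ) * imDefect x ρ + l x - (h x).im : ℝ) : ℂ) *
          Complex.I)) := by
    intro x hx
    have hmx : m x = 0 := E.eq_zero_of_lt_re (by simp; linarith)
    have h1 := E.tendsto_sum_upTo ((E.hasSum z hz).sub (E.hasSum x hmx))
      (fun ρ h0 => by simp [h0])
    have h2 := E.tendsto_sum_upTo (E.hasSum_re hmx) (fun ρ h0 => by simp [h0])
    have h3 := E.tendsto_sum_upTo (E.summable_of_abs_le (f := imDefect x)
      fun ρ hρ => E.abs_imDefect_le_of_one_le hx hρ).hasSum (fun ρ h0 => by simp [h0])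
    have h4 := hlim x (by linarith)
    have h5 := (h1.add ((Complex.continuous_ofReal.tendsto _).comp h2)).add
      (((Complex.continuous_ofReal.tendsto _).comp (h3.add h4)).mul_const Complex.I)
    have h6 : h z - B - (h x - B) + ((h x).re : ℂ) +
        ((∑' ρ : ℂ, (m ρ : ℝ) * imDefect x ρ + l x : ℝ) : ℂ) * Complex.I =
        h z + ((∑' ρ : ℂ, (m ρ : ℝ) * imDefect x ρ + l x - (h x).im : ℝ) : ℂ) * Complex.I := by
      have := Complex.re_add_im (h x)
      push_cast
      linear_combination this
    rw [h6] at h5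
    refine h5.congr fun T => ?_
    simp only [Function.comp]
    push_cast
    rw [← Finset.sum_add_distrib, ← Finset.sum_add_distrib, Finset.sum_mul,
      ← Finset.sum_add_distrib]
    refine Finset.sum_congr rfl fun ρ _ => ?_
    have h7 := Complex.re_add_im (1 / ((x : ℂ) - ρ))
    rw [imDefect]
    push_cast
    linear_combination (m ρ : ℂ) * h7
  have h1 : Tendsto (fun x : ℝ => h z +
      ((∑' ρ : ℂ, (m ρ : ℝ) * imDefect x ρ + l x - (h x).im : ℝ) : ℂ) * Complex.I) atTop
      (𝓝 (h z + ((0 + 0 - 0 : ℝ) : ℂ) * Complex.I)) := by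
    have h2 : Tendsto l atTop (𝓝 0) := by
      have h3 := (tendsto_rpow_neg_atTop (show (0 : ℝ) < 1 / 8 by norm_num)).const_mul C
      rw [mul_zero] at h3
      refine squeeze_zero_norm' ?_ h3
      filter_upwards [eventually_ge_atTop 1] with x hx
      exact hl x hx
    exact tendsto_const_nhds.add (((Complex.continuous_ofReal.tendsto _).comp
      ((E.tendsto_tsum_imDefect.add h2).sub E.im_tendsto)).mul_const _)
  have h2 : (fun x : ℝ => h z +
      ((∑' ρ : ℂ, (m ρ : ℝ) * imDefect x ρ + l x - (h x).im : ℝ) : ℂ) * Complex.I) =ᶠ[atTop]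
      fun _ => h z + ((∑' ρ : ℂ, (m ρ : ℝ) * imDefect (2 * b + 1) ρ + l (2 * b + 1) -
        (h (2 * b + 1 : ℝ)).im : ℝ) : ℂ) * Complex.I := by
    filter_upwards [eventually_ge_atTop (2 * b + 1)] with x hx
    exact tendsto_nhds_unique (key x hx) (key _ le_rfl)
  have h3 := tendsto_nhds_unique (h1.congr' h2) tendsto_const_nhds
  have h4 := key _ le_rfl
  rw [← h3] at h4
  simpa using h4

theorem finsum_eq_sum_upTo (E : StripExpansion m h B b σ) (f : ℂ → ℂ) (T : ℝ) :
    ∑ᶠ ρ ∈ {ρ ∈ {ρ | m ρ ≠ 0} | |ρ.im| ≤ T}, f ρ = ∑ ρ ∈ E.upTo T, f ρ :=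
  finsum_mem_eq_finite_toFinset_sum f (E.finite_abs_im_le T)

theorem hasPVSum (E : StripExpansion m h B b σ) {z : ℂ} (hz : m z = 0) :
    HasPVSum {ρ | m ρ ≠ 0} m (fun ρ => 1 / (z - ρ)) (h z) :=
  ⟨E.finite_abs_im_le, by
    simpa only [E.finsum_eq_sum_upTo] using E.tendsto_sum_one_div_sub hz⟩

end StripExpansion

/-- `f` is `O(exp(C (1 + |z|)^A))` on `U`. -/
def GrowthOn (A : ℝ) (U : Set ℂ) (f : ℂ → ℂ) : Prop :=
  ∃ C : ℝ, 0 ≤ C ∧ ∀ z ∈ U, ‖f z‖ ≤ Real.exp (C * (1 + ‖z‖) ^ A)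

namespace GrowthOn

variable {A : ℝ} {U V : Set ℂ} {f f₁ f₂ : ℂ → ℂ}

theorem one_le_rpow (hA : 1 ≤ A) (z : ℂ) : 1 ≤ (1 + ‖z‖) ^ A :=
  Real.one_le_rpow (by linarith [norm_nonneg z]) (by linarith)

theorem le_rpow (hA : 1 ≤ A) (z : ℂ) : 1 + ‖z‖ ≤ (1 + ‖z‖) ^ A :=
  Real.self_le_rpow_of_one_le (by linarith [norm_nonneg z]) hA

theorem mul (h₁ : GrowthOn A U f₁) (h₂ : GrowthOn A U f₂) :
    GrowthOn A U fun z => f₁ z * f₂ z := by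
  obtain ⟨C₁, h₁0, h₁⟩ := h₁
  obtain ⟨C₂, h₂0, h₂⟩ := h₂
  refine ⟨C₁ + C₂, by positivity, fun z hz => ?_⟩
  rw [norm_mul, add_mul, Real.exp_add]
  exact mul_le_mul (h₁ z hz) (h₂ z hz) (norm_nonneg _) (Real.exp_pos _).le

theorem of_norm_le {M : ℝ} (hA : 1 ≤ A) (h : ∀ z ∈ U, ‖f z‖ ≤ M) : GrowthOn A U f := by
  refine ⟨|M|, abs_nonneg M, fun z hz => (h z hz).trans ?_⟩
  calc M ≤ |M| := le_abs_self M
    _ ≤ |M| * (1 + ‖z‖) ^ A := le_mul_of_one_le_right (abs_nonneg M) (one_le_rpow hA z)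
    _ ≤ _ := by linarith [Real.add_one_le_exp (|M| * (1 + ‖z‖) ^ A)]

theorem of_norm_le_exp {M : ℝ} (hA : 1 ≤ A) (hM : 0 ≤ M)
    (h : ∀ z ∈ U, ‖f z‖ ≤ Real.exp (M * (1 + ‖z‖))) : GrowthOn A U f := by
  refine ⟨M, hM, fun z hz => (h z hz).trans (Real.exp_le_exp.2 ?_)⟩
  gcongr
  exact le_rpow hA z

theorem pow (hA : 1 ≤ A) (h : GrowthOn A U f) (n : ℕ) : GrowthOn A U fun z => f z ^ n := by
  induction n with
  | zero => exact of_norm_le hA (M := 1) fun z _ => by simp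
  | succ n ih => simpa only [pow_succ] using ih.mul h

theorem prod (hA : 1 ≤ A) {ι : Type*} (s : Finset ι) {F : ι → ℂ → ℂ}
    (h : ∀ i ∈ s, GrowthOn A U (F i)) : GrowthOn A U fun z => ∏ i ∈ s, F i z := by
  classical
  induction s using Finset.induction_on with
  | empty => exact of_norm_le hA (M := 1) fun z _ => by simp
  | insert i s hi ih =>
    simp only [Finset.prod_insert hi]
    exact (h i (by simp)).mul (ih fun j hj => h j (by simp [hj]))

theorem mono (h : GrowthOn A V f) (hUV : U ⊆ V) : GrowthOn A U f :=
  h.imp fun _ hC => ⟨hC.1, fun z hz => hC.2 z (hUV hz)⟩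

theorem congr (h : GrowthOn A U f₁) (hf : ∀ z ∈ U, ‖f₂ z‖ ≤ ‖f₁ z‖) : GrowthOn A U f₂ :=
  h.imp fun _ hC => ⟨hC.1, fun z hz => (hf z hz).trans (hC.2 z hz)⟩

theorem exponent_mono {A' : ℝ} (h : GrowthOn A U f) (hAA : A ≤ A') : GrowthOn A' U f := by
  obtain ⟨C, hC0, hC⟩ := h
  refine ⟨C, hC0, fun z hz => (hC z hz).trans (Real.exp_le_exp.2 ?_)⟩
  gcongr
  linarith [norm_nonneg z]

theorem union (h₁ : GrowthOn A U f) (h₂ : GrowthOn A V f) : GrowthOn A (U ∪ V) f := by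
  obtain ⟨C₁, h₁0, h₁⟩ := h₁
  obtain ⟨C₂, h₂0, h₂⟩ := h₂
  refine ⟨max C₁ C₂, le_max_of_le_left h₁0, fun z hz => ?_⟩
  rcases hz with hz | hz
  · refine (h₁ z hz).trans (Real.exp_le_exp.2 ?_)
    gcongr
    exact le_max_left _ _
  · refine (h₂ z hz).trans (Real.exp_le_exp.2 ?_)
    gcongr
    exact le_max_right _ _

theorem add_const (hA : 1 ≤ A) (w : ℂ) : GrowthOn A U fun z => z + w := by
  refine of_norm_le_exp hA (M := 1 + ‖w‖) (by positivity) fun z _ => ?_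
  have h1 := norm_add_le z w
  have h2 := Real.add_one_le_exp ((1 + ‖w‖) * (1 + ‖z‖))
  nlinarith [norm_nonneg z, norm_nonneg w]

theorem reflect (hA : 1 ≤ A) (h : GrowthOn A U f) :
    GrowthOn A {z | 1 - conj z ∈ U} fun z => f (1 - conj z) := by
  obtain ⟨C, hC0, hC⟩ := h
  refine ⟨C * 2 ^ A, by positivity, fun z hz => (hC _ hz).trans (Real.exp_le_exp.2 ?_)⟩
  rw [mul_assoc, ← Real.mul_rpow (by norm_num) (by positivity)]
  have h1 : ‖1 - conj z‖ ≤ 1 + ‖z‖ := by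
    simpa using norm_sub_le (1 : ℂ) (conj z)
  gcongr
  linarith [norm_nonneg z]

end GrowthOn

theorem norm_Gamma_le {z : ℂ} (hz : 0 < z.re) : ‖Complex.Gamma z‖ ≤ Real.Gamma z.re := by
  rw [Complex.Gamma_eq_integral hz, Complex.GammaIntegral, Real.Gamma_eq_integral hz]
  refine (MeasureTheory.norm_integral_le_integral_norm _).trans_eq ?_
  refine MeasureTheory.setIntegral_congr_fun measurableSet_Ioi fun x hx => ?_
  simp only [norm_mul]
  rw [Complex.norm_real, Complex.norm_cpow_eq_rpow_re_of_pos hx, Real.norm_eq_abs, Real.abs_exp]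
  simp

theorem Gamma_le_exp_of_two_le {y : ℝ} (hy : 2 ≤ y) :
    Real.Gamma y ≤ Real.exp (2 * (1 + y) ^ (3 / 2 : ℝ)) := by
  set n := ⌈y⌉₊ with hn
  have h1 : y ≤ n := Nat.le_ceil y
  have h2 : (n : ℝ) < y + 1 := Nat.ceil_lt_add_one (by linarith)
  have h3 : Real.Gamma y ≤ n.factorial := by
    rw [← Real.Gamma_nat_eq_factorial]
    exact Real.Gamma_strictMonoOn_Ici.monotoneOn (Set.mem_Ici.2 hy)
      (Set.mem_Ici.2 (by linarith)) (by linarith)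
  have h4 : (n.factorial : ℝ) ≤ (n : ℝ) ^ n := by exact_mod_cast n.factorial_le_pow
  have hn0 : (0 : ℝ) < n := by linarith
  refine h3.trans (h4.trans ?_)
  rw [← Real.rpow_natCast, Real.rpow_def_of_pos hn0]
  apply Real.exp_le_exp.2
  have h5 := Real.log_le_rpow_div hn0.le (show (0 : ℝ) < 1 / 2 by norm_num)
  have h6 : (1 + y) ^ (3 / 2 : ℝ) = (1 + y) ^ (1 / 2 : ℝ) * (1 + y) := by
    nth_rewrite 3 [← Real.rpow_one (1 + y)]
    rw [← Real.rpow_add (by linarith)]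
    norm_num
  have h7 : (n : ℝ) ^ (1 / 2 : ℝ) ≤ (1 + y) ^ (1 / 2 : ℝ) := by gcongr; linarith
  calc Real.log n * n ≤ ((n : ℝ) ^ (1 / 2 : ℝ) / (1 / 2)) * n := by gcongr
    _ = 2 * ((n : ℝ) ^ (1 / 2 : ℝ) * n) := by ring
    _ ≤ 2 * ((1 + y) ^ (1 / 2 : ℝ) * (1 + y)) := by gcongr; linarith
    _ = _ := by rw [h6]

theorem growthOn_Gamma {l δ : ℝ} (hl : 0 < l) (hδ : 0 < δ) (μ : ℂ) (hμ : 0 ≤ μ.re) :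
    GrowthOn (3 / 2) {z | δ ≤ z.re} fun z => Complex.Gamma (l * z + μ) := by
  set ε : ℝ := l * δ with hε
  have hε0 : 0 < ε := by positivity
  have h1 : GrowthOn (3 / 2) {z | δ ≤ z.re} fun _ => ((1 / (ε * (ε + 1)) : ℝ) : ℂ) :=
    GrowthOn.of_norm_le (by norm_num) fun _ _ => le_rfl
  have h2 : GrowthOn (3 / 2) {z | δ ≤ z.re}
      fun z => ((Real.Gamma ((l * z + μ).re + 2) : ℝ) : ℂ) := by
    refine ⟨2 * (3 + l + ‖μ‖) ^ (3 / 2 : ℝ), by positivity, fun z hz => ?_⟩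
    have hre : (l * z + μ).re = l * z.re + μ.re := by simp
    have h3 : ε ≤ l * z.re := by
      rw [hε]
      exact mul_le_mul_of_nonneg_left hz hl.le
    simp only [hre]
    rw [Complex.norm_real, Real.norm_of_nonneg (Real.Gamma_nonneg_of_nonneg (by linarith))]
    refine (Gamma_le_exp_of_two_le (by linarith)).trans (Real.exp_le_exp.2 ?_)
    rw [mul_assoc, ← Real.mul_rpow (by positivity) (by positivity)]
    gcongr
    · linarith
    · have h4 := Complex.re_le_norm z
      have h5 := Complex.re_le_norm μ
      have h6 : l * z.re ≤ l * ‖z‖ := by gcongr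
      nlinarith [norm_nonneg z, norm_nonneg μ, mul_nonneg (norm_nonneg z) (norm_nonneg μ)]
  refine (h1.mul h2).congr fun z hz => ?_
  have hre : (l * z + μ).re = l * z.re + μ.re := by simp
  have h3 : ε ≤ (l * z + μ).re := by
    rw [hε, hre]
    linarith [mul_le_mul_of_nonneg_left (show δ ≤ z.re from hz) hl.le]
  set x : ℝ := (l * z + μ).re
  have hx0 : 0 < x := by linarith
  refine (norm_Gamma_le hx0).trans ?_
  have h4 : Real.Gamma (x + 2) = (x + 1) * (x * Real.Gamma x) := by
    rw [show x + 2 = (x + 1) + 1 by ring, Real.Gamma_add_one (by positivity),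
      Real.Gamma_add_one hx0.ne']
  rw [norm_mul, Complex.norm_real, Complex.norm_real, Real.norm_of_nonneg (by positivity),
    Real.norm_of_nonneg (Real.Gamma_nonneg_of_nonneg (by linarith)), h4]
  have h5 := (Real.Gamma_pos_of_pos hx0).le
  rw [one_div, ← div_eq_inv_mul, le_div_iff₀ (by positivity)]
  have h6 : ε * (ε + 1) ≤ x * (x + 1) := by gcongr
  nlinarith

theorem growthOn_cpow {Q : ℝ} (hQ : 0 < Q) (U : Set ℂ) :
    GrowthOn (3 / 2) U fun z => (Q : ℂ) ^ z := by
  refine GrowthOn.of_norm_le_exp (by norm_num) (abs_nonneg (Real.log Q)) fun z _ => ?_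
  rw [Complex.norm_cpow_eq_rpow_re_of_pos hQ, Real.rpow_def_of_pos hQ]
  apply Real.exp_le_exp.2
  calc Real.log Q * z.re ≤ |Real.log Q * z.re| := le_abs_self _
    _ = |Real.log Q| * |z.re| := abs_mul _ _
    _ ≤ |Real.log Q| * (1 + ‖z‖) := by
      gcongr
      linarith [Complex.abs_re_le_norm z]

namespace GammaData

variable (D : GammaData)

/-- The exponential and Gamma factors of the completed function. -/
def archFactor (s : ℂ) : ℂ := D.c * (D.Q : ℂ) ^ s * D.gammaFactor s

theorem growthOn_archFactor {δ : ℝ} (hδ : 0 < δ) :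
    GrowthOn (3 / 2) {z | δ ≤ z.re} D.archFactor := by
  have h1 : GrowthOn (3 / 2) {z | δ ≤ z.re} fun _ => (D.c : ℂ) :=
    GrowthOn.of_norm_le (by norm_num) fun _ _ => le_rfl
  exact (h1.mul (growthOn_cpow D.Q_pos _)).mul (GrowthOn.prod (by norm_num) _ fun j _ =>
    growthOn_Gamma (D.lam_pos j) hδ (D.mu j) (D.mu_re j))

theorem re_pos {s : ℂ} (hs : 0 < s.re) (j : Fin D.f) : 0 < ((D.lam j : ℂ) * s + D.mu j).re := by
  have h1 := mul_pos (D.lam_pos j) hs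
  have h2 := D.mu_re j
  simp
  linarith

theorem regular_of_re_pos {s : ℂ} (hs : 0 < s.re) : D.Regular s := by
  intro j n h
  have h1 := D.re_pos hs j
  rw [h] at h1
  simp at h1
  linarith [Nat.cast_nonneg (α := ℝ) n]

theorem archFactor_ne_zero {s : ℂ} (hs : D.Regular s) : D.archFactor s ≠ 0 := by
  have hQ : (D.Q : ℂ) ≠ 0 := by exact_mod_cast D.Q_pos.ne'
  have hc : (D.c : ℂ) ≠ 0 := by exact_mod_cast D.c_pos.ne'
  exact mul_ne_zero (mul_ne_zero hc (by simp [Complex.cpow_eq_zero_iff, hQ]))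
    (Finset.prod_ne_zero_iff.2 fun j _ => Complex.Gamma_ne_zero (hs j))

theorem differentiableAt_gammaFactor {s : ℂ} (hs : D.Regular s) :
    DifferentiableAt ℂ D.gammaFactor s := by
  have : ∀ j ∈ Finset.univ, DifferentiableAt ℂ
      (fun s : ℂ => Complex.Gamma ((D.lam j : ℂ) * s + D.mu j)) s := fun j _ =>
    DifferentiableAt.comp s (Complex.differentiableAt_Gamma _ (hs j))
      (f := fun s : ℂ => (D.lam j : ℂ) * s + D.mu j) (by fun_prop)
  exact DifferentiableAt.fun_finsetProd this

theorem differentiableAt_archFactor {s : ℂ} (hs : D.Regular s) :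
    DifferentiableAt ℂ D.archFactor s := by
  have hQ : (D.Q : ℂ) ≠ 0 := by exact_mod_cast D.Q_pos.ne'
  have h1 : DifferentiableAt ℂ (fun s : ℂ => (D.Q : ℂ) ^ s) s :=
    differentiableAt_id.const_cpow (Or.inl hQ)
  exact ((differentiableAt_const _).mul h1).mul (D.differentiableAt_gammaFactor hs)

/-- The vertical-line bound for the archimedean factors. -/
theorem norm_archFactor_le {s : ℂ} (hs : 0 < s.re) :
    ‖D.archFactor s‖ ≤ D.c * D.Q ^ s.re * ∏ j, Real.Gamma (D.lam j * s.re + (D.mu j).re) := by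
  rw [archFactor, norm_mul, norm_mul, Complex.norm_real, Real.norm_of_nonneg D.c_pos.le,
    Complex.norm_cpow_eq_rpow_re_of_pos D.Q_pos, gammaFactor, norm_prod]
  have hc := D.c_pos
  have hQ := D.Q_pos
  gcongr with j
  refine (norm_Gamma_le (D.re_pos hs j)).trans_eq ?_
  simp

end GammaData


theorem ClearsPole.of_succ_of_eq_zero {L : ℂ → ℂ} {k : ℕ} {g : ℂ → ℂ}
    (hg : EntireOfFiniteOrder g) (hgL : ∀ s, s ≠ 1 → g s = (s - 1) ^ (k + 1) * L s)
    (h1 : g 1 = 0) : ClearsPole L k := by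
  obtain ⟨hd, A, C, hA, hC⟩ := hg
  have hdd : Differentiable ℂ (dslope g 1) := by
    rw [← differentiableOn_univ] at hd ⊢
    exact (Complex.differentiableOn_dslope univ_mem).2 hd
  have hmul : ∀ s, (s - 1) * dslope g 1 s = g s := fun s => by
    have := sub_smul_dslope g 1 s
    rwa [smul_eq_mul, h1, sub_zero] at this
  refine ⟨dslope g 1, ⟨hdd, A, ?_⟩, fun s hs => ?_⟩
  · obtain ⟨M, hM⟩ := (isCompact_closedBall (1 : ℂ) 1).exists_bound_of_continuousOn
      hdd.continuous.continuousOn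
    refine ⟨max C M, hA, fun z => ?_⟩
    have hM0 : 0 ≤ M := (norm_nonneg _).trans (hM 1 (by simp))
    have hexp : 1 ≤ Real.exp (‖z‖ ^ A) := Real.one_le_exp (by positivity)
    rcases le_total ‖z - 1‖ 1 with h | h
    · refine (hM z (by simpa [dist_eq_norm] using h)).trans ((le_max_right C M).trans ?_)
      exact le_mul_of_one_le_right (le_max_of_le_right hM0) hexp
    · have h2 : ‖dslope g 1 z‖ ≤ ‖g z‖ := by
        rw [← hmul z, norm_mul]
        exact le_mul_of_one_le_left (norm_nonneg _) h
      refine h2.trans ((hC z).trans ?_)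
      gcongr
      exact le_max_left _ _
  · have hs1 : s - 1 ≠ 0 := sub_ne_zero.2 hs
    refine mul_left_cancel₀ hs1 ?_
    rw [hmul, hgL s hs]
    ring

theorem eventually_punctured_ne (s c : ℂ) : ∀ᶠ z in 𝓝[≠] s, z ≠ c := by
  rcases eq_or_ne s c with rfl | h
  · exact self_mem_nhdsWithin
  · exact mem_nhdsWithin_of_mem_nhds (isOpen_ne.mem_nhds h)

/-- The entire function `(s - 1)^k L(s)`. -/
theorem ExtendedSelbergClass.exists_entire {a : ℕ → ℂ} {L : ℂ → ℂ} (hL : ExtendedSelbergClass a L)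
    (hne : L ≠ 0) :
    ∃ g : ℂ → ℂ, EntireOfFiniteOrder g ∧ (∀ s, s ≠ 1 → g s = (s - 1) ^ poleOrder L * L s) ∧
      g ≠ 0 ∧ (poleOrder L ≠ 0 → g 1 ≠ 0) ∧ (poleOrder L = 0 → g = L) := by
  have hmem : ClearsPole L (poleOrder L) := Nat.sInf_mem (s := {k | ClearsPole L k}) hL.continuation
  obtain ⟨g, hg, hgL⟩ := hmem
  have h0 : poleOrder L = 0 → g = L := by
    intro hk
    have hLc := (hL.entire hk).continuous
    refine Continuous.ext_on (dense_compl_singleton (1 : ℂ)) hg.1.continuous hLc fun s hs => ?_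
    rw [hgL s hs, hk]
    simp
  refine ⟨g, hg, hgL, ?_, fun hk h1 => ?_, h0⟩
  · intro hg0
    have hk : poleOrder L = 0 := by
      refine Nat.sInf_eq_zero.2 (Or.inl ⟨0, ⟨differentiable_const 0, 0, 0, le_rfl, by simp⟩,
        fun s hs => ?_⟩)
      have h1 := hgL s hs
      rw [hg0, Pi.zero_apply] at h1
      have h2 : L s = 0 := by
        rcases mul_eq_zero.1 h1.symm with h | h
        · exact absurd h (pow_ne_zero _ (sub_ne_zero.2 hs))
        · exact h
      simp [h2]
    exact hne ((h0 hk).symm.trans hg0)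
  · obtain ⟨k, hk'⟩ := Nat.exists_eq_succ_of_ne_zero hk
    rw [hk'] at hgL
    have h2 := ClearsPole.of_succ_of_eq_zero hg hgL h1
    have h3 : poleOrder L ≤ k := Nat.sInf_le h2
    omega

namespace GammaData

variable (D : GammaData)

theorem regular_iff {s : ℂ} : D.Regular s ↔ D.gammaFactor s ≠ 0 := by
  rw [gammaFactor, Finset.prod_ne_zero_iff]
  simp [Regular, Complex.Gamma_eq_zero_iff]

theorem differentiable_inv_gammaFactor : Differentiable ℂ fun s => (D.gammaFactor s)⁻¹ := by
  simp only [gammaFactor, ← Finset.prod_inv_distrib]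
  refine Differentiable.fun_finsetProd fun j _ => ?_
  exact Complex.differentiable_one_div_Gamma.comp
    (f := fun s : ℂ => (D.lam j : ℂ) * s + D.mu j) (by fun_prop)

theorem isOpen_regular : IsOpen {s | D.Regular s} := by
  have : {s | D.Regular s} = (fun s => (D.gammaFactor s)⁻¹) ⁻¹' {0}ᶜ := by
    ext s
    simp [D.regular_iff]
  rw [this]
  exact isOpen_compl_singleton.preimage D.differentiable_inv_gammaFactor.continuous

theorem eventually_regular (s : ℂ) : ∀ᶠ z in 𝓝[≠] s, D.Regular z := by
  have h1 : AnalyticOnNhd ℂ (fun s => (D.gammaFactor s)⁻¹) Set.univ := fun z _ =>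
    D.differentiable_inv_gammaFactor.analyticAt z
  have h3 := mem_codiscrete.1 (AnalyticOnNhd.preimage_zero_mem_codiscrete (x := 1) h1 (by
    simpa using D.regular_iff.1 (D.regular_of_re_pos (by simp)))) s
  rw [disjoint_principal_right, compl_compl] at h3
  filter_upwards [h3] with z hz
  simpa [D.regular_iff] using hz

theorem completed_eq (L : ℂ → ℂ) (s : ℂ) : D.completed L s = D.archFactor s * L s := rfl

/-- The entire function `(s(1-s))^k Λ(s)`. -/
theorem exists_entire_completion {a : ℕ → ℂ} {L : ℂ → ℂ} (hL : ExtendedSelbergClass a L)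
    (hne : L ≠ 0) (hD : D.FunctionalEquation L) :
    ∃ g g₁ : ℂ → ℂ, Differentiable ℂ g ∧ g ≠ 0 ∧ EntireOfFiniteOrder g₁ ∧
      (∀ s, s ≠ 1 → g₁ s = (s - 1) ^ poleOrder L * L s) ∧
      (∀ s, 0 < s.re → g s = D.archFactor s * (-s) ^ poleOrder L * g₁ s) ∧
      (∀ s, g s = D.W * conj (g (1 - conj s))) ∧
      (∀ s, D.Regular s → (poleOrder L ≠ 0 → s ≠ 0 ∧ s ≠ 1) →
        g s = (s * (1 - s)) ^ poleOrder L * D.completed L s) ∧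
      (poleOrder L ≠ 0 → g 0 ≠ 0 ∧ g 1 ≠ 0) := by
  obtain ⟨g₁, hg₁, hgL, hg₁ne, hg1, hk0⟩ := hL.exists_entire hne
  set k := poleOrder L with hk
  set G : ℂ → ℂ := fun s => D.archFactor s * (-s) ^ k * g₁ s with hG
  set H : ℂ → ℂ := fun s => D.W * conj (G (1 - conj s)) with hH
  have hre : ∀ s : ℂ, (1 - conj s).re = 1 - s.re := fun s => by simp
  have hinv : ∀ s : ℂ, 1 - conj (1 - conj s) = s := fun s => by simp
  have hWW : D.W * conj D.W = 1 := by
    rw [Complex.mul_conj, Complex.normSq_eq_norm_sq, D.norm_W]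
    simp
  have hGc : ∀ s, s ≠ 1 → G s = (s * (1 - s)) ^ k * D.completed L s := by
    intro s hs
    simp only [hG]
    rw [hgL s hs, completed_eq, show s * (1 - s) = -s * (s - 1) by ring, mul_pow]
    ring
  have hmatch : ∀ s : ℂ, 0 < s.re → s.re < 1 → G s = H s := by
    intro s h0 h1
    have hs0 : s ≠ 0 := fun h => by simp [h] at h0
    have hs1 : s ≠ 1 := fun h => by simp [h] at h1
    have hs1' : 1 - conj s ≠ 1 := fun h => hs0 (by simpa using h)
    have h2 := hD s hs0 hs1 (D.regular_of_re_pos h0)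
      (D.regular_of_re_pos (by rw [hre]; linarith))
    simp only [hH]
    rw [hGc s hs1, hGc _ hs1', h2]
    simp only [map_mul, map_pow, map_sub, map_one, Complex.conj_conj]
    ring
  have hGd : ∀ s : ℂ, 0 < s.re → DifferentiableAt ℂ G s := fun s hs =>
    ((D.differentiableAt_archFactor (D.regular_of_re_pos hs)).mul (by fun_prop)).mul (hg₁.1 s)
  have hHd : ∀ s : ℂ, s.re < 1 → DifferentiableAt ℂ H s := by
    intro s hs
    have h1 : DifferentiableAt ℂ (fun z => G (1 - z)) (conj s) :=
      DifferentiableAt.comp (conj s) (f := fun z : ℂ => 1 - z)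
        (hGd _ (by rw [hre]; linarith)) (by fun_prop)
    have h2 := h1.conj_conj
    rw [Complex.conj_conj] at h2
    have h3 : H = fun z => D.W * (conj ∘ (fun z => G (1 - z)) ∘ conj) z := rfl
    rw [h3]
    exact h2.const_mul _
  classical
  set g : ℂ → ℂ := fun s => if 0 < s.re then G s else H s with hg
  have hgG : ∀ s : ℂ, 0 < s.re → g s = G s := fun s hs => if_pos hs
  have hgH : ∀ s : ℂ, s.re < 1 → g s = H s := by
    intro s hs
    by_cases h0 : 0 < s.re
    · rw [hgG s h0, hmatch s h0 hs]
    · exact if_neg h0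
  have hgd : Differentiable ℂ g := by
    intro s
    by_cases h0 : 0 < s.re
    · refine (hGd s h0).congr_of_eventuallyEq ?_
      filter_upwards [(isOpen_lt continuous_const Complex.continuous_re).mem_nhds h0] with z hz
      exact hgG z hz
    · have h1 : s.re < 1 := by linarith
      refine (hHd s h1).congr_of_eventuallyEq ?_
      filter_upwards [(isOpen_lt Complex.continuous_re continuous_const).mem_nhds h1] with z hz
      exact hgH z hz
  have hFE : ∀ s, g s = D.W * conj (g (1 - conj s)) := by
    intro s
    by_cases h1 : s.re < 1
    · rw [hgH s h1, hgG (1 - conj s) (by rw [hre]; linarith)]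
    · rw [hgG s (by linarith), hgH (1 - conj s) (by rw [hre]; linarith)]
      simp only [hH]
      rw [hinv, map_mul, Complex.conj_conj, ← mul_assoc, hWW, one_mul]
  have hgc : ∀ s, s ≠ 0 → s ≠ 1 → D.Regular s → g s = (s * (1 - s)) ^ k * D.completed L s := by
    intro s hs0 hs1 hreg
    by_cases h0 : 0 < s.re
    · rw [hgG s h0, hGc s hs1]
    · have h1 : 0 < (1 - conj s).re := by rw [hre]; linarith
      have hs1' : 1 - conj s ≠ 1 := fun h => hs0 (by simpa using h)
      rw [hgH s (by linarith), hD s hs0 hs1 hreg (D.regular_of_re_pos h1)]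
      simp only [hH]
      rw [hGc _ hs1']
      simp only [map_mul, map_pow, map_sub, map_one, Complex.conj_conj]
      ring
  have hgne : g ≠ 0 := by
    intro h0
    apply hg₁ne
    refine AnalyticOnNhd.eq_of_eventuallyEq (z₀ := 2) (fun z _ => hg₁.1.analyticAt z)
      (fun z _ => analyticAt_const) ?_
    have h2 : (0 : ℝ) < (2 : ℂ).re := by simp
    filter_upwards [(isOpen_lt continuous_const Complex.continuous_re).mem_nhds h2] with z hz
    have h3 := hgG z hz
    rw [h0] at h3
    simp only [hG, Pi.zero_apply] at h3
    have hz0 : z ≠ 0 := fun h => by rw [h] at hz; exact lt_irrefl _ hz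
    rcases mul_eq_zero.1 h3.symm with h4 | h4
    · rcases mul_eq_zero.1 h4 with h5 | h5
      · exact absurd h5 (D.archFactor_ne_zero (D.regular_of_re_pos hz))
      · exact absurd h5 (pow_ne_zero _ (neg_ne_zero.2 hz0))
    · exact h4
  refine ⟨g, g₁, hgd, hgne, hg₁, hgL, hgG, hFE, fun s hreg hs => ?_, fun hkne => ?_⟩
  · by_cases hkz : k = 0
    · have hLd : Differentiable ℂ L := hL.entire hkz
      have hc : ContinuousAt (D.completed L) s :=
        ((D.differentiableAt_archFactor hreg).mul (hLd s)).continuousAt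
      have hev : g =ᶠ[𝓝[≠] s] D.completed L := by
        filter_upwards [eventually_punctured_ne s 0, eventually_punctured_ne s 1,
          D.eventually_regular s] with z hz0 hz1 hz'
        rw [hgc z hz0 hz1 hz', hkz]
        simp
      have h3 := tendsto_nhds_unique
        (((hgd s).continuousAt.tendsto.mono_left nhdsWithin_le_nhds).congr' hev)
        (hc.tendsto.mono_left nhdsWithin_le_nhds)
      rw [hkz, h3]
      simp
    · exact hgc s (hs hkz).1 (hs hkz).2 hreg
  · have h1 : g 1 ≠ 0 := by
      rw [hgG 1 (by simp)]
      simp only [hG]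
      exact mul_ne_zero (mul_ne_zero (D.archFactor_ne_zero (D.regular_of_re_pos (by simp)))
        (pow_ne_zero _ (by simp))) (hg1 hkne)
    refine ⟨?_, h1⟩
    rw [hFE 0]
    simp only [map_zero, sub_zero]
    have hW : D.W ≠ 0 := fun h => by simpa [h] using D.norm_W
    exact mul_ne_zero hW (by simpa using h1)

end GammaData


theorem one_le_norm_add_three {z : ℂ} (hz : -1 ≤ z.re) : 1 ≤ ‖z + 3‖ := by
  have h1 := Complex.re_le_norm (z + 3)
  simp at h1
  linarith

/-- A Phragmén–Lindelöf estimate in the strip `-1 ≤ Re z ≤ 2`. -/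
theorem norm_le_pow_of_strip {g : ℂ → ℂ} (hg : Differentiable ℂ g) {A C : ℝ} (hA : 0 ≤ A)
    (hgr : GrowthOn A Set.univ g) {n : ℕ}
    (hl : ∀ z : ℂ, z.re = -1 → ‖g z‖ ≤ C * ‖z + 3‖ ^ n)
    (hr : ∀ z : ℂ, z.re = 2 → ‖g z‖ ≤ C * ‖z + 3‖ ^ n) {z : ℂ} (h1 : -1 ≤ z.re)
    (h2 : z.re ≤ 2) : ‖g z‖ ≤ C * ‖z + 3‖ ^ n := by
  set f : ℂ → ℂ := fun z => g z / (z + 3) ^ n with hf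
  have hne : ∀ z : ℂ, -1 ≤ z.re → z + 3 ≠ 0 := fun z hz h => by
    have := one_le_norm_add_three hz
    rw [h, norm_zero] at this
    linarith
  have hpos : ∀ z : ℂ, -1 ≤ z.re → 0 < ‖z + 3‖ ^ n := fun z hz =>
    pow_pos (norm_pos_iff.2 (hne z hz)) n
  have key : ‖f z‖ ≤ C := by
    refine PhragmenLindelof.vertical_strip (a := -1) (b := 2) (f := f) ?_ ?_ ?_ ?_ h1 h2
    · refine DifferentiableOn.diffContOnCl fun w hw => ?_
      have hw' : -1 ≤ w.re := by
        have h3 : closure (Complex.re ⁻¹' Set.Ioo (-1 : ℝ) 2) ⊆ {w : ℂ | -1 ≤ w.re} :=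
          closure_minimal (fun w hw => hw.1.le)
            (isClosed_le continuous_const Complex.continuous_re)
        exact h3 hw
      have h4 : DifferentiableAt ℂ (fun z : ℂ => (z + 3) ^ n) w := by fun_prop
      exact ((hg w).div h4 (pow_ne_zero n (hne w hw'))).differentiableWithinAt
    · obtain ⟨K, hK0, hK⟩ := hgr
      refine ⟨1, by linarith [Real.pi_gt_three], 1, ?_⟩
      refine Asymptotics.IsBigO.of_bound 1 ?_
      have hlim : Tendsto (fun z : ℂ => |z.im|)
          (comap (_root_.abs ∘ Complex.im) atTop ⊓ 𝓟 (Complex.re ⁻¹' Set.Ioo (-1 : ℝ) 2)) atTop :=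
        (tendsto_comap (f := (_root_.abs ∘ Complex.im))).mono_left inf_le_left
      have h3 : ∀ᶠ u : ℝ in atTop, K * (3 + u) ^ A ≤ Real.exp u := by
        have h4 := ((isLittleO_rpow_exp_atTop A).comp_tendsto
          (tendsto_atTop_add_const_left atTop (3 : ℝ) tendsto_id)).bound
          (c := 1 / ((K + 1) * Real.exp 3)) (by positivity)
        filter_upwards [h4, eventually_ge_atTop 0] with u hu hu0
        simp only [Function.comp, id] at hu
        rw [Real.norm_of_nonneg (by positivity), Real.norm_of_nonneg (Real.exp_pos _).le,
          Real.exp_add] at hu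
        calc K * (3 + u) ^ A ≤ (K + 1) * (1 / ((K + 1) * Real.exp 3) *
              (Real.exp 3 * Real.exp u)) := by
              gcongr
              linarith
          _ = Real.exp u := by field_simp
      filter_upwards [hlim.eventually h3, mem_inf_of_right (mem_principal_self _)] with w hw hws
      have hw1 : -1 < w.re := hws.1
      have hw2 : w.re < 2 := hws.2
      rw [one_mul, one_mul, one_mul, Real.norm_of_nonneg (Real.exp_pos _).le]
      simp only [hf]
      rw [norm_div, norm_pow]
      refine (div_le_self (norm_nonneg _)
        (one_le_pow₀ (one_le_norm_add_three hw1.le))).trans ?_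
      refine (hK w trivial).trans (Real.exp_le_exp.2 (le_trans ?_ hw))
      have h5 := Complex.norm_le_abs_re_add_abs_im w
      have h6 : |w.re| ≤ 2 := abs_le.2 ⟨by linarith, by linarith⟩
      have h7 : 1 + ‖w‖ ≤ 3 + |w.im| := by linarith
      gcongr
    · intro w hw
      simp only [hf]
      rw [norm_div, norm_pow, div_le_iff₀ (hpos w hw.ge)]
      exact hl w hw
    · intro w hw
      simp only [hf]
      rw [norm_div, norm_pow, div_le_iff₀ (hpos w (by linarith))]
      exact hr w hw
  simp only [hf] at key
  rwa [norm_div, norm_pow, div_le_iff₀ (hpos z h1)] at key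

theorem EntireOfFiniteOrder.exists_growthOn {g : ℂ → ℂ} (hg : EntireOfFiniteOrder g) :
    ∃ A, 3 / 2 ≤ A ∧ GrowthOn A Set.univ g := by
  obtain ⟨-, A, C, hA, hC⟩ := hg
  have hA' : 1 ≤ max A (3 / 2) := le_max_of_le_right (by norm_num)
  refine ⟨max A (3 / 2), le_max_right _ _, ?_⟩
  have h1 : GrowthOn (max A (3 / 2)) Set.univ fun _ => (C : ℂ) :=
    GrowthOn.of_norm_le hA' fun _ _ => le_rfl
  have h2 : GrowthOn (max A (3 / 2)) Set.univ fun z => Complex.exp (((1 + ‖z‖) ^ max A (3 / 2) : ℝ)) :=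
    ⟨1, zero_le_one, fun z _ => by rw [Complex.norm_exp_ofReal, one_mul]⟩
  refine (h1.mul h2).congr fun z _ => (hC z).trans ?_
  rw [norm_mul, Complex.norm_exp_ofReal, Complex.norm_real, Real.norm_eq_abs]
  have h3 : ‖z‖ ^ A ≤ (1 + ‖z‖) ^ max A (3 / 2) := by
    calc ‖z‖ ^ A ≤ (1 + ‖z‖) ^ A := by gcongr; linarith
      _ ≤ _ := by
        gcongr
        · linarith [norm_nonneg z]
        · exact le_max_left _ _
  gcongr
  exact le_abs_self C

/-- An entire function with a functional equation whose right half-plane factorization involves the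
archimedean factors and a function of polynomial growth has order at most `3/2`. -/
theorem GammaData.growthBound (D : GammaData) {g g₁ : ℂ → ℂ} {k : ℕ} {M : ℝ}
    (hg : Differentiable ℂ g) (hg₁ : EntireOfFiniteOrder g₁)
    (hM : ∀ s : ℂ, 2 ≤ s.re → ‖g₁ s‖ ≤ M * ‖s - 1‖ ^ k)
    (hfac : ∀ s : ℂ, 0 < s.re → g s = D.archFactor s * (-s) ^ k * g₁ s)
    (hFE : ∀ s, g s = D.W * conj (g (1 - conj s))) : GrowthBound g := by
  have hrefl : ∀ s, ‖g (1 - conj s)‖ = ‖g s‖ := fun s => by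
    rw [hFE s, norm_mul, D.norm_W, one_mul, RCLike.norm_conj]
  have hid : ∀ {A : ℝ}, 1 ≤ A → ∀ U, GrowthOn A U fun z => z := fun hA U => by
    simpa using GrowthOn.add_const (U := U) hA 0
  have hneg : ∀ {A : ℝ}, 1 ≤ A → ∀ U, GrowthOn A U fun z => (-z) ^ k := fun hA U =>
    GrowthOn.pow hA ((hid hA U).congr (f₂ := fun z => -z) fun z _ => by simp) k
  have hM0 : 0 ≤ M := by
    have := (norm_nonneg _).trans (hM 2 (by simp))
    norm_num at this
    exact this
  have hfin : ∃ A, 1 ≤ A ∧ GrowthOn A Set.univ g := by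
    obtain ⟨A, hA, hgr⟩ := hg₁.exists_growthOn
    have hA1 : 1 ≤ A := by linarith
    have h1 : GrowthOn A {z | 1 / 2 ≤ z.re} g :=
      ((((D.growthOn_archFactor (δ := 1 / 2) (by norm_num)).exponent_mono hA).mul
        (hneg hA1 _)).mul (hgr.mono (Set.subset_univ _))).congr fun z hz => by
          rw [hfac z (by linarith [show 1 / 2 ≤ z.re from hz])]
    refine ⟨A, hA1, (h1.union ((h1.reflect hA1).congr (f₂ := g) fun z _ => ?_)).mono ?_⟩
    · rw [hrefl]
    · intro z _
      rcases le_total (1 / 2) z.re with h | h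
      · exact Or.inl h
      · refine Or.inr ?_
        simp
        linarith
  obtain ⟨A, hA, hgA⟩ := hfin
  set C₀ : ℝ := D.c * D.Q ^ (2 : ℝ) * ∏ j, Real.Gamma (D.lam j * 2 + (D.mu j).re) with hC₀
  have hright : ∀ z : ℂ, z.re = 2 → ‖g z‖ ≤ C₀ * M * 20 ^ k * ‖z + 3‖ ^ (2 * k) := by
    intro z hz
    have h3 := one_le_norm_add_three (z := z) (by linarith)
    have h4 : ‖z‖ ≤ 4 * ‖z + 3‖ := by
      have := norm_sub_le (z + 3) 3
      simp at this
      linarith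
    have h5 : ‖z - 1‖ ≤ 5 * ‖z + 3‖ := by
      have := norm_sub_le (z + 3) 4
      rw [show z + 3 - 4 = z - 1 by ring] at this
      norm_num at this
      linarith
    have h6 := D.norm_archFactor_le (s := z) (by linarith)
    rw [hz, ← hC₀] at h6
    rw [hfac z (by linarith), norm_mul, norm_mul, norm_pow, norm_neg]
    calc ‖D.archFactor z‖ * ‖z‖ ^ k * ‖g₁ z‖
        ≤ C₀ * (4 * ‖z + 3‖) ^ k * (M * (5 * ‖z + 3‖) ^ k) := by
          have := hM z hz.ge
          have h7 : 0 ≤ C₀ := (norm_nonneg _).trans h6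
          gcongr
          exact this.trans (by gcongr)
      _ = C₀ * M * (4 * 5) ^ k * ‖z + 3‖ ^ (2 * k) := by
          rw [mul_pow, mul_pow, mul_pow]
          ring
      _ = _ := by norm_num
  set C₁ : ℝ := C₀ * M * 20 ^ k * 4 ^ (2 * k) with hC₁
  have hpos : 0 ≤ C₀ * M * 20 ^ k := by
    have h6 := D.norm_archFactor_le (s := 2) (by simp)
    have h7 : 0 ≤ C₀ := (norm_nonneg _).trans (h6.trans_eq (by simp [hC₀]))
    positivity
  have hleft : ∀ z : ℂ, z.re = -1 → ‖g z‖ ≤ C₁ * ‖z + 3‖ ^ (2 * k) := by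
    intro z hz
    have h1 := hright (1 - conj z) (by simp [hz]; norm_num)
    rw [hrefl] at h1
    refine h1.trans ?_
    have h3 := one_le_norm_add_three (z := z) (by linarith)
    have h4 : ‖1 - conj z + 3‖ ≤ 4 * ‖z + 3‖ := by
      have h5 : 1 - conj z + 3 = (z + 3) + 3 := by
        apply Complex.ext
        · simp [hz]
          norm_num
        · simp
      rw [h5]
      have := norm_add_le (z + 3) 3
      norm_num at this
      linarith
    rw [hC₁, mul_assoc (C₀ * M * 20 ^ k), ← mul_pow]
    gcongr
  have hstrip : GrowthOn (3 / 2) {z | -1 ≤ z.re ∧ z.re ≤ 2} g := by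
    have h1 : GrowthOn (3 / 2) {z | -1 ≤ z.re ∧ z.re ≤ 2}
        fun z => (C₁ : ℂ) * (z + 3) ^ (2 * k) :=
      (GrowthOn.of_norm_le (by norm_num) fun _ _ => le_rfl).mul
        (GrowthOn.pow (by norm_num) (GrowthOn.add_const (by norm_num) 3) _)
    refine h1.congr fun z hz => ?_
    have hC₁0 : 0 ≤ C₁ := by positivity
    rw [norm_mul, norm_pow, Complex.norm_real, Real.norm_of_nonneg hC₁0]
    refine norm_le_pow_of_strip hg (by linarith) hgA hleft (fun w hw => ?_) hz.1 hz.2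
    refine (hright w hw).trans ?_
    rw [hC₁]
    exact mul_le_mul_of_nonneg_right
      (le_mul_of_one_le_right hpos (one_le_pow₀ (by norm_num : (1 : ℝ) ≤ 4))) (by positivity)
  have hplane : GrowthOn (3 / 2) {z | 2 ≤ z.re} g := by
    have h1 : GrowthOn (3 / 2) {z | 2 ≤ z.re} fun z => (M : ℂ) * (z + (-1)) ^ k :=
      (GrowthOn.of_norm_le (by norm_num) fun _ _ => le_rfl).mul
        (GrowthOn.pow (by norm_num) (GrowthOn.add_const (by norm_num) (-1)) _)
    refine (((D.growthOn_archFactor (δ := 2) (by norm_num)).mul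
      (hneg (by norm_num) _)).mul h1).congr fun z hz => ?_
    rw [hfac z (by linarith [show 2 ≤ z.re from hz]), norm_mul, norm_mul (_ * _)]
    gcongr
    rw [norm_mul, norm_pow, Complex.norm_real, Real.norm_of_nonneg hM0, ← sub_eq_add_neg]
    exact hM z hz
  obtain ⟨C, -, hC⟩ := (hplane.union hstrip).union
    ((hplane.reflect (by norm_num)).congr (f₂ := g) fun z _ => (hrefl z).ge)
  refine ⟨C, fun z => hC z ?_⟩
  rcases le_total 2 z.re with h | h
  · exact Or.inl (Or.inl h)
  · rcases le_total (-1) z.re with h' | h'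
    · exact Or.inl (Or.inr ⟨h', h⟩)
    · refine Or.inr ?_
      simp
      linarith

/-- The Dirichlet series is bounded for `Re s ≥ 2`. -/
theorem ExtendedSelbergClass.exists_norm_le {a : ℕ → ℂ} {L : ℂ → ℂ}
    (hL : ExtendedSelbergClass a L) : ∃ M, ∀ s : ℂ, 2 ≤ s.re → ‖L s‖ ≤ M := by
  have h2 : LSeriesSummable a 2 := hL.summable 2 (by simp)
  refine ⟨∑' n, ‖LSeries.term a 2 n‖, fun s hs => ?_⟩
  rw [hL.eq_series s (by linarith), LSeries]
  have h3 : ∀ n, ‖LSeries.term a s n‖ ≤ ‖LSeries.term a 2 n‖ :=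
    LSeries.norm_term_le_of_re_le_re a (by simpa using hs)
  exact tsum_of_norm_bounded h2.norm.hasSum h3


/-- Functions on a half-plane `Re s ≥ σ` with slow growth, whose real part on the line `Re s = σ` is
even up to a small mean, and which are asymptotically real on the real axis. -/
structure Tame (σ : ℝ) (u : ℂ → ℂ) : Prop where
  growth : ∃ C : ℝ, ∀ s : ℂ, σ ≤ s.re → ‖u s‖ ≤ C * (1 + ‖s‖) ^ (1 / 4 : ℝ)
  continuous : Continuous fun t : ℝ => u (σ + t * Complex.I)
  odd_integral : ∃ C : ℝ, ∀ T : ℝ, 1 ≤ T →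
    |∫ t in (0 : ℝ)..T, ((u (σ + t * Complex.I)).re - (u (σ + (-t : ℝ) * Complex.I)).re)| ≤
      C * T ^ (3 / 4 : ℝ)
  im_tendsto : Tendsto (fun x : ℝ => (u x).im) atTop (𝓝 0)

namespace Tame

variable {σ : ℝ} {u v : ℂ → ℂ}

theorem congr (hu : Tame σ u) (h : ∀ s : ℂ, σ ≤ s.re → v s = u s) : Tame σ v := by
  have h1 : ∀ t : ℝ, v (σ + t * Complex.I) = u (σ + t * Complex.I) := fun t => h _ (by simp)
  refine ⟨?_, ?_, ?_, ?_⟩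
  · exact hu.growth.imp fun C hC s hs => by rw [h s hs]; exact hC s hs
  · simpa only [h1] using hu.continuous
  · simpa only [h1] using hu.odd_integral
  · refine hu.im_tendsto.congr' ?_
    filter_upwards [eventually_ge_atTop σ] with x hx
    rw [h x (by simpa using hx)]

theorem intervalIntegrable (hu : Tame σ u) (a b : ℝ) :
    IntervalIntegrable (fun t : ℝ => (u (σ + t * Complex.I)).re - (u (σ + (-t : ℝ) * Complex.I)).re)
      MeasureTheory.volume a b := by
  refine Continuous.intervalIntegrable ?_ a b
  exact (Complex.continuous_re.comp hu.continuous).sub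
    (Complex.continuous_re.comp (hu.continuous.comp continuous_neg))

theorem add (hu : Tame σ u) (hv : Tame σ v) : Tame σ fun s => u s + v s := by
  refine ⟨?_, hu.continuous.add hv.continuous, ?_, ?_⟩
  · obtain ⟨C₁, h₁⟩ := hu.growth
    obtain ⟨C₂, h₂⟩ := hv.growth
    refine ⟨C₁ + C₂, fun s hs => (norm_add_le _ _).trans ?_⟩
    rw [add_mul]
    exact add_le_add (h₁ s hs) (h₂ s hs)
  · obtain ⟨C₁, h₁⟩ := hu.odd_integral
    obtain ⟨C₂, h₂⟩ := hv.odd_integral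
    refine ⟨C₁ + C₂, fun T hT => ?_⟩
    have h3 := intervalIntegral.integral_add (hu.intervalIntegrable 0 T)
      (hv.intervalIntegrable 0 T)
    rw [add_mul]
    refine le_trans (le_of_eq ?_) ((abs_add_le _ _).trans (add_le_add (h₁ T hT) (h₂ T hT)))
    rw [← h3]
    congr 1
    refine intervalIntegral.integral_congr fun t _ => ?_
    simp only [Complex.add_re]
    ring
  · simpa using hu.im_tendsto.add hv.im_tendsto

theorem real_mul (hu : Tame σ u) (r : ℝ) : Tame σ fun s => (r : ℂ) * u s := by
  refine ⟨?_, continuous_const.mul hu.continuous, ?_, ?_⟩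
  · obtain ⟨C, hC⟩ := hu.growth
    refine ⟨|r| * C, fun s hs => ?_⟩
    rw [norm_mul, Complex.norm_real, Real.norm_eq_abs, mul_assoc]
    exact mul_le_mul_of_nonneg_left (hC s hs) (abs_nonneg r)
  · obtain ⟨C, hC⟩ := hu.odd_integral
    refine ⟨|r| * C, fun T hT => ?_⟩
    simp only [Complex.re_ofReal_mul, ← mul_sub]
    rw [intervalIntegral.integral_const_mul, abs_mul, mul_assoc]
    exact mul_le_mul_of_nonneg_left (hC T hT) (abs_nonneg r)
  · simpa using hu.im_tendsto.const_mul r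

theorem of_conj {C : ℝ} (hC0 : 0 ≤ C) (hC : ∀ s : ℂ, σ ≤ s.re → ‖u s‖ ≤ C)
    (hc : Continuous fun t : ℝ => u (σ + t * Complex.I))
    (hu : ∀ s, u (conj s) = conj (u s)) : Tame σ u := by
  refine ⟨⟨C, fun s hs => (hC s hs).trans ?_⟩, hc, ⟨0, fun T _ => ?_⟩, ?_⟩
  · exact le_mul_of_one_le_right hC0
      (Real.one_le_rpow (by linarith [norm_nonneg s]) (by norm_num))
  · have h1 : ∀ t : ℝ, (u (σ + t * Complex.I)).re - (u (σ + (-t : ℝ) * Complex.I)).re = 0 := by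
      intro t
      have h2 : (σ : ℂ) + (-t : ℝ) * Complex.I = conj (σ + t * Complex.I : ℂ) := by simp
      rw [h2, hu, Complex.conj_re, sub_self]
    simp only [h1]
    simp
  · have h1 : ∀ x : ℝ, (u x).im = 0 := by
      intro x
      rw [← Complex.conj_eq_iff_im, ← hu, Complex.conj_ofReal]
    simp only [h1]
    exact tendsto_const_nhds

theorem const (σ r : ℝ) : Tame σ fun _ => (r : ℂ) :=
  of_conj (abs_nonneg r) (fun s _ => by simp) continuous_const (by simp)

theorem sum {ι : Type*} (s : Finset ι) {U : ι → ℂ → ℂ} (h : ∀ i ∈ s, Tame σ (U i)) :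
    Tame σ fun z => ∑ i ∈ s, U i z := by
  classical
  induction s using Finset.induction_on with
  | empty => simpa using const σ 0
  | insert i s hi ih =>
    simp only [Finset.sum_insert hi]
    exact (h i (by simp)).add (ih fun j hj => h j (by simp [hj]))

theorem one_div_sub {σ r : ℝ} (hr : r < σ) : Tame σ fun s => 1 / (s - r) := by
  have h0 : ∀ s : ℂ, σ ≤ s.re → σ - r ≤ ‖s - r‖ := fun s hs => by
    have := Complex.re_le_norm (s - r)
    simp at this
    linarith
  refine of_conj (C := 1 / (σ - r)) (one_div_nonneg.2 (by linarith)) (fun s hs => ?_) ?_ ?_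
  · rw [norm_div, norm_one]
    exact one_div_le_one_div_of_le (by linarith) (h0 s hs)
  · refine continuous_const.div (by fun_prop) fun t h => ?_
    have := h0 (σ + t * Complex.I) (by simp)
    rw [h, norm_zero] at this
    linarith
  · intro s
    simp

end Tame

theorem digamma_conj {w : ℂ} (hw : 0 < w.re) :
    Complex.digamma (conj w) = conj (Complex.digamma w) := by
  rw [digamma_eq_tsum hw, digamma_eq_tsum (w := conj w) (by simpa using hw), map_add,
    Complex.conj_tsum]
  simp [digammaTerm]

theorem continuousAt_digamma {w : ℂ} (hw : 0 < w.re) : ContinuousAt Complex.digamma w := by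
  have ho : IsOpen {w : ℂ | 0 < w.re} := isOpen_lt continuous_const Complex.continuous_re
  have hne : ∀ w : ℂ, 0 < w.re → ∀ n : ℕ, w ≠ -n := fun w hw n h => by
    rw [h] at hw
    simp at hw
    linarith [Nat.cast_nonneg (α := ℝ) n]
  have hd : DifferentiableOn ℂ Complex.Gamma {w | 0 < w.re} := fun w hw =>
    (Complex.differentiableAt_Gamma w (hne w hw)).differentiableWithinAt
  exact (((hd.deriv ho).differentiableAt (ho.mem_nhds hw)).div
    (hd.differentiableAt (ho.mem_nhds hw)) (Complex.Gamma_ne_zero (hne w hw))).continuousAt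

/-- An even function of moderate growth has small oscillation after a shift. -/
theorem exists_abs_integral_shift_le {φ : ℝ → ℝ} (hφ : Continuous φ) (heven : ∀ y, φ (-y) = φ y)
    {C : ℝ} (hC0 : 0 ≤ C) (hC : ∀ y, |φ y| ≤ C * (1 + |y|) ^ (1 / 4 : ℝ)) {l : ℝ} (hl : 0 < l)
    (m : ℝ) :
    ∃ K : ℝ, ∀ T : ℝ, 1 ≤ T →
      |∫ t in (0 : ℝ)..T, (φ (l * t + m) - φ (l * (-t) + m))| ≤ K * T ^ (3 / 4 : ℝ) := by
  set R : ℝ := 1 + l + |m| with hR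
  have hm := abs_nonneg m
  have hbound : ∀ x T : ℝ, 1 ≤ T → |x| ≤ l * T →
      |∫ y in (x - m)..(x + m), φ y| ≤ C * R * (2 * |m|) * T ^ (3 / 4 : ℝ) := by
    intro x T hT hx
    have h1 : ∀ y ∈ Set.uIoc (x - m) (x + m), ‖φ y‖ ≤ C * (R * T) ^ (1 / 4 : ℝ) := by
      intro y hy
      have h2 : |y - x| ≤ |m| := by
        rw [Set.mem_uIoc] at hy
        rcases hy with hy | hy
        · have := le_abs_self m
          exact abs_le.2 ⟨by linarith, by linarith⟩
        · have := neg_abs_le m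
          exact abs_le.2 ⟨by linarith, by linarith⟩
      have h3 : |y| ≤ l * T + |m| := by
        have := abs_add_le (y - x) x
        rw [sub_add_cancel] at this
        linarith
      rw [Real.norm_eq_abs]
      refine (hC y).trans ?_
      gcongr
      rw [hR]
      nlinarith
    have h4 := intervalIntegral.norm_integral_le_of_norm_le_const h1
    rw [Real.norm_eq_abs, show x + m - (x - m) = 2 * m by ring, abs_mul, abs_two] at h4
    refine h4.trans ?_
    have h5 : (R * T) ^ (1 / 4 : ℝ) ≤ R * T ^ (3 / 4 : ℝ) := by
      rw [Real.mul_rpow (by positivity) (by positivity)]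
      have h6 : R ^ (1 / 4 : ℝ) ≤ R := by
        conv_rhs => rw [← Real.rpow_one R]
        exact Real.rpow_le_rpow_of_exponent_le (by linarith) (by norm_num)
      have h7 : T ^ (1 / 4 : ℝ) ≤ T ^ (3 / 4 : ℝ) :=
        Real.rpow_le_rpow_of_exponent_le hT (by norm_num)
      gcongr
    calc C * (R * T) ^ (1 / 4 : ℝ) * (2 * |m|)
        ≤ C * (R * T ^ (3 / 4 : ℝ)) * (2 * |m|) := by gcongr
      _ = _ := by ring
  have hint : ∀ a b : ℝ, IntervalIntegrable φ MeasureTheory.volume a b := fun a b =>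
    hφ.intervalIntegrable a b
  refine ⟨2 * (l⁻¹ * (C * R * (2 * |m|))), fun T hT => ?_⟩
  have e1 : ∀ t : ℝ, φ (l * (-t) + m) = φ (l * t + -m) := fun t => by
    rw [← heven]
    congr 1
    ring
  simp only [e1]
  have hi : ∀ d : ℝ, IntervalIntegrable (fun t => φ (l * t + d)) MeasureTheory.volume 0 T :=
    fun d => Continuous.intervalIntegrable (by fun_prop) 0 T
  rw [intervalIntegral.integral_sub (hi m) (hi (-m)),
    intervalIntegral.integral_comp_mul_add φ hl.ne' m,
    intervalIntegral.integral_comp_mul_add φ hl.ne' (-m), smul_eq_mul, smul_eq_mul, ← mul_sub]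
  have e2 : (∫ y in (l * 0 + m)..(l * T + m), φ y) - ∫ y in (l * 0 + -m)..(l * T + -m), φ y =
      (∫ y in (l * T - m)..(l * T + m), φ y) - ∫ y in (0 - m)..(0 + m), φ y := by
    have h1 := intervalIntegral.integral_add_adjacent_intervals (hint (0 - m) (0 + m))
      (hint (0 + m) (l * T + m))
    have h2 := intervalIntegral.integral_add_adjacent_intervals (hint (0 - m) (l * T - m))
      (hint (l * T - m) (l * T + m))
    rw [mul_zero, ← sub_eq_add_neg, ← sub_eq_add_neg]
    linarith
  rw [e2, abs_mul, abs_of_pos (inv_pos.2 hl)]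
  have h1 := hbound (l * T) T hT (abs_of_nonneg (by positivity)).le
  have h2 := hbound 0 T hT (by rw [abs_zero]; positivity)
  calc l⁻¹ * |_| ≤ l⁻¹ * (C * R * (2 * |m|) * T ^ (3 / 4 : ℝ) +
        C * R * (2 * |m|) * T ^ (3 / 4 : ℝ)) := by
        gcongr
        exact (abs_sub _ _).trans (add_le_add h1 h2)
    _ = _ := by ring

theorem Tame.digamma {σ l : ℝ} (hσ : 0 < σ) (hl : 0 < l) {μ : ℂ} (hμ : 0 ≤ μ.re) :
    Tame σ fun s => Complex.digamma (l * s + μ) := by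
  have hδ : 0 < l * σ := by positivity
  obtain ⟨C, hC0, hC⟩ := exists_norm_digamma_le hδ
  have hre : ∀ s : ℂ, σ ≤ s.re → l * σ ≤ (l * s + μ).re := fun s hs => by
    simp
    nlinarith
  have hx : 0 < l * σ + μ.re := by linarith
  refine ⟨?_, ?_, ?_, tendsto_im_digamma hl μ⟩
  · refine ⟨C * (1 + l + ‖μ‖) ^ (1 / 4 : ℝ), fun s hs => (hC _ (hre s hs)).trans ?_⟩
    rw [mul_assoc, ← Real.mul_rpow (by positivity) (by positivity)]
    have h1 : ‖(l : ℂ) * s + μ‖ ≤ l * ‖s‖ + ‖μ‖ := by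
      refine (norm_add_le _ _).trans_eq ?_
      rw [norm_mul, Complex.norm_real, Real.norm_of_nonneg hl.le]
    gcongr
    nlinarith [norm_nonneg s, norm_nonneg μ, mul_nonneg (norm_nonneg s) (norm_nonneg μ)]
  · refine continuous_iff_continuousAt.2 fun t => ?_
    have h1 : 0 < ((l : ℂ) * (σ + t * Complex.I) + μ).re := by
      have := hre (σ + t * Complex.I) (by simp)
      linarith
    exact ContinuousAt.comp (f := fun t : ℝ => (l : ℂ) * (σ + t * Complex.I) + μ)
      (continuousAt_digamma h1) (by fun_prop)
  · set x : ℝ := l * σ + μ.re with hx_def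
    set φ : ℝ → ℝ := fun y => (Complex.digamma (x + y * Complex.I)).re with hφ
    have hcont : Continuous φ := by
      refine continuous_iff_continuousAt.2 fun y => ?_
      have h1 : ContinuousAt (fun y : ℝ => Complex.digamma (x + y * Complex.I)) y :=
        ContinuousAt.comp (f := fun y : ℝ => (x : ℂ) + y * Complex.I)
          (continuousAt_digamma (by simpa using hx)) (by fun_prop)
      exact Complex.continuous_re.continuousAt.comp h1
    have heven : ∀ y, φ (-y) = φ y := by
      intro y
      have h1 : (x : ℂ) + ((-y : ℝ) : ℂ) * Complex.I = conj (x + y * Complex.I : ℂ) := by simp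
      simp only [hφ]
      rw [h1, digamma_conj (by simpa using hx), Complex.conj_re]
    have hgr : ∀ y, |φ y| ≤ C * (1 + x) ^ (1 / 4 : ℝ) * (1 + |y|) ^ (1 / 4 : ℝ) := by
      intro y
      refine (Complex.abs_re_le_norm _).trans ((hC _ (by simp [hx_def]; linarith)).trans ?_)
      rw [mul_assoc, ← Real.mul_rpow (by positivity) (by positivity)]
      have h1 : ‖(x : ℂ) + y * Complex.I‖ ≤ x + |y| := by
        refine (norm_add_le _ _).trans_eq ?_
        rw [norm_mul, Complex.norm_real, Complex.norm_real, Complex.norm_I, mul_one,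
          Real.norm_of_nonneg hx.le, Real.norm_eq_abs]
      gcongr
      nlinarith [abs_nonneg y]
    obtain ⟨K, hK⟩ := exists_abs_integral_shift_le hcont heven (by positivity) hgr hl μ.im
    refine ⟨K, fun T hT => ?_⟩
    have h2 : ∀ t : ℝ, (l : ℂ) * (σ + t * Complex.I) + μ =
        x + ((l * t + μ.im : ℝ) : ℂ) * Complex.I := by
      intro t
      apply Complex.ext <;> simp [hx_def]
    simp only [h2]
    exact hK T hT

/-- Logarithmic derivatives of functions close to `1` in a half-plane are tame. -/
theorem Tame.logDeriv_of_norm_sub_one_le {M : ℂ → ℂ} {σ₁ : ℝ}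
    (hd : ∀ s : ℂ, σ₁ ≤ s.re → DifferentiableAt ℂ M s)
    (hM : ∀ s : ℂ, σ₁ ≤ s.re → ‖M s - 1‖ ≤ 1 / 2)
    (hlim : ∀ ε : ℝ, 0 < ε → ∃ X, ∀ s : ℂ, X ≤ s.re → ‖M s - 1‖ ≤ ε) {σ : ℝ} (hσ : σ₁ + 1 ≤ σ) :
    Tame σ fun s => deriv M s / M s := by
  have hball : ∀ s z : ℂ, ‖z - s‖ ≤ 1 → s.re - 1 ≤ z.re := fun s z hz => by
    have h1 := (Complex.abs_re_le_norm (z - s)).trans hz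
    have h2 := (abs_le.1 h1).1
    rw [Complex.sub_re] at h2
    linarith
  have hlow : ∀ s : ℂ, σ₁ ≤ s.re → 1 / 2 ≤ ‖M s‖ := fun s hs => by
    have h1 := hM s hs
    have h3 := norm_sub_norm_le (1 : ℂ) (M s)
    rw [norm_one, norm_sub_rev 1 (M s)] at h3
    linarith
  have hne : ∀ s : ℂ, σ₁ ≤ s.re → M s ≠ 0 := fun s hs h => by
    have := hlow s hs
    rw [h, norm_zero] at this
    linarith
  have hder : ∀ (s : ℂ) (ε : ℝ), σ₁ + 1 ≤ s.re → (∀ z : ℂ, s.re - 1 ≤ z.re → ‖M z - 1‖ ≤ ε) →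
      ‖deriv M s / M s‖ ≤ 2 * ε := by
    intro s ε hs hε
    have h1 : ‖deriv (fun z => M z - 1) s‖ ≤ ε / 1 := by
      refine Complex.norm_deriv_le_of_forall_mem_sphere_norm_le one_pos ?_ fun z hz => ?_
      · refine DifferentiableOn.diffContOnCl fun z hz => ?_
        have h2 : ‖z - s‖ ≤ 1 := by
          have h3 := Metric.closure_ball_subset_closedBall hz
          rwa [Metric.mem_closedBall, dist_eq_norm] at h3
        exact ((hd z (by linarith [hball s z h2])).sub_const 1).differentiableWithinAt
      · rw [Metric.mem_sphere, dist_eq_norm] at hz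
        exact hε z (hball s z hz.le)
    rw [deriv_sub_const_fun, div_one] at h1
    rw [norm_div, div_le_iff₀ (by linarith [hlow s (by linarith)])]
    have h4 := hlow s (by linarith)
    have h5 := (norm_nonneg _).trans h1
    nlinarith
  refine ⟨⟨1, fun s hs => ?_⟩, ?_, ⟨2 * (2 * Real.pi), fun T hT => ?_⟩, ?_⟩
  · have h1 := hder s (1 / 2) (by linarith) fun z hz => hM z (by linarith)
    have h2 : 1 ≤ (1 + ‖s‖) ^ (1 / 4 : ℝ) :=
      Real.one_le_rpow (by linarith [norm_nonneg s]) (by norm_num)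
    linarith
  all_goals
    have ho : IsOpen {s : ℂ | σ₁ < s.re} := isOpen_lt continuous_const Complex.continuous_re
    have hdo : DifferentiableOn ℂ M {s | σ₁ < s.re} := fun s hs =>
      (hd s (le_of_lt hs)).differentiableWithinAt
    have hcd : Continuous fun t : ℝ =>
        deriv M (σ + t * Complex.I) / M (σ + t * Complex.I) := by
      refine continuous_iff_continuousAt.2 fun t => ?_
      have hmem : (σ + t * Complex.I : ℂ) ∈ {s : ℂ | σ₁ < s.re} := by
        simp
        linarith
      have h1 := (((hdo.deriv ho).differentiableAt (ho.mem_nhds hmem)).div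
        (hdo.differentiableAt (ho.mem_nhds hmem)) (hne _ (le_of_lt hmem))).continuousAt
      exact ContinuousAt.comp (f := fun t : ℝ => (σ : ℂ) + t * Complex.I) h1 (by fun_prop)
  · exact hcd
  · have hlog : ∀ e t : ℝ, HasDerivAt
        (fun t : ℝ => (Complex.log (M (σ + (e * t : ℝ) * Complex.I))).im)
        (e * (deriv M (σ + (e * t : ℝ) * Complex.I) / M (σ + (e * t : ℝ) * Complex.I)).re) t := by
      intro e t
      set s : ℂ := σ + (e * t : ℝ) * Complex.I with hs
      have hsre : σ₁ ≤ s.re := by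
        simp [hs]
        linarith
      have hline : HasDerivAt (fun t : ℝ => (σ : ℂ) + (e * t : ℝ) * Complex.I)
          ((e : ℂ) * Complex.I) t := by
        have h1 : HasDerivAt (fun t : ℝ => e * t) e t := by
          simpa using (hasDerivAt_id t).const_mul e
        exact (h1.ofReal_comp.mul_const Complex.I).const_add _
      have hslit : M s ∈ Complex.slitPlane := by
        left
        have h1 := (Complex.abs_re_le_norm _).trans (hM s hsre)
        have h2 := (abs_le.1 h1).1
        simp at h2
        linarith
      have h2 : HasDerivAt (fun t : ℝ => M (σ + (e * t : ℝ) * Complex.I))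
          (deriv M s * ((e : ℂ) * Complex.I)) t :=
        HasDerivAt.comp (h₂ := M) (h := fun t : ℝ => (σ : ℂ) + (e * t : ℝ) * Complex.I) t
          (hd s hsre).hasDerivAt hline
      have h3 := h2.clog_real hslit
      have h4 := (Complex.imCLM.hasFDerivAt.comp_hasDerivAt t h3)
      refine h4.congr_deriv ?_
      rw [Complex.imCLM_apply, show deriv M s * ((e : ℂ) * Complex.I) / M s =
        e * (deriv M s / M s * Complex.I) by ring, Complex.im_ofReal_mul, Complex.mul_I_im]
    have hF : ∀ t : ℝ, HasDerivAt
        (fun t : ℝ => (Complex.log (M (σ + ((1 : ℝ) * t : ℝ) * Complex.I))).im +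
          (Complex.log (M (σ + ((-1 : ℝ) * t : ℝ) * Complex.I))).im)
        ((deriv M (σ + t * Complex.I) / M (σ + t * Complex.I)).re -
          (deriv M (σ + (-t : ℝ) * Complex.I) / M (σ + (-t : ℝ) * Complex.I)).re) t := by
      intro t
      refine ((hlog 1 t).add (hlog (-1) t)).congr_deriv ?_
      rw [one_mul, one_mul, neg_one_mul, neg_one_mul, ← sub_eq_add_neg]
    rw [intervalIntegral.integral_eq_sub_of_hasDerivAt (fun t _ => hF t)
      (((Complex.continuous_re.comp hcd).sub
        (Complex.continuous_re.comp (hcd.comp continuous_neg))).intervalIntegrable 0 T)]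
    have hpi : ∀ z : ℂ, |(Complex.log z).im| ≤ Real.pi := fun z => by
      rw [Complex.log_im]
      exact Complex.abs_arg_le_pi z
    have hT1 : 1 ≤ T ^ (3 / 4 : ℝ) := Real.one_le_rpow hT (by norm_num)
    have hpi0 := Real.pi_pos
    refine ((abs_sub _ _).trans (add_le_add ((abs_add_le _ _).trans (add_le_add (hpi _) (hpi _)))
      ((abs_add_le _ _).trans (add_le_add (hpi _) (hpi _))))).trans ?_
    nlinarith
  · have h1 : Tendsto (fun x : ℝ => deriv M x / M x) atTop (𝓝 0) := by
      rw [Metric.tendsto_atTop]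
      intro ε hε
      obtain ⟨X, hX⟩ := hlim (ε / 4) (by positivity)
      refine ⟨max (X + 1) (σ₁ + 1), fun x hx => ?_⟩
      have hx1 := (le_max_left _ _).trans hx
      have hx2 := (le_max_right _ _).trans hx
      rw [dist_zero_right]
      have := hder x (ε / 4) (by simpa using hx2) fun z hz =>
        hX z (by rw [Complex.ofReal_re] at hz; linarith)
      linarith
    simpa [Function.comp_def] using (Complex.continuous_im.tendsto 0).comp h1


/-- A Dirichlet series is asymptotic to its leading term. -/
theorem ExtendedSelbergClass.exists_leading_term {a : ℕ → ℂ} {L : ℂ → ℂ}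
    (hL : ExtendedSelbergClass a L) (hne : ∃ s : ℂ, 2 ≤ s.re ∧ L s ≠ 0) :
    ∃ (n : ℕ) (θ K : ℝ), n ≠ 0 ∧ a n ≠ 0 ∧ 0 < θ ∧ θ < 1 ∧
      ∀ s : ℂ, 2 ≤ s.re → ‖(n : ℂ) ^ s * L s - a n‖ ≤ θ ^ (s.re - 2) * K := by
  classical
  have hex : ∃ n : ℕ, n ≠ 0 ∧ a n ≠ 0 := by
    by_contra! h
    obtain ⟨s, hs, hLs⟩ := hne
    refine hLs ?_
    rw [hL.eq_series s (by linarith), LSeries_congr (g := 0) (fun {n} hn => h n hn), LSeries_zero]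
    rfl
  obtain ⟨⟨hn0, han⟩, hmin⟩ := Nat.find_spec hex, fun m hm => Nat.find_min hex (m := m) hm
  set n := Nat.find hex with hn
  have hnpos : (0 : ℝ) < n := by exact_mod_cast Nat.pos_of_ne_zero hn0
  have hnC : (n : ℂ) ≠ 0 := by exact_mod_cast hn0
  set θ : ℝ := n / (n + 1) with hθ
  have h2 : LSeriesSummable a 2 := hL.summable 2 (by simp)
  refine ⟨n, θ, ∑' j, (n : ℝ) ^ (2 : ℝ) * ‖LSeries.term a 2 j‖, hn0, han, by positivity,
    (div_lt_one (by linarith)).2 (by linarith), fun s hs => ?_⟩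
  have hs0 : LSeriesSummable a s := hL.summable s (by linarith)
  rw [hL.eq_series s (by linarith), LSeries, ← tsum_mul_left]
  have h3 := ((hs0.mul_left ((n : ℂ) ^ s)).hasSum).sub (hasSum_ite_eq n (a n))
  refine (h3.tsum_eq ▸ tsum_of_norm_bounded
    ((h2.norm.mul_left ((n : ℝ) ^ (2 : ℝ))).hasSum.mul_left (θ ^ (s.re - 2))) fun j => ?_)
  have hrhs : 0 ≤ θ ^ (s.re - 2) * ((n : ℝ) ^ (2 : ℝ) * ‖LSeries.term a 2 j‖) := by positivity
  rcases lt_trichotomy j n with hj | hj | hj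
  · have h4 : LSeries.term a s j = 0 := by
      rcases eq_or_ne j 0 with rfl | hj0
      · exact LSeries.term_zero a s
      · have h5 : a j = 0 := by
          by_contra h
          exact hmin j hj ⟨hj0, h⟩
        rw [LSeries.term_of_ne_zero hj0, h5, zero_div]
    rw [h4, if_neg hj.ne, mul_zero, sub_zero, norm_zero]
    exact hrhs
  · rw [hj, if_pos rfl, LSeries.term_of_ne_zero hn0, mul_div_cancel₀ _
      (by simp [Complex.cpow_eq_zero_iff, hnC]), sub_self, norm_zero]
    rwa [hj] at hrhs
  · have hj0 : j ≠ 0 := by omega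
    have hjpos : (0 : ℝ) < j := by exact_mod_cast Nat.pos_of_ne_zero hj0
    have hle : (n : ℝ) + 1 ≤ j := by exact_mod_cast hj
    rw [if_neg hj.ne', sub_zero, norm_mul, LSeries.norm_term_eq, LSeries.norm_term_eq, if_neg hj0,
      if_neg hj0, Complex.norm_natCast_cpow_of_pos (Nat.pos_of_ne_zero hn0)]
    have h4 : (n : ℝ) ^ s.re = (n : ℝ) ^ (s.re - 2) * (n : ℝ) ^ (2 : ℝ) := by
      rw [← Real.rpow_add hnpos]
      ring_nf
    have h5 : (j : ℝ) ^ s.re = (j : ℝ) ^ (s.re - 2) * (j : ℝ) ^ (2 : ℝ) := by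
      rw [← Real.rpow_add hjpos]
      ring_nf
    have h6 : (n : ℝ) ^ (s.re - 2) / (j : ℝ) ^ (s.re - 2) ≤ θ ^ (s.re - 2) := by
      rw [← Real.div_rpow hnpos.le hjpos.le]
      refine Real.rpow_le_rpow (by positivity) ?_ (by linarith)
      exact div_le_div_of_nonneg_left hnpos.le (by linarith) hle
    have hre2 : (2 : ℂ).re = 2 := by simp
    rw [h4, h5, hre2]
    calc (n : ℝ) ^ (s.re - 2) * (n : ℝ) ^ (2 : ℝ) *
          (‖a j‖ / ((j : ℝ) ^ (s.re - 2) * (j : ℝ) ^ (2 : ℝ)))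
        = (n : ℝ) ^ (s.re - 2) / (j : ℝ) ^ (s.re - 2) *
          ((n : ℝ) ^ (2 : ℝ) * (‖a j‖ / (j : ℝ) ^ (2 : ℝ))) := by
          have := (Real.rpow_pos_of_pos hjpos (s.re - 2)).ne'
          field_simp
      _ ≤ _ := by gcongr

theorem ExtendedSelbergClass.exists_near_one {a : ℕ → ℂ} {L : ℂ → ℂ}
    (hL : ExtendedSelbergClass a L) (hne : ∃ s : ℂ, 2 ≤ s.re ∧ L s ≠ 0) :
    ∃ (ν : ℝ) (α : ℂ) (σ₁ : ℝ), 0 < ν ∧ α ≠ 0 ∧ 2 ≤ σ₁ ∧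
      (∀ s : ℂ, σ₁ ≤ s.re → ‖(ν : ℂ) ^ s * L s / α - 1‖ ≤ 1 / 2) ∧
      ∀ ε : ℝ, 0 < ε → ∃ X, ∀ s : ℂ, X ≤ s.re → ‖(ν : ℂ) ^ s * L s / α - 1‖ ≤ ε := by
  obtain ⟨n, θ, K, hn, han, hθ0, hθ1, hK⟩ := hL.exists_leading_term hne
  have hα : 0 < ‖a n‖ := norm_pos_iff.2 han
  have key : ∀ ε : ℝ, 0 < ε → ∃ X, 2 ≤ X ∧ ∀ s : ℂ, X ≤ s.re →
      ‖((n : ℝ) : ℂ) ^ s * L s / a n - 1‖ ≤ ε := by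
    intro ε hε
    have h1 : Tendsto (fun x : ℝ => θ ^ (x - 2) * K) atTop (𝓝 (0 * K)) :=
      (((tendsto_rpow_atTop_of_base_lt_one θ (by linarith) hθ1).comp
        (tendsto_atTop_add_const_right atTop (-2 : ℝ) tendsto_id))).mul_const K
    rw [zero_mul] at h1
    obtain ⟨X, hX⟩ := eventually_atTop.1 (h1.eventually (gt_mem_nhds (mul_pos hε hα)))
    refine ⟨max X 2, le_max_right _ _, fun s hs => ?_⟩
    have h2 := hK s ((le_max_right _ _).trans hs)
    have h3 := hX s.re ((le_max_left _ _).trans hs)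
    rw [Complex.ofReal_natCast, div_sub_one han, norm_div, div_le_iff₀ hα]
    exact h2.trans h3.le
  obtain ⟨σ₁, h2, h3⟩ := key (1 / 2) (by norm_num)
  exact ⟨n, a n, σ₁, by exact_mod_cast Nat.pos_of_ne_zero hn, han, h2, h3,
    fun ε hε => (key ε hε).imp fun X hX => hX.2⟩

namespace GammaData

variable (D : GammaData)

theorem logDeriv_gammaFactor {s : ℂ} (hs : D.Regular s) :
    deriv D.gammaFactor s / D.gammaFactor s =
      ∑ j, (D.lam j : ℂ) * Complex.digamma ((D.lam j : ℂ) * s + D.mu j) := by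
  have hd : ∀ j, DifferentiableAt ℂ (fun s : ℂ => Complex.Gamma ((D.lam j : ℂ) * s + D.mu j)) s :=
    fun j => DifferentiableAt.comp s (Complex.differentiableAt_Gamma _ (hs j))
      (f := fun s : ℂ => (D.lam j : ℂ) * s + D.mu j) (by fun_prop)
  have h1 : D.gammaFactor =
      fun s => ∏ j, (fun s : ℂ => Complex.Gamma ((D.lam j : ℂ) * s + D.mu j)) s := rfl
  rw [← logDeriv_apply, h1, logDeriv_prod
    (f := fun j (s : ℂ) => Complex.Gamma ((D.lam j : ℂ) * s + D.mu j)) (fun j _ => Complex.Gamma_ne_zero (hs j))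
    fun j _ => hd j]
  refine Finset.sum_congr rfl fun j _ => ?_
  have h2 : HasDerivAt (fun s : ℂ => (D.lam j : ℂ) * s + D.mu j) (D.lam j : ℂ) s := by
    simpa using ((hasDerivAt_id s).const_mul (D.lam j : ℂ)).add_const (D.mu j)
  have h3 := logDeriv_comp (f := Complex.Gamma) (g := fun s : ℂ => (D.lam j : ℂ) * s + D.mu j)
    (x := s) (Complex.differentiableAt_Gamma _ (hs j)) h2.differentiableAt
  rw [h2.deriv] at h3
  rw [show (fun s : ℂ => Complex.Gamma ((D.lam j : ℂ) * s + D.mu j)) =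
    Complex.Gamma ∘ fun s : ℂ => (D.lam j : ℂ) * s + D.mu j from rfl, h3, mul_comm]
  rfl

theorem logDeriv_cpow {Q : ℝ} (hQ : 0 < Q) (s : ℂ) :
    logDeriv (fun s : ℂ => (Q : ℂ) ^ s) s = (Real.log Q : ℂ) := by
  have hQ' : (Q : ℂ) ≠ 0 := by exact_mod_cast hQ.ne'
  have h1 : HasDerivAt (fun s : ℂ => (Q : ℂ) ^ s) ((Q : ℂ) ^ s * Complex.log Q * 1) s :=
    (hasDerivAt_id s).const_cpow (c := (Q : ℂ)) (Or.inl hQ')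
  rw [logDeriv_apply, h1.deriv, Complex.ofReal_log hQ.le]
  have : (Q : ℂ) ^ s ≠ 0 := by simp [Complex.cpow_eq_zero_iff, hQ']
  field_simp

theorem logDeriv_archFactor {s : ℂ} (hs : D.Regular s) :
    logDeriv D.archFactor s = (Real.log D.Q : ℂ) + deriv D.gammaFactor s / D.gammaFactor s := by
  have hQ : (D.Q : ℂ) ≠ 0 := by exact_mod_cast D.Q_pos.ne'
  have hc : (D.c : ℂ) ≠ 0 := by exact_mod_cast D.c_pos.ne'
  have h0 : (D.Q : ℂ) ^ s ≠ 0 := by simp [Complex.cpow_eq_zero_iff, hQ]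
  have h1 : DifferentiableAt ℂ (fun s : ℂ => (D.Q : ℂ) ^ s) s :=
    differentiableAt_id.const_cpow (Or.inl hQ)
  have h2 : D.archFactor = fun s => ((D.c : ℂ) * (D.Q : ℂ) ^ s) * D.gammaFactor s := rfl
  rw [h2, logDeriv_mul (f := fun s : ℂ => (D.c : ℂ) * (D.Q : ℂ) ^ s) s (mul_ne_zero hc h0) (D.regular_iff.1 hs) (h1.const_mul _)
    (D.differentiableAt_gammaFactor hs), logDeriv_const_mul s _ hc, logDeriv_cpow D.Q_pos,
    logDeriv_apply]

theorem logDeriv_completion {L g : ℂ → ℂ} {k : ℕ} {s : ℂ} (hs : D.Regular s)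
    (hk : k ≠ 0 → s ≠ 0 ∧ s ≠ 1) (hLd : DifferentiableAt ℂ L s) (hLs : L s ≠ 0)
    (hg : g =ᶠ[𝓝 s] fun z => (z * (1 - z)) ^ k * D.completed L z) :
    deriv g s / g s = deriv L s / L s + (k : ℂ) / s + (k : ℂ) / (s - 1) + (Real.log D.Q : ℂ) +
      deriv D.gammaFactor s / D.gammaFactor s := by
  have ha0 := D.archFactor_ne_zero hs
  have had := D.differentiableAt_archFactor hs
  have h1 : logDeriv (D.completed L) s = logDeriv D.archFactor s + logDeriv L s :=
    logDeriv_mul (f := D.archFactor) (g := L) s ha0 hLs had hLd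
  have hc0 : D.completed L s ≠ 0 := mul_ne_zero ha0 hLs
  have hcd : DifferentiableAt ℂ (D.completed L) s := had.mul hLd
  have h2 : deriv g s / g s = logDeriv (fun z => (z * (1 - z)) ^ k * D.completed L z) s := by
    rw [logDeriv_apply, hg.deriv_eq, hg.eq_of_nhds]
  rw [h2]
  rcases eq_or_ne k 0 with rfl | hk0
  · simp only [pow_zero, one_mul]
    rw [h1, D.logDeriv_archFactor hs, logDeriv_apply]
    simp
    ring
  · obtain ⟨hs0, hs1⟩ := hk hk0
    have hs1' : 1 - s ≠ 0 := sub_ne_zero.2 hs1.symm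
    have hs1'' : s - 1 ≠ 0 := sub_ne_zero.2 hs1
    have hq : HasDerivAt (fun z : ℂ => z * (1 - z)) (1 * (1 - s) + s * (0 - 1)) s :=
      (hasDerivAt_id s).mul ((hasDerivAt_const s (1 : ℂ)).sub (hasDerivAt_id s))
    have hp0 : (s * (1 - s)) ^ k ≠ 0 := pow_ne_zero _ (mul_ne_zero hs0 hs1')
    rw [logDeriv_mul (f := fun z : ℂ => (z * (1 - z)) ^ k) s hp0 hc0
      (hq.differentiableAt.pow k) hcd, logDeriv_fun_pow hq.differentiableAt,
      logDeriv_apply (fun z : ℂ => z * (1 - z)), hq.deriv, h1, D.logDeriv_archFactor hs,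
      logDeriv_apply]
    have h3 : (k : ℂ) * ((1 * (1 - s) + s * (0 - 1)) / (s * (1 - s))) =
        (k : ℂ) / s + (k : ℂ) / (s - 1) := by
      rw [show s - 1 = -(1 - s) by ring]
      field_simp
      ring
    rw [h3]
    ring

end GammaData


theorem analyticOrderNatAt_eq_zero_iff {g : ℂ → ℂ} (hg : Differentiable ℂ g) (hne : g ≠ 0)
    {z : ℂ} : analyticOrderNatAt g z = 0 ↔ g z ≠ 0 := by
  refine ⟨fun h => (hg.analyticAt z).analyticOrderAt_eq_zero.1 ?_,
    analyticOrderNatAt_eq_zero_of_ne_zero hg⟩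
  rw [← Nat.cast_analyticOrderNatAt (analyticOrderAt_ne_top hg hne z), h, Nat.cast_zero]

section Reflection

variable {g : ℂ → ℂ} {W : ℂ}

theorem differentiable_conj_one_sub_conj (hg : Differentiable ℂ g) :
    Differentiable ℂ fun s => conj (g (1 - conj s)) := by
  intro s
  have h1 : DifferentiableAt ℂ (fun z => g (1 - z)) (conj s) := by fun_prop
  have h2 := h1.conj_conj
  rwa [Complex.conj_conj] at h2

theorem deriv_of_functionalEquation (hg : Differentiable ℂ g)
    (hFE : ∀ s, g s = W * conj (g (1 - conj s))) (s : ℂ) :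
    deriv g s = -(W * conj (deriv g (1 - conj s))) := by
  have h1 : HasDerivAt (fun z => g (1 - z)) (deriv g (1 - conj s) * -1) (conj s) := by
    refine HasDerivAt.comp (h₂ := g) (h := fun z => 1 - z) (conj s)
      (hg (1 - conj s)).hasDerivAt ?_
    simpa using (hasDerivAt_id (conj s)).const_sub 1
  have h2 := h1.conj_conj
  rw [Complex.conj_conj] at h2
  have h3 : HasDerivAt g (W * conj (deriv g (1 - conj s) * -1)) s :=
    (h2.const_mul W).congr_of_eventuallyEq (Eventually.of_forall hFE)
  rw [h3.deriv]
  simp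

theorem analyticOrderNatAt_one_sub_conj (hg : Differentiable ℂ g) (hne : g ≠ 0) (hW : W ≠ 0)
    (hFE : ∀ s, g s = W * conj (g (1 - conj s))) (ρ : ℂ) :
    analyticOrderNatAt g (1 - conj ρ) = analyticOrderNatAt g ρ := by
  obtain ⟨q, hq, hgq, hqρ⟩ := exists_eq_prod_sub_pow_mul hg hne {ρ}
  set n := analyticOrderNatAt g ρ with hn
  have h1 : analyticOrderAt g (1 - conj ρ) = n := by
    rw [(hg.analyticAt _).analyticOrderAt_eq_natCast]
    refine ⟨fun z => W * (-1) ^ n * conj (q (1 - conj z)),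
      ((differentiable_conj_one_sub_conj hq).const_mul _).analyticAt _, ?_, ?_⟩
    · simp only [map_sub, map_one, Complex.conj_conj, sub_sub_cancel]
      exact mul_ne_zero (mul_ne_zero hW (pow_ne_zero _ (by norm_num)))
        ((map_ne_zero _).2 (hqρ ρ (by simp)))
    · refine Eventually.of_forall fun z => ?_
      rw [hFE z, hgq]
      simp only [Finset.prod_singleton, map_mul, map_pow, map_sub, map_one, Complex.conj_conj,
        smul_eq_mul, ← hn]
      rw [show 1 - z - conj ρ = -1 * (z - (1 - conj ρ)) by ring, mul_pow]
      ring
  rw [analyticOrderNatAt, h1]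
  rfl

theorem exists_re_logDeriv_eq_zero (hg : Differentiable ℂ g) (hne : g ≠ 0) (hW : W ≠ 0)
    (hFE : ∀ s, g s = W * conj (g (1 - conj s))) :
    ∃ s₀ : ℂ, s₀.re = 1 / 2 ∧ g s₀ ≠ 0 ∧ (deriv g s₀ / g s₀).re = 0 := by
  set p : ℝ → ℂ := fun t => ((1 / 2 : ℝ) : ℂ) + t * Complex.I with hp
  have hinj : Function.Injective p := fun t u h => by
    have := congrArg Complex.im h
    simpa [hp] using this
  obtain ⟨t, ht, hgt⟩ : ∃ t ∈ Set.Icc (0 : ℝ) 1, g (p t) ≠ 0 := by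
    by_contra! h
    refine ((Set.Icc_infinite (zero_lt_one' ℝ)).image hinj.injOn)
      ((finite_zeros_inter_closedBall hg hne 2).subset ?_)
    rintro _ ⟨t, ht, rfl⟩
    refine ⟨h t ht, ?_⟩
    refine (Complex.norm_le_abs_re_add_abs_im _).trans ?_
    simp only [hp, Complex.add_re, Complex.ofReal_re, Complex.re_ofReal_mul, Complex.I_re,
      Complex.add_im, Complex.ofReal_im, Complex.im_ofReal_mul, Complex.I_im]
    rw [mul_zero, add_zero, mul_one, zero_add, abs_of_nonneg ht.1, abs_of_pos (by norm_num)]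
    linarith [ht.2]
  have hfix : 1 - conj (p t) = p t := by
    apply Complex.ext
    · simp [hp]
      norm_num
    · simp [hp]
  refine ⟨p t, by simp [hp], hgt, ?_⟩
  have h1 := hFE (p t)
  have h2 := deriv_of_functionalEquation hg hFE (p t)
  rw [hfix] at h1 h2
  have h3 : deriv g (p t) / g (p t) = -conj (deriv g (p t) / g (p t)) := by
    conv_lhs => rw [h2, h1]
    rw [map_div₀]
    have : conj (g (p t)) ≠ 0 := (map_ne_zero _).2 hgt
    field_simp
  have h4 := congrArg Complex.re h3
  rw [Complex.neg_re, Complex.conj_re] at h4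
  linarith

end Reflection

theorem ExtendedSelbergClass.differentiableAt {a : ℕ → ℂ} {L : ℂ → ℂ}
    (hL : ExtendedSelbergClass a L) {s : ℂ} (hs : poleOrder L ≠ 0 → s ≠ 1) :
    DifferentiableAt ℂ L s := by
  by_cases hk : poleOrder L = 0
  · exact hL.entire hk s
  · obtain ⟨k, g, hg, hgL⟩ := hL.continuation
    have hs1 := sub_ne_zero.2 (hs hk)
    have h1 : DifferentiableAt ℂ (fun z : ℂ => (z - 1) ^ k) s := by fun_prop
    refine ((hg.1 s).div h1 (pow_ne_zero k hs1)).congr_of_eventuallyEq ?_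
    filter_upwards [isOpen_ne.mem_nhds (hs hk)] with z hz
    rw [Pi.div_apply, hgL z hz, mul_div_cancel_left₀ _ (pow_ne_zero k (sub_ne_zero.2 hz))]

namespace GammaData

variable (D : GammaData)

theorem stripExpansion {a : ℕ → ℂ} {L : ℂ → ℂ} (hL : ExtendedSelbergClass a L) {g : ℂ → ℂ}
    (hg : Differentiable ℂ g) (hne : g ≠ 0) (hFE : ∀ s, g s = D.W * conj (g (1 - conj s)))
    (hgL : ∀ s, D.Regular s → (poleOrder L ≠ 0 → s ≠ 0 ∧ s ≠ 1) →
      g s = (s * (1 - s)) ^ poleOrder L * D.completed L s) {B : ℂ}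
    (hsum : Summable fun ρ : ℂ => (analyticOrderNatAt g ρ : ℝ) / (1 + ‖ρ‖) ^ 2)
    (hB : ∀ z, g z ≠ 0 → HasSum (fun ρ : ℂ => (analyticOrderNatAt g ρ : ℂ) *
      (1 / (z - ρ) + 1 / ρ)) (deriv g z / g z - B)) :
    ∃ b σ, StripExpansion (analyticOrderNatAt g) (fun z => deriv g z / g z) B b σ := by
  have hW : D.W ≠ 0 := fun h => by simpa [h] using D.norm_W
  set k := poleOrder L with hk
  have hLne : ∃ s : ℂ, 2 ≤ s.re ∧ L s ≠ 0 := by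
    by_contra! h
    refine hne (AnalyticOnNhd.eq_of_eventuallyEq (z₀ := 3) (fun z _ => hg.analyticAt z)
      (fun z _ => analyticAt_const) ?_)
    have h3 : (2 : ℝ) < (3 : ℂ).re := by norm_num
    filter_upwards [(isOpen_lt continuous_const Complex.continuous_re).mem_nhds h3] with z hz
    have hz' : 2 < z.re := hz
    rw [hgL z (D.regular_of_re_pos (by linarith)) fun _ => ⟨?_, ?_⟩, D.completed_eq, h z hz'.le]
    · simp
    · rintro rfl
      simp at hz'
      linarith
    · rintro rfl
      simp at hz'
  obtain ⟨ν, α, σ₁, hν, hα, hσ₁, hM, hlim⟩ := hL.exists_near_one hLne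
  set M : ℂ → ℂ := fun s => (ν : ℂ) ^ s * L s / α with hM_def
  have hνC : (ν : ℂ) ≠ 0 := by exact_mod_cast hν.ne'
  have hν0 : ∀ s : ℂ, (ν : ℂ) ^ s ≠ 0 := fun s => by simp [Complex.cpow_eq_zero_iff, hνC]
  have hL0 : ∀ s : ℂ, σ₁ ≤ s.re → L s ≠ 0 := fun s hs h => by
    have := hM s hs
    simp only [h] at this
    norm_num at this
  have hne01 : ∀ s : ℂ, σ₁ ≤ s.re → s ≠ 0 ∧ s ≠ 1 := fun s hs => by
    constructor
    · rintro rfl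
      simp at hs
      linarith
    · rintro rfl
      simp at hs
      linarith
  have hLd : ∀ s : ℂ, σ₁ ≤ s.re → DifferentiableAt ℂ L s := fun s hs =>
    hL.differentiableAt fun _ => (hne01 s hs).2
  have hνd : ∀ s : ℂ, DifferentiableAt ℂ (fun s : ℂ => (ν : ℂ) ^ s) s := fun s =>
    differentiableAt_id.const_cpow (Or.inl hνC)
  have hg0 : ∀ s : ℂ, σ₁ ≤ s.re → g s ≠ 0 := fun s hs => by
    have hreg := D.regular_of_re_pos (s := s) (by linarith)
    rw [hgL s hreg fun _ => hne01 s hs, D.completed_eq]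
    exact mul_ne_zero (pow_ne_zero _ (mul_ne_zero (hne01 s hs).1
      (sub_ne_zero.2 (hne01 s hs).2.symm))) (mul_ne_zero (D.archFactor_ne_zero hreg) (hL0 s hs))
  have hMtame : Tame (σ₁ + 1) fun s => deriv M s / M s :=
    Tame.logDeriv_of_norm_sub_one_le
      (fun s hs => ((hνd s).mul (hLd s hs)).div_const α) hM hlim le_rfl
  have hformula : ∀ s : ℂ, σ₁ + 1 ≤ s.re → deriv g s / g s =
      ((k : ℝ) : ℂ) * (1 / (s - (0 : ℝ))) + ((k : ℝ) : ℂ) * (1 / (s - (1 : ℝ))) +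
        ((Real.log D.Q - Real.log ν : ℝ) : ℂ) +
        ∑ j, (D.lam j : ℂ) * Complex.digamma ((D.lam j : ℂ) * s + D.mu j) +
        deriv M s / M s := by
    intro s hs
    have hs1 : σ₁ ≤ s.re := by linarith
    have hreg := D.regular_of_re_pos (s := s) (by linarith)
    have hev : g =ᶠ[𝓝 s] fun z => (z * (1 - z)) ^ k * D.completed L z := by
      have h1 : σ₁ < s.re := by linarith
      filter_upwards [(isOpen_lt continuous_const Complex.continuous_re).mem_nhds h1] with z hz
      have hz' : σ₁ < z.re := hz
      exact hgL z (D.regular_of_re_pos (by linarith)) fun _ => hne01 z hz'.le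
    have h2 : deriv M s / M s = (Real.log ν : ℂ) + deriv L s / L s := by
      have h3 : M = fun s => ((ν : ℂ) ^ s * L s) * α⁻¹ := by
        ext s
        simp only [hM_def]
        rw [div_eq_mul_inv]
      rw [← logDeriv_apply, h3, logDeriv_mul_const _ _ (inv_ne_zero hα),
        logDeriv_mul (f := fun s : ℂ => (ν : ℂ) ^ s) s (hν0 s) (hL0 s hs1) (hνd s) (hLd s hs1),
        logDeriv_cpow hν, logDeriv_apply]
    rw [D.logDeriv_completion hreg (fun _ => hne01 s hs1) (hLd s hs1) (hL0 s hs1) hev,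
      D.logDeriv_gammaFactor hreg, h2]
    push_cast
    ring
  have htame : Tame (σ₁ + 1) fun s => deriv g s / g s :=
    ((((((Tame.one_div_sub (by linarith)).real_mul k).add
      ((Tame.one_div_sub (by linarith)).real_mul k)).add (Tame.const _ _)).add
      (Tame.sum Finset.univ fun j _ => (Tame.digamma (by linarith) (D.lam_pos j)
        (D.mu_re j)).real_mul (D.lam j))).add hMtame).congr hformula
  have hm : ∀ z, analyticOrderNatAt g z = 0 → g z ≠ 0 := fun z =>
    (analyticOrderNatAt_eq_zero_iff hg hne).1
  refine ⟨σ₁, σ₁ + 1, hsum, by linarith, fun ρ hρ => ?_, le_rfl, fun z hz => hB z (hm z hz),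
    analyticOrderNatAt_one_sub_conj hg hne hW hFE, ?_, htame.growth, htame.odd_integral,
    htame.im_tendsto⟩
  · have h1 : ¬ σ₁ ≤ ρ.re := fun h =>
      hρ ((analyticOrderNatAt_eq_zero_iff hg hne).2 (hg0 ρ h))
    have h2 : ¬ σ₁ ≤ (1 - conj ρ).re := fun h => by
      rw [← analyticOrderNatAt_one_sub_conj hg hne hW hFE] at hρ
      exact hρ ((analyticOrderNatAt_eq_zero_iff hg hne).2 (hg0 _ h))
    simp only [Complex.sub_re, Complex.one_re, Complex.conj_re] at h2
    push Not at h1 h2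
    exact abs_le.2 ⟨by linarith, h1.le⟩
  · obtain ⟨s₀, h1, h2, h3⟩ := exists_re_logDeriv_eq_zero hg hne hW hFE
    exact ⟨s₀, h1, (analyticOrderNatAt_eq_zero_iff hg hne).2 h2, h3⟩

end GammaData

namespace GammaData

variable (D : GammaData)

section Orders

variable {L g : ℂ → ℂ} {k : ℕ}

theorem meromorphicOrderAt_completed_of_eventuallyEq (hg : Differentiable ℂ g) (hne : g ≠ 0)
    {ρ : ℂ} {p r : ℂ → ℂ} {l : ℕ} (hr : Differentiable ℂ r) (hrρ : r ρ ≠ 0)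
    (hp : ∀ z, p z = (z - ρ) ^ l * r z)
    (hgL : ∀ᶠ z in 𝓝[≠] ρ, g z = p z * D.completed L z) :
    meromorphicOrderAt (D.completed L) ρ = (analyticOrderNatAt g ρ - l : ℤ) := by
  obtain ⟨q, hq, hgq, hqρ⟩ := exists_eq_prod_sub_pow_mul hg hne {ρ}
  set n := analyticOrderNatAt g ρ with hn
  have hqr : AnalyticAt ℂ (fun z => q z / r z) ρ :=
    (hq.analyticAt ρ).div (hr.analyticAt ρ) hrρ
  have hev : ∀ᶠ z in 𝓝[≠] ρ,
      D.completed L z = (z - ρ) ^ ((n : ℤ) - l) • (fun z => q z / r z) z := by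
    have h1 : ∀ᶠ z in 𝓝[≠] ρ, r z ≠ 0 :=
      mem_nhdsWithin_of_mem_nhds (hr.continuous.continuousAt.eventually_ne hrρ)
    filter_upwards [hgL, h1, self_mem_nhdsWithin] with z hz hrz hzρ
    have hzρ' : z - ρ ≠ 0 := sub_ne_zero.2 hzρ
    rw [hgq, hp] at hz
    simp only [Finset.prod_singleton, ← hn] at hz
    rw [zpow_sub₀ hzρ', zpow_natCast, zpow_natCast, smul_eq_mul, div_mul_div_comm, hz,
      mul_div_cancel_left₀ _ (mul_ne_zero (pow_ne_zero l hzρ') hrz)]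
  have hmer : MeromorphicAt (D.completed L) ρ :=
    ((((MeromorphicAt.id ρ).sub (MeromorphicAt.const ρ ρ)).zpow ((n : ℤ) - l)).smul
      hqr.meromorphicAt).congr (hev.mono fun z hz => hz.symm)
  exact (meromorphicOrderAt_eq_int_iff hmer).2
    ⟨_, hqr, div_ne_zero (hqρ ρ (by simp)) hrρ, hev⟩

/-- The orders of the completed function in terms of the orders of its entire completion. -/
theorem meromorphicOrderAt_completed (hg : Differentiable ℂ g) (hne : g ≠ 0)
    (hgL : ∀ s, D.Regular s → (k ≠ 0 → s ≠ 0 ∧ s ≠ 1) →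
      g s = (s * (1 - s)) ^ k * D.completed L s) (ρ : ℂ) :
    meromorphicOrderAt (D.completed L) ρ =
      (analyticOrderNatAt g ρ - (if ρ = 0 ∨ ρ = 1 then k else 0 : ℕ) : ℤ) := by
  have hev : ∀ᶠ z in 𝓝[≠] ρ, g z = (z * (1 - z)) ^ k * D.completed L z := by
    filter_upwards [D.eventually_regular ρ, eventually_punctured_ne ρ 0,
      eventually_punctured_ne ρ 1] with z h1 h2 h3
    exact hgL z h1 fun _ => ⟨h2, h3⟩
  have hmain : ∃ r : ℂ → ℂ, Differentiable ℂ r ∧ r ρ ≠ 0 ∧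
      ∀ z, (z * (1 - z)) ^ k = (z - ρ) ^ (if ρ = 0 ∨ ρ = 1 then k else 0) * r z := by
    by_cases h0 : ρ = 0
    · refine ⟨fun z => (1 - z) ^ k, by fun_prop, by simp [h0], fun z => ?_⟩
      rw [if_pos (Or.inl h0), h0, sub_zero, mul_pow]
    by_cases h1 : ρ = 1
    · refine ⟨fun z => (-z) ^ k, by fun_prop, by simp [h1], fun z => ?_⟩
      rw [if_pos (Or.inr h1), h1, ← mul_pow]
      ring
    · refine ⟨fun z => (z * (1 - z)) ^ k, by fun_prop,
        pow_ne_zero _ (mul_ne_zero h0 (sub_ne_zero.2 (Ne.symm h1))), fun z => ?_⟩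
      rw [if_neg (by tauto), pow_zero, one_mul]
  obtain ⟨r, hr, hrρ, hp⟩ := hmain
  exact D.meromorphicOrderAt_completed_of_eventuallyEq hg hne hr hrρ hp hev

theorem order_add (hg : Differentiable ℂ g) (hne : g ≠ 0)
    (hgL : ∀ s, D.Regular s → (k ≠ 0 → s ≠ 0 ∧ s ≠ 1) →
      g s = (s * (1 - s)) ^ k * D.completed L s) {ρ : ℂ} (hρ : ρ = 0 ∨ ρ = 1) :
    D.order L ρ + k = analyticOrderNatAt g ρ := by
  rw [order, D.meromorphicOrderAt_completed hg hne hgL, if_pos hρ, WithTop.untop₀_coe]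
  ring

theorem mult_eq (hg : Differentiable ℂ g) (hne : g ≠ 0)
    (hgL : ∀ s, D.Regular s → (k ≠ 0 → s ≠ 0 ∧ s ≠ 1) →
      g s = (s * (1 - s)) ^ k * D.completed L s) (hk : k ≠ 0 → g 0 ≠ 0 ∧ g 1 ≠ 0) :
    D.mult L = analyticOrderNatAt g := by
  funext ρ
  rw [mult, order, D.meromorphicOrderAt_completed hg hne hgL, WithTop.untop₀_coe]
  split_ifs with h
  · rcases eq_or_ne k 0 with rfl | hk0
    · simp
    · have h1 : analyticOrderNatAt g ρ = 0 := by
        rw [analyticOrderNatAt_eq_zero_iff hg hne]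
        rcases h with rfl | rfl
        · exact (hk hk0).1
        · exact (hk hk0).2
      rw [h1]
      simp
  · simp

theorem zeros_eq (hg : Differentiable ℂ g) (hne : g ≠ 0)
    (hgL : ∀ s, D.Regular s → (k ≠ 0 → s ≠ 0 ∧ s ≠ 1) →
      g s = (s * (1 - s)) ^ k * D.completed L s) (hk : k ≠ 0 → g 0 ≠ 0 ∧ g 1 ≠ 0) :
    D.zeros L = {ρ | analyticOrderNatAt g ρ ≠ 0} := by
  rw [← D.mult_eq hg hne hgL hk]
  ext ρ
  have h := D.meromorphicOrderAt_completed hg hne hgL ρ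
  rw [zeros, Set.mem_ofPred_eq, Set.mem_ofPred_eq, mult, order, h, WithTop.untop₀_coe, ne_eq,
    Int.toNat_eq_zero, not_le]
  exact_mod_cast Iff.rfl

end Orders

end GammaData

theorem StripExpansion.hasPVSum_one_div {m : ℂ → ℕ} {h : ℂ → ℂ} {B : ℂ} {b σ : ℝ}
    (E : StripExpansion m h B b σ) :
    HasPVSum ({ρ | m ρ ≠ 0} \ {0, 1}) m (fun ρ => 1 / ρ) (-(B + m 1)) := by
  classical
  obtain ⟨s₀, -, hs₀, -⟩ := E.re_eq_zero
  have hfin : ∀ T : ℝ, {ρ ∈ {ρ | m ρ ≠ 0} \ {0, 1} | |ρ.im| ≤ T}.Finite := fun T =>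
    (E.finite_abs_im_le T).subset fun ρ hρ => ⟨hρ.1.1, hρ.2⟩
  refine ⟨hfin, ?_⟩
  have h1 := E.tendsto_sum_upTo (E.hasSum s₀ hs₀) fun ρ h0 => by simp [h0]
  have h2 := (h1.sub (E.tendsto_sum_one_div_sub hs₀)).sub_const (m 1 : ℂ)
  rw [show h s₀ - B - h s₀ - m 1 = -(B + m 1) by ring] at h2
  refine h2.congr' ?_
  filter_upwards [eventually_ge_atTop 0] with T hT
  refine Eq.trans ?_ (finsum_mem_eq_finite_toFinset_sum _ (hfin T)).symm
  rw [← Finset.sum_sub_distrib]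
  have h3 : ∀ ρ ∈ E.upTo T, (m ρ : ℂ) * (1 / (s₀ - ρ) + 1 / ρ) - (m ρ : ℂ) * (1 / (s₀ - ρ)) =
      (m ρ : ℂ) * (1 / ρ) := fun ρ _ => by ring
  rw [Finset.sum_congr rfl h3, sub_eq_iff_eq_add]
  have h4 : ∑ ρ ∈ E.upTo T, (m ρ : ℂ) * (1 / ρ) =
      ∑ ρ ∈ insert 1 (hfin T).toFinset, (m ρ : ℂ) * (1 / ρ) := by
    have h5 : ∑ ρ ∈ E.upTo T, (m ρ : ℂ) * (1 / ρ) =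
        ∑ ρ ∈ insert 1 (E.upTo T), (m ρ : ℂ) * (1 / ρ) := by
      refine Finset.sum_subset (Finset.subset_insert _ _) fun ρ hρ hρ' => ?_
      have h6 : ρ = 1 := (Finset.mem_insert.1 hρ).resolve_right hρ'
      have h7 : m ρ = 0 := by
        by_contra h
        exact hρ' (E.mem_upTo.2 ⟨h, by simpa [h6] using hT⟩)
      simp [h7]
    rw [h5]
    symm
    refine Finset.sum_subset (fun ρ hρ => ?_) fun ρ hρ hρ' => ?_
    · rw [Finset.mem_insert] at hρ ⊢
      refine hρ.imp_right fun h => ?_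
      have := (Set.Finite.mem_toFinset _).1 h
      exact E.mem_upTo.2 ⟨this.1.1, this.2⟩
    · rw [Finset.mem_insert, not_or] at hρ'
      have h6 := E.mem_upTo.1 ((Finset.mem_insert.1 hρ).resolve_left hρ'.1)
      have h7 : ρ = 0 := by
        by_contra h0
        exact hρ'.2 ((Set.Finite.mem_toFinset _).2 ⟨⟨h6.1, by simp [h0, hρ'.1]⟩, h6.2⟩)
      simp [h7]
  rw [h4, Finset.sum_insert (by simp), add_comm]
  simp

/-- Deleting the factors at `0` and `1` from a canonical product. -/
theorem hasProd_canonical_diff {m : ℂ → ℕ} {z P : ℂ} (hz : z ≠ 1)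
    (hP : HasProd (fun ρ : ℂ => ((1 - z / ρ) * Complex.exp (z / ρ)) ^ m ρ) P) :
    HasProd (fun ρ : ↥({ρ | m ρ ≠ 0} \ {0, 1} : Set ℂ) =>
      ((1 - z / (ρ : ℂ)) * Complex.exp (z / (ρ : ℂ))) ^ m ρ)
      (P * (((1 - z) * Complex.exp z) ^ m 1)⁻¹) := by
  classical
  set f : ℂ → ℂ := fun ρ => ((1 - z / ρ) * Complex.exp (z / ρ)) ^ m ρ with hf
  have hf1 : f 1 = ((1 - z) * Complex.exp z) ^ m 1 := by simp [hf]
  have hf1' : f 1 ≠ 0 := by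
    rw [hf1]
    exact pow_ne_zero _ (mul_ne_zero (sub_ne_zero.2 hz.symm) (Complex.exp_ne_zero z))
  have h1 := hP.mul (hasProd_ite_eq (1 : ℂ) (f 1)⁻¹)
  rw [← hf1]
  have h2 : (fun ρ : ↥({ρ | m ρ ≠ 0} \ {0, 1} : Set ℂ) =>
      ((1 - z / (ρ : ℂ)) * Complex.exp (z / (ρ : ℂ))) ^ m ρ) =
      (fun ρ : ℂ => f ρ * if ρ = 1 then (f 1)⁻¹ else 1) ∘
        ((↑) : ↥({ρ | m ρ ≠ 0} \ {0, 1} : Set ℂ) → ℂ) := by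
    funext ρ
    have : (ρ : ℂ) ≠ 1 := fun h => ρ.2.2 (by simp [h])
    simp only [Function.comp, if_neg this, mul_one, hf]
  rw [h2, hasProd_subtype_iff_of_mulSupport_subset]
  · exact h1
  · intro ρ hρ
    rw [Function.mem_mulSupport] at hρ
    refine ⟨fun h0 => hρ ?_, fun h0 => hρ ?_⟩
    · by_cases h : ρ = 1
      · rw [if_pos h, h, mul_inv_cancel₀ hf1']
      · simp [if_neg h, hf, h0]
    · rcases h0 with rfl | h0
      · simp [hf]
      · rw [Set.mem_singleton_iff] at h0
        rw [if_pos h0, h0, mul_inv_cancel₀ hf1']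

/-- Exponential functions that agree up to a constant on an open set have the same rate. -/
theorem eq_of_eventually_exp_eq {c A B₁ B₂ z : ℂ}
    (h : ∀ᶠ w in 𝓝 z, c * Complex.exp (B₁ * w) = Complex.exp (A + B₂ * w)) : B₁ = B₂ := by
  have h1 : HasDerivAt (fun w => c * Complex.exp (B₁ * w)) (c * (Complex.exp (B₁ * z) * B₁)) z := by
    have := ((hasDerivAt_id z).const_mul B₁).cexp.const_mul c
    simpa using this
  have h2 : HasDerivAt (fun w => Complex.exp (A + B₂ * w)) (Complex.exp (A + B₂ * z) * B₂) z := by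
    have := (((hasDerivAt_id z).const_mul B₂).const_add A).cexp
    simpa using this
  have h3 := (h2.congr_of_eventuallyEq h).unique h1
  rw [← mul_assoc, h.self_of_nhds] at h3
  exact (mul_left_cancel₀ (Complex.exp_ne_zero _) h3).symm

end Selberg

end

theorem mainTheorem9 (a : ℕ → ℂ) (L : ℂ → ℂ) (hL : Selberg.ExtendedSelbergClass a L)
    (hne : L ≠ 0) (D : Selberg.GammaData) (hD : D.FunctionalEquation L) :
    (∀ s : ℂ, L s ≠ 0 → D.Regular s → (Selberg.poleOrder L ≠ 0 → s ≠ 0 ∧ s ≠ 1) →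
      ∃ S : ℂ,
        Selberg.HasPVSum (D.zeros L) (D.mult L) (fun ρ => 1 / (s - ρ)) S ∧
        deriv L s / L s + (Selberg.poleOrder L : ℂ) / s + (Selberg.poleOrder L : ℂ) / (s - 1) =
          S - (Real.log D.Q : ℂ) - deriv D.gammaFactor s / D.gammaFactor s) ∧
    (∃ A B : ℂ, D.IsHadamardFactorization L A B) ∧
    (∀ A B : ℂ, D.IsHadamardFactorization L A B →
      ∃ S : ℂ,
        Selberg.HasPVSum (D.zeros L \ {0, 1}) (D.mult L) (fun ρ => 1 / ρ) S ∧
        B + S = 0) := by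
  obtain ⟨g, g₁, hg, hg0, hg₁, hg₁L, hfac, hFE, hgL, hk⟩ := D.exists_entire_completion hL hne hD
  have hgrowth : Selberg.GrowthBound g := by
    obtain ⟨M, hM⟩ := hL.exists_norm_le
    refine D.growthBound (M := M) hg hg₁ (fun s hs => ?_) hfac hFE
    have hs1 : s ≠ 1 := fun h => by
      rw [h, Complex.one_re] at hs
      linarith
    rw [hg₁L s hs1, norm_mul, norm_pow, mul_comm]
    exact mul_le_mul_of_nonneg_right (hM s hs) (by positivity)
  obtain ⟨hsum, c, B', hc, hB', hprod⟩ := Selberg.exists_hasSum_logDeriv hg hg0 hgrowth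
  obtain ⟨b, σ, E⟩ := D.stripExpansion hL hg hg0 hFE hgL hsum hB'
  have hev : ∀ s : ℂ, D.Regular s → (Selberg.poleOrder L ≠ 0 → s ≠ 0 ∧ s ≠ 1) →
      ∀ᶠ z in 𝓝 s, D.Regular z ∧ (Selberg.poleOrder L ≠ 0 → z ≠ 0 ∧ z ≠ 1) := by
    intro s hs hs01
    have hopen : ∀ᶠ z in 𝓝 s, D.Regular z := D.isOpen_regular.mem_nhds hs
    refine hopen.and ?_
    by_cases h : Selberg.poleOrder L = 0
    · exact Filter.Eventually.of_forall fun z h' => absurd h h'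
    · filter_upwards [isOpen_ne.mem_nhds (hs01 h).1, isOpen_ne.mem_nhds (hs01 h).2] with z h0 h1
      exact fun _ => ⟨h0, h1⟩
  have hm := D.mult_eq hg hg0 hgL hk
  have hz := D.zeros_eq hg hg0 hgL hk
  rw [hz, hm]
  have hadamard : ∀ s : ℂ, s ≠ 0 → s ≠ 1 → D.Regular s → ∃ P : ℂ,
      HasProd (fun ρ : ↥(D.zeros L \ {0, 1}) =>
        ((1 - s / (ρ : ℂ)) * Complex.exp (s / (ρ : ℂ))) ^ D.mult L ρ) P ∧
      (s * (1 - s)) ^ Selberg.poleOrder L * D.completed L s =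
        s ^ (D.order L 0 + Selberg.poleOrder L) * (1 - s) ^ (D.order L 1 + Selberg.poleOrder L) *
          (c * Complex.exp ((B' + analyticOrderNatAt g 1) * s)) * P := by
    intro s hs0 hs1 hreg
    obtain ⟨P, hP, hgP⟩ := hprod s
    rw [hz, hm, D.order_add hg hg0 hgL (Or.inl rfl), D.order_add hg hg0 hgL (Or.inr rfl)]
    refine ⟨_, Selberg.hasProd_canonical_diff hs1 hP, ?_⟩
    have h1 : (1 - s) ^ analyticOrderNatAt g 1 ≠ 0 := pow_ne_zero _ (sub_ne_zero.2 hs1.symm)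
    have h2 : Complex.exp s ^ analyticOrderNatAt g 1 ≠ 0 := pow_ne_zero _ (Complex.exp_ne_zero s)
    rw [← hgL s hreg fun _ => ⟨hs0, hs1⟩, hgP, add_mul, Complex.exp_add, Complex.exp_nat_mul,
      mul_pow, zpow_natCast, zpow_natCast]
    field_simp
  refine ⟨fun s hLs hreg hs01 => ?_, ?_, fun A B hAB => ?_⟩
  · have hgs : g s ≠ 0 := by
      rw [hgL s hreg hs01]
      refine mul_ne_zero ?_ (mul_ne_zero (D.archFactor_ne_zero hreg) hLs)
      by_cases h : Selberg.poleOrder L = 0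
      · simp [h]
      · exact pow_ne_zero _ (mul_ne_zero (hs01 h).1 (sub_ne_zero.2 (hs01 h).2.symm))
    refine ⟨_, E.hasPVSum ((Selberg.analyticOrderNatAt_eq_zero_iff hg hg0).2 hgs), ?_⟩
    rw [D.logDeriv_completion hreg hs01 (hL.differentiableAt fun h => (hs01 h).2) hLs
      ((hev s hreg hs01).mono fun z hz => hgL z hz.1 hz.2)]
    ring
  · refine ⟨Complex.log c, B' + analyticOrderNatAt g 1, fun s hs0 hs1 hreg => ?_⟩
    rw [Complex.exp_add, Complex.exp_log hc]
    exact hadamard s hs0 hs1 hreg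
  · refine ⟨_, E.hasPVSum_one_div, ?_⟩
    have hgen : ∃ s : ℂ, D.Regular s ∧ s ≠ 0 ∧ s ≠ 1 ∧ g s ≠ 0 := by
      obtain ⟨s₀, hre, hs₀, -⟩ := E.re_eq_zero
      refine ⟨s₀, D.regular_of_re_pos (by rw [hre]; norm_num), ?_, ?_,
        (Selberg.analyticOrderNatAt_eq_zero_iff hg hg0).1 hs₀⟩
      · rintro rfl
        norm_num at hre
      · rintro rfl
        norm_num at hre
    obtain ⟨s₀, hreg₀, hs₀0, hs₀1, hgs₀⟩ := hgen
    have heq : B' + analyticOrderNatAt g 1 = B := by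
      refine Selberg.eq_of_eventually_exp_eq (c := c) (A := A) (z := s₀) ?_
      filter_upwards [hev s₀ hreg₀ fun _ => ⟨hs₀0, hs₀1⟩, isOpen_ne.mem_nhds hs₀0,
        isOpen_ne.mem_nhds hs₀1, hg.continuous.continuousAt.eventually_ne hgs₀]
        with z hzreg hz0 hz1 hgz
      obtain ⟨P, hP, h1⟩ := hadamard z hz0 hz1 hzreg.1
      obtain ⟨P', hP', h2⟩ := hAB z hz0 hz1 hzreg.1
      rw [hP'.unique hP, h1] at h2
      rw [hgL z hzreg.1 hzreg.2, h1] at hgz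
      have hP0 : P ≠ 0 := right_ne_zero_of_mul hgz
      have hz0' := left_ne_zero_of_mul (left_ne_zero_of_mul hgz)
      exact mul_left_cancel₀ hz0' (mul_right_cancel₀ hP0 h2)
    rw [heq]
    ring
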